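/- Let $(M,g)$ be a Riemannian manifold with three complex structures $I,J,K$ on $M$ satisfying $I^2=J^2=K^2=IJK=-1$, such that $(M,g)$ is Kähler with respect to each of them (a hyperkähler manifold, not necessarily compact). For $C\in\{I,J,K\}$ let $C$ act on covectors by $C\alpha=\alpha\circ C^{-1}$ (the action on $TM$ transported to $T^*M$ by $g$), and let $ad_C$ be the derivation of the algebra of (real or complex valued) differential forms extending it, $ad_C(\alpha_1\wedge\dots\wedge\alpha_k)=\sum_i\alpha_1\wedge\dots\wedge C(\alpha_i)\wedge\dots\wedge\alpha_k$. Let $d_C=[ad_C,d]$, and let $N$ be the operator acting on $k$-forms as multiplication by $k$. For a quaternion $x=x^0+x^1i+x^2j+x^3k$ with real $x^0,\dots,x^3$ put $$d_x=x^0d+x^1d_I+x^2d_J+x^3d_K,\qquad \hat x=x^0N+x^1\,ad_I+x^2\,ad_J+x^3\,ad_K .$$ Let ${}^*$ denote the (formal) adjoint with respect to the $L^2$ scalar product of forms defined by $g$, and $\Delta=dd^*+d^*d$. Then the operators $d_y$ have such adjoints $d_y^*$ on smooth forms, and for all quaternions $x,y$, on smooth differential forms: (i) $[\hat x,d_y]=\hat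 x\,d_y-d_y\,\hat x=d_{xy}$; (ii) $\{d_x,d_y\}=d_xd_y+d_yd_x=0$; (iii) $\{d_x,d_y^*\}=d_xd_y^*+d_y^*d_x=\mathrm{Re}(\bar x y)\,\Delta$. -/

import Mathlib

open scoped ContDiff Manifold Quaternion

noncomputable section

namespace HK

/-! ### Differential forms, exterior derivative -/

section Forms

variable (m : ℕ) (M : Type*) [TopologicalSpace M] [ChartedSpace (EuclideanSpace ℝ (Fin m)) M]
  (𝕜 : Type*) [RCLike 𝕜]

/-- `k`-forms on the `m`-manifold `M` with values in `𝕜` (`ℝ` or `ℂ`), without regularity. -/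
abbrev KForm (k : ℕ) : Type _ := (x : M) → (TangentSpace (𝓡 m) x) [⋀^Fin k]→L[ℝ] 𝕜

/-- Differential forms of mixed degree: `η k` is the component of degree `k`. As `k`-forms vanish
for `k > m`, the product over all `k` is the direct sum. -/
abbrev Form : Type _ := (k : ℕ) → KForm m M 𝕜 k

/-- A field of endomorphisms of the tangent spaces. -/
abbrev EndField : Type _ := (x : M) → TangentSpace (𝓡 m) x →L[ℝ] TangentSpace (𝓡 m) x

variable {m M 𝕜}

/-- The differential at `y` of the inverse of the preferred chart at `c`. -/
def chartInvDeriv (c : M) (y : EuclideanSpace ℝ (Fin m)) :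
    EuclideanSpace ℝ (Fin m) →L[ℝ] TangentSpace (𝓡 m) ((extChartAt (𝓡 m) c).symm y) :=
  mfderiv 𝓘(ℝ, EuclideanSpace ℝ (Fin m)) (𝓡 m) (extChartAt (𝓡 m) c).symm y

/-- The differential at `c` of the preferred chart at `c`. -/
def chartDeriv (c : M) : TangentSpace (𝓡 m) c →L[ℝ] EuclideanSpace ℝ (Fin m) :=
  mfderiv (𝓡 m) 𝓘(ℝ, EuclideanSpace ℝ (Fin m)) (extChartAt (𝓡 m) c) c

/-- The expression of a `k`-form in the preferred chart at `c`: its pullback by the inverse of the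
chart. It is meaningful on the target of the chart. -/
def KForm.inChart {k : ℕ} (η : KForm m M 𝕜 k) (c : M) (y : EuclideanSpace ℝ (Fin m)) :
    (EuclideanSpace ℝ (Fin m)) [⋀^Fin k]→L[ℝ] 𝕜 :=
  (η ((extChartAt (𝓡 m) c).symm y)).compContinuousLinearMap (chartInvDeriv c y)

/-- A `k`-form is smooth if its expressions in charts are. -/
def KForm.IsSmooth {k : ℕ} (η : KForm m M 𝕜 k) : Prop :=
  ∀ c : M, ContDiffOn ℝ ∞ (η.inChart c) (extChartAt (𝓡 m) c).target

/-- The exterior derivative of a `k`-form, computed at `x` in the preferred chart at `x`. -/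
def KForm.d {k : ℕ} (η : KForm m M 𝕜 k) : KForm m M 𝕜 (k + 1) := fun x ↦
  (extDeriv (η.inChart x) (extChartAt (𝓡 m) x x)).compContinuousLinearMap (chartDeriv x)

/-- A form of mixed degree is smooth if all its components are. -/
def Form.IsSmooth (η : Form m M 𝕜) : Prop := ∀ k, KForm.IsSmooth (η k)

/-- A form of mixed degree with compact support. -/
def Form.IsCompactlySupported (η : Form m M 𝕜) : Prop :=
  ∃ S : Set M, IsCompact S ∧ ∀ k, ∀ x ∉ S, η k x = 0

/-- The exterior derivative `d` on forms of mixed degree. -/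
def Form.d (η : Form m M 𝕜) : Form m M 𝕜
  | 0 => 0
  | k + 1 => KForm.d (η k)

/-- The grading operator `N`, acting on `k`-forms as multiplication by `k`. -/
def Form.grading (η : Form m M 𝕜) : Form m M 𝕜 := fun k ↦ (k : ℝ) • η k

end Forms

/-! ### The derivation `ad_C` of the algebra of forms -/

section Ad

theorem derivExt_aux {V : Type*} [AddCommGroup V] [Module ℝ V] [TopologicalSpace V]
    {k : ℕ} (B : V →L[ℝ] V) (v : Fin k → V) (i : Fin k) :
    (fun j ↦ (if j = i then B else ContinuousLinearMap.id ℝ V) (v j)) =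
      Function.update v i (B (v i)) := by
  funext j
  by_cases h : j = i
  · subst h; simp
  · simp [h]

/-- The alternating map `(v₁, …, v_k) ↦ ∑ᵢ α (v₁, …, B vᵢ, …, v_k)`. On `α₁ ∧ … ∧ α_k` it is
`∑ᵢ α₁ ∧ … ∧ (αᵢ ∘ B) ∧ … ∧ α_k`. -/
def derivExt {V F : Type*} [AddCommGroup V] [Module ℝ V] [TopologicalSpace V]
    [AddCommGroup F] [Module ℝ F] [TopologicalSpace F] [IsTopologicalAddGroup F]
    {k : ℕ} (B : V →L[ℝ] V) (α : V [⋀^Fin k]→L[ℝ] F) : V [⋀^Fin k]→L[ℝ] F where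
  toContinuousMultilinearMap := ∑ i : Fin k,
    α.toContinuousMultilinearMap.compContinuousLinearMap
      (fun j ↦ if j = i then B else ContinuousLinearMap.id ℝ V)
  map_eq_zero_of_eq' v a b hv hab := by
    change (∑ i : Fin k, α.toContinuousMultilinearMap.compContinuousLinearMap
      (fun j ↦ if j = i then B else ContinuousLinearMap.id ℝ V)) v = 0
    simp only [sum_apply, ContinuousMultilinearMap.compContinuousLinearMap_apply, derivExt_aux,
      ContinuousAlternatingMap.coe_toContinuousMultilinearMap]
    rw [Finset.sum_eq_add a b hab]
    · have hs : Function.update v b (B (v b)) =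
          Function.update v a (B (v a)) ∘ Equiv.swap a b := by
        funext j
        by_cases hja : j = a
        · subst hja; simp [hab, hv, hab.symm]
        · by_cases hjb : j = b
          · subst hjb; simp [hv]
          · simp [Equiv.swap_apply_of_ne_of_ne hja hjb, hja, hjb]
      rw [hs]
      have : α (Function.update v a (B (v a)) ∘ Equiv.swap a b) =
          -α (Function.update v a (B (v a))) :=
        α.toAlternatingMap.map_swap (Function.update v a (B (v a))) hab
      rw [this, add_neg_cancel]
    · intro i _ hi
      refine α.map_eq_zero_of_eq _ ?_ hab
      simp [hi.1.symm, hi.2.symm, hv]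
    · simp
    · simp

theorem derivExt_apply {V F : Type*} [AddCommGroup V] [Module ℝ V] [TopologicalSpace V]
    [AddCommGroup F] [Module ℝ F] [TopologicalSpace F] [IsTopologicalAddGroup F]
    {k : ℕ} (B : V →L[ℝ] V) (α : V [⋀^Fin k]→L[ℝ] F) (v : Fin k → V) :
    derivExt B α v = ∑ i, α (Function.update v i (B (v i))) := by
  change (∑ i : Fin k, α.toContinuousMultilinearMap.compContinuousLinearMap
      (fun j ↦ if j = i then B else ContinuousLinearMap.id ℝ V)) v = _
  simp only [sum_apply, ContinuousMultilinearMap.compContinuousLinearMap_apply, derivExt_aux,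
    ContinuousAlternatingMap.coe_toContinuousMultilinearMap]

variable {m : ℕ} {M : Type*} [TopologicalSpace M] [ChartedSpace (EuclideanSpace ℝ (Fin m)) M]
  {𝕜 : Type*} [RCLike 𝕜]

/-- The operator `ad_C`. An almost complex structure `C` acts on covectors by
`C α = α ∘ C⁻¹ = -α ∘ C` (this is the action of `C` on tangent vectors transported by the
identification of `TM` with `T*M` by a Hermitian metric), and `ad_C` is its extension to forms
as a derivation. -/
def Form.ad (C : EndField m M) (η : Form m M 𝕜) : Form m M 𝕜 :=
  fun k x ↦ derivExt (-(C x)) (η k x)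

/-- The twisted differential `d_C = [ad_C, d]`. -/
def Form.dC (C : EndField m M) (η : Form m M 𝕜) : Form m M 𝕜 :=
  Form.ad C (Form.d η) - Form.d (Form.ad C η)

/-- The operator `d_x = x⁰ d + x¹ d_I + x² d_J + x³ d_K`. -/
def Form.dQ (I J K : EndField m M) (x : ℍ[ℝ]) (η : Form m M 𝕜) : Form m M 𝕜 :=
  x.re • Form.d η + x.imI • Form.dC I η + x.imJ • Form.dC J η + x.imK • Form.dC K η

/-- The operator `x̂ = x⁰ N + x¹ ad_I + x² ad_J + x³ ad_K`. -/
def Form.hat (I J K : EndField m M) (x : ℍ[ℝ]) (η : Form m M 𝕜) : Form m M 𝕜 :=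
  x.re • Form.grading η + x.imI • Form.ad I η + x.imJ • Form.ad J η + x.imK • Form.ad K η

end Ad

/-! ### Kähler and hyperkähler structures -/

section Kahler

variable {m : ℕ} {M : Type*} [TopologicalSpace M] [ChartedSpace (EuclideanSpace ℝ (Fin m)) M]
  [IsManifold (𝓡 m) ∞ M]

/-- Smooth Riemannian metrics on `M`. -/
abbrev Metric (m : ℕ) (M : Type*) [TopologicalSpace M]
    [ChartedSpace (EuclideanSpace ℝ (Fin m)) M] [IsManifold (𝓡 m) ∞ M] : Type _ :=
  Bundle.ContMDiffRiemannianMetric (𝓡 m) ∞ (EuclideanSpace ℝ (Fin m))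
    (fun x : M ↦ TangentSpace (𝓡 m) x)

/-- Smooth fields of endomorphisms of the tangent bundle. -/
def EndField.IsSmooth (C : EndField m M) : Prop :=
  ContMDiff (𝓡 m) ((𝓡 m).prod 𝓘(ℝ, EuclideanSpace ℝ (Fin m) →L[ℝ] EuclideanSpace ℝ (Fin m))) ∞
    (fun x : M ↦ Bundle.TotalSpace.mk' (EuclideanSpace ℝ (Fin m) →L[ℝ] EuclideanSpace ℝ (Fin m))
      (E := fun x : M ↦ TangentSpace (𝓡 m) x →L[ℝ] TangentSpace (𝓡 m) x) x (C x))

/-- The vector field `V` is smooth near `x`. -/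
def IsSmoothFieldAt (V : (x : M) → TangentSpace (𝓡 m) x) (x : M) : Prop :=
  ContMDiffAt (𝓡 m) (𝓡 m).tangent ∞ (fun p ↦ (⟨p, V p⟩ : TangentBundle (𝓡 m) M)) x

/-- The Nijenhuis bracket `[CV, CW] - C [CV, W] - C [V, CW] - [V, W]` of two vector fields. -/
def nijenhuis (C : EndField m M) (V W : (x : M) → TangentSpace (𝓡 m) x) (x : M) :
    TangentSpace (𝓡 m) x :=
  VectorField.mlieBracket (𝓡 m) (fun p ↦ C p (V p)) (fun p ↦ C p (W p)) x
    - C x (VectorField.mlieBracket (𝓡 m) (fun p ↦ C p (V p)) W x)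
    - C x (VectorField.mlieBracket (𝓡 m) V (fun p ↦ C p (W p)) x)
    - VectorField.mlieBracket (𝓡 m) V W x

/-- Complex structures on the manifold: integrable smooth almost complex structures. -/
structure IsComplexStructure (C : EndField m M) : Prop where
  smooth : EndField.IsSmooth C
  sq : ∀ x v, C x (C x v) = -v
  integrable : ∀ x V W, IsSmoothFieldAt V x → IsSmoothFieldAt W x → nijenhuis C V W x = 0

/-- `(M, g)` is Kähler with respect to `C`: `C` is a complex structure, `g` is Hermitian, and
`g (C ·, ·)` is a closed 2-form. -/
structure IsKahler (g : Metric m M) (C : EndField m M) : Prop where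
  complex : IsComplexStructure C
  hermitian : ∀ x v w, g.inner x (C x v) (C x w) = g.inner x v w
  closed : ∃ η : KForm m M ℝ 2, (∀ x v w, η x ![v, w] = g.inner x (C x v) w) ∧ η.d = 0

/-- `(M, g, I, J, K)` is a hyperkähler manifold. -/
structure IsHyperkahler (g : Metric m M) (I J K : EndField m M) : Prop where
  kahlerI : IsKahler g I
  kahlerJ : IsKahler g J
  kahlerK : IsKahler g K
  /-- `IJK = -1`; together with `I² = J² = K² = -1` these are the quaternionic identities -/
  ijk : ∀ x v, I x (J x (K x v)) = -v

end Kahler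

/-! ### Scalar product of forms and formal adjoints -/

section Adjoint

variable {m : ℕ} {M : Type*} [TopologicalSpace M] [ChartedSpace (EuclideanSpace ℝ (Fin m)) M]
  [IsManifold (𝓡 m) ∞ M] {𝕜 : Type*} [RCLike 𝕜]

/-- A basis of `T_x M`: the coordinate vectors of the preferred chart at `x`, through which
`TangentSpace (𝓡 m) x` is by definition the model space. -/
def stdVec (x : M) (i : Fin m) : TangentSpace (𝓡 m) x :=
  (EuclideanSpace.single i (1 : ℝ) : EuclideanSpace ℝ (Fin m))

/-- The matrix `g_ij` of the metric at `x`. -/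
def gram (g : Metric m M) (x : M) : Matrix (Fin m) (Fin m) ℝ :=
  Matrix.of fun i j ↦ g.inner x (stdVec x i) (stdVec x j)

/-- The scalar product of `k`-covectors at `x` induced by the metric,
`(1 / k!) g^{i₁j₁} ⋯ g^{i_kj_k} conj(α_{i₁…i_k}) β_{j₁…j_k}`. -/
def formInner (g : Metric m M) {k : ℕ} (x : M)
    (α β : (TangentSpace (𝓡 m) x) [⋀^Fin k]→L[ℝ] 𝕜) : 𝕜 :=
  ((k.factorial : ℝ)⁻¹ : ℝ) • ∑ i : Fin k → Fin m, ∑ j : Fin k → Fin m,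
    (∏ a, (gram g x)⁻¹ (i a) (j a)) •
      (starRingEnd 𝕜 (α fun a ↦ stdVec x (i a)) * β fun a ↦ stdVec x (j a))

/-- The matrix `g_ij` of the metric in the preferred chart at `c`, at the point of coordinates
`y`. -/
def gramInChart (g : Metric m M) (c : M) (y : EuclideanSpace ℝ (Fin m)) :
    Matrix (Fin m) (Fin m) ℝ :=
  Matrix.of fun i j ↦ g.inner ((extChartAt (𝓡 m) c).symm y)
    (chartInvDeriv c y (EuclideanSpace.single i 1)) (chartInvDeriv c y (EuclideanSpace.single j 1))

/-- The Riemannian measure of the domain of the preferred chart at `c`, of density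
`√(det g_ij)` in the coordinates. -/
def chartVolume [MeasurableSpace M] (g : Metric m M) (c : M) : MeasureTheory.Measure M :=
  ((MeasureTheory.volume.restrict (extChartAt (𝓡 m) c).target).withDensity
    (fun y ↦ ENNReal.ofReal (Real.sqrt (gramInChart g c y).det))).map (extChartAt (𝓡 m) c).symm

/-- The Riemannian measure of `M`. The measures of the chart domains agree on overlaps, so their
supremum is the measure that restricts to `√(det g_ij) dy¹ ⋯ dyᵐ` on each of them. -/
def riemannianVolume [MeasurableSpace M] (g : Metric m M) : MeasureTheory.Measure M :=
  ⨆ c : M, chartVolume g c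

/-- The scalar product `∫ ⟨α, β⟩ dvol` of forms; different degrees are orthogonal, and degrees
greater than `m` do not contribute. -/
def formL2Inner [MeasurableSpace M] (g : Metric m M) (α β : Form m M 𝕜) : 𝕜 :=
  ∫ x, ∑ k ∈ Finset.range (m + 1), formInner g x (α k x) (β k x) ∂(riemannianVolume g)

/-- The operator `δ` on smooth forms is the (formal) adjoint of `D`. -/
structure IsFormalAdjoint [MeasurableSpace M] (g : Metric m M)
    (D δ : Form m M 𝕜 → Form m M 𝕜) : Prop where
  smooth : ∀ β, Form.IsSmooth β → Form.IsSmooth (δ β)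
  adjoint : ∀ α β, Form.IsSmooth α → Form.IsCompactlySupported α → Form.IsSmooth β →
    formL2Inner g (D α) β = formL2Inner g α (δ β)

end Adjoint

end HK

end

/-! Everything rests on one geometric fact: on a Kähler manifold the complex structure is parallel.
Write `Alt` for the alternation `alternatizeUncurryFin`, ∇ for the covariant derivative `covd` in a
chart, and A_* for `derivExt A`. Since the Levi-Civita connection is torsion free, dσ = Alt(∇σ). If
A is parallel, A_* commutes with ∇, so [A_*, d]σ = Alt(∇σ ∘ A), and more generally the bracket of
A_* with σ ↦ Alt(∇σ ∘ B) is σ ↦ Alt(∇σ ∘ BA). With A = -C and B = -C' this shows that ad_I, ad_J,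
ad_K act by brackets on d, d_I, d_J, d_K as i, j, k act on 1, i, j, k by left multiplication
(`isQuatModule_dQuad`). Expanding bilinearly, and using that every one of these differentials raises
the degree by one, gives (i).

For (ii), bracketing with ad_C is a derivation of anticommutators (`commutator_anticommutator`).
Bracketing d² = 0 gives {d, d_C} = 0, and further brackets give all the other relations
(`IsQuatModule.anticommutator_self`).

For (iii), let Λ_C be the contraction with the bivector of C. The Kähler identity d_C^* = [Λ_C, d]
together with d² = 0 gives {d, d_C^*} = 0 (`dEnd_anticommute_deltaCEnd`). As ad_C is skew-adjoint,
the quaternionic relations pass to the adjoints (`isQuatModule_deltaQuad`). Bracketing {d, d_C^*} =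
0 repeatedly with the ad's then yields {d_i, d_j^*} = 0 for i ≠ j and {d_C, d_C^*} = {d, d^*}
(`IsQuatModule.anticommutator`).

The Kähler identity is proved as an adjointness statement. Both d_C and [Λ_C, d] are first-order
expressions in ∇, and in each chart the difference of the two pointwise products is, up to the
density, a divergence (`sum_fderiv_flux`). It integrates to zero for forms supported in a chart, and
a partition of unity gives the general case (`integral_adjointDefect`). No separate argument is
needed for d^*: since d = -[ad_I, d_I], it is -[ad_I, d_I^*]. Formal adjoints are unique on smooth
forms because the scalar product is nondegenerate against compactly supported ones
(`eq_of_l2Inner`), so the conclusion holds for any given adjoints.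

The connection enters only through one-jets at a point. `exists_christoffel` supplies a symmetric Γ
from the first derivative of the metric, and `parallel_of_kahler` derives from the Hermitian,
closedness and Nijenhuis conditions that the derivative of C is CΓ - ΓC. -/

noncomputable section
namespace HK

set_option linter.unusedSectionVars false

/-! ### Derivations and alternation of multilinear forms -/

section MultilinearAlgebra

open ContinuousAlternatingMap

variable {V F : Type*} [NormedAddCommGroup V] [NormedSpace ℝ V] [NormedAddCommGroup F]
  [NormedSpace ℝ F] {k : ℕ}

theorem derivExt_add_right (B : V →L[ℝ] V) (α β : V [⋀^Fin k]→L[ℝ] F) :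
    derivExt B (α + β) = derivExt B α + derivExt B β := by
  ext v; simp [derivExt_apply, Finset.sum_add_distrib]

theorem derivExt_smul_right (B : V →L[ℝ] V) (r : ℝ) (α : V [⋀^Fin k]→L[ℝ] F) :
    derivExt B (r • α) = r • derivExt B α := by
  ext v; simp [derivExt_apply, Finset.smul_sum]

theorem derivExt_add_left (A B : V →L[ℝ] V) (α : V [⋀^Fin k]→L[ℝ] F) :
    derivExt (A + B) α = derivExt A α + derivExt B α := by
  ext v; simp [derivExt_apply, Finset.sum_add_distrib]

theorem derivExt_smul_left (r : ℝ) (B : V →L[ℝ] V) (α : V [⋀^Fin k]→L[ℝ] F) :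
    derivExt (r • B) α = r • derivExt B α := by
  ext v; simp [derivExt_apply, Finset.smul_sum]

theorem norm_derivExt_le (B : V →L[ℝ] V) (α : V [⋀^Fin k]→L[ℝ] F) :
    ‖derivExt B α‖ ≤ k * ‖B‖ * ‖α‖ := by
  refine opNorm_le_bound _ (by positivity) fun v ↦ ?_
  rw [derivExt_apply]
  refine (norm_sum_le _ _).trans ?_
  have h : ∀ i ∈ (Finset.univ : Finset (Fin k)),
      ‖α (Function.update v i (B (v i)))‖ ≤ ‖B‖ * ‖α‖ * ∏ j, ‖v j‖ := by
    intro i _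
    refine (α.le_opNorm _).trans ?_
    have h2 : ∏ j, ‖Function.update v i (B (v i)) j‖ ≤ ‖B‖ * ∏ j, ‖v j‖ := by
      rw [← Finset.mul_prod_erase _ _ (Finset.mem_univ i),
        ← Finset.mul_prod_erase _ (fun j ↦ ‖v j‖) (Finset.mem_univ i), ← mul_assoc]
      simp only [Function.update_self]
      refine mul_le_mul (B.le_opNorm _) (le_of_eq ?_) (by positivity) (by positivity)
      refine Finset.prod_congr rfl fun j hj ↦ ?_
      rw [Function.update_of_ne (Finset.ne_of_mem_erase hj)]
    calc ‖α‖ * ∏ j, ‖Function.update v i (B (v i)) j‖ ≤ ‖α‖ * (‖B‖ * ∏ j, ‖v j‖) := by gcongr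
      _ = _ := by ring
  refine (Finset.sum_le_sum h).trans (le_of_eq ?_)
  simp; ring

variable (V F k) in
/-- `derivExt` as a continuous bilinear map. -/
def derivExtL : (V →L[ℝ] V) →L[ℝ] (V [⋀^Fin k]→L[ℝ] F) →L[ℝ] (V [⋀^Fin k]→L[ℝ] F) :=
  LinearMap.mkContinuous₂
    (LinearMap.mk₂ ℝ derivExt derivExt_add_left derivExt_smul_left derivExt_add_right
      fun r B α ↦ derivExt_smul_right B r α) k norm_derivExt_le

@[simp]
theorem derivExtL_apply (B : V →L[ℝ] V) (α : V [⋀^Fin k]→L[ℝ] F) :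
    derivExtL V F k B α = derivExt B α := rfl

theorem derivExt_degree_zero (B : V →L[ℝ] V) (α : V [⋀^Fin 0]→L[ℝ] F) : derivExt B α = 0 := by
  ext v; simp [derivExt_apply]

/-- The last term is the summand in which B hits the slot occupied by x. This identity drives the
inductions on the degree below. -/
theorem derivExt_curryLeft (B : V →L[ℝ] V) (α : V [⋀^Fin (k + 1)]→L[ℝ] F) (x : V) :
    (derivExt B α).curryLeft x = derivExt B (α.curryLeft x) + α.curryLeft (B x) := by
  ext v
  rw [ContinuousAlternatingMap.add_apply, curryLeft_apply_apply, curryLeft_apply_apply, derivExt_apply,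
    derivExt_apply, Fin.sum_univ_succ, add_comm]
  refine congrArg₂ (· + ·) ?_ ?_
  · refine Finset.sum_congr rfl fun i _ ↦ congrArg α ?_
    funext j
    refine Fin.cases ?_ (fun j ↦ ?_) j
    · rw [Function.update_of_ne (Fin.succ_ne_zero i).symm]; rfl
    · by_cases h : j = i
      · subst h; simp
      · simp [h]
  · refine congrArg α ?_
    funext j
    refine Fin.cases ?_ (fun j ↦ ?_) j <;> simp [Matrix.vecCons]

theorem ext_curryLeft {α β : V [⋀^Fin (k + 1)]→L[ℝ] F}
    (h : ∀ x, α.curryLeft x = β.curryLeft x) : α = β := by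
  ext v
  have := congrArg (fun γ ↦ γ (Fin.tail v)) (h (v 0))
  simpa [Matrix.vecCons] using this

variable (F k) in
/-- Contraction of a form with a vector, as a continuous linear map. -/
def contractL (x : V) : (V [⋀^Fin (k + 1)]→L[ℝ] F) →L[ℝ] V [⋀^Fin k]→L[ℝ] F :=
  ContinuousLinearMap.apply ℝ _ x ∘L
    (curryLeftLI : (V [⋀^Fin (k + 1)]→L[ℝ] F) →ₗᵢ[ℝ] _).toContinuousLinearMap

@[simp]
theorem contractL_apply (x : V) (α : V [⋀^Fin (k + 1)]→L[ℝ] F) :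
    contractL F k x α = α.curryLeft x := rfl

/-- The order on the right is reversed because endomorphisms act on forms by precomposition. -/
theorem derivExt_derivExt_sub (A B : V →L[ℝ] V) (α : V [⋀^Fin k]→L[ℝ] F) :
    derivExt B (derivExt A α) - derivExt A (derivExt B α) =
      derivExt (A ∘L B - B ∘L A) α := by
  induction k with
  | zero => simp [derivExt_degree_zero]
  | succ k ih =>
    refine ext_curryLeft fun x ↦ ?_
    have h1 := ih (α.curryLeft x)
    have e : ∀ β γ : V [⋀^Fin (k + 1)]→L[ℝ] F,
      (β - γ).curryLeft x = β.curryLeft x - γ.curryLeft x := fun _ _ ↦ rfl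
    rw [e]
    simp only [derivExt_curryLeft, derivExt_add_right, ← h1, _root_.sub_apply, map_sub,
      ContinuousLinearMap.comp_apply]
    abel

/-- Leibniz rule for contraction: the term of the alternation that feeds x to φ is split off, and
moving x past one slot in the others costs a sign. -/
theorem curryLeft_alternatizeUncurryFin (φ : V →L[ℝ] V [⋀^Fin (k + 1)]→L[ℝ] F) (x : V) :
    (alternatizeUncurryFin φ).curryLeft x =
      φ x - alternatizeUncurryFin (contractL F k x ∘L φ) := by
  ext v
  rw [ContinuousAlternatingMap.sub_apply, curryLeft_apply_apply, alternatizeUncurryFin_apply,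
    alternatizeUncurryFin_apply, Fin.sum_univ_succ, sub_eq_add_neg, ← Finset.sum_neg_distrib]
  refine congrArg₂ (· + ·) ?_ ?_
  · simp [Matrix.vecCons, Fin.removeNth_zero]
  · refine Finset.sum_congr rfl fun i _ ↦ ?_
    have : Fin.removeNth i.succ (Matrix.vecCons x v) = Matrix.vecCons x (Fin.removeNth i v) := by
      funext j
      refine Fin.cases ?_ (fun j ↦ ?_) j <;> simp [Fin.removeNth, Matrix.vecCons]
    rw [this]
    simp [pow_succ]

theorem curryLeft_alternatizeUncurryFin_zero (φ : V →L[ℝ] V [⋀^Fin 0]→L[ℝ] F) (x : V) :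
    (alternatizeUncurryFin φ).curryLeft x = φ x := by
  ext v
  simp [alternatizeUncurryFin_apply, Matrix.vecCons, Fin.removeNth_zero]

/-- This is the formula Σ eᵃ ∧ i_{A eₐ} α for the derivation; the sign of the alternation cancels
the one from inserting A vᵢ at position i. For A the identity it recovers a multiple of α from its
contractions. -/
theorem alternatizeUncurryFin_curryLeft_comp (A : V →L[ℝ] V) (α : V [⋀^Fin (k + 1)]→L[ℝ] F) :
    alternatizeUncurryFin (α.curryLeft ∘L A) = derivExt A α := by
  ext v
  simp only [alternatizeUncurryFin_apply, derivExt_apply, ContinuousLinearMap.comp_apply,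
    curryLeft_apply_apply, ← map_insertNth]
  refine Finset.sum_congr rfl fun i _ ↦ congrArg α ?_
  simp

/-- The derivation either hits the differentiation slot of φ or one of its form slots. The first
term is what survives in [ad_C, d]. -/
theorem derivExt_alternatizeUncurryFin (A : V →L[ℝ] V) (φ : V →L[ℝ] V [⋀^Fin k]→L[ℝ] F) :
    derivExt A (alternatizeUncurryFin φ) =
      alternatizeUncurryFin (φ ∘L A) + alternatizeUncurryFin (derivExtL V F k A ∘L φ) := by
  ext v
  simp only [derivExt_apply, alternatizeUncurryFin_apply, ContinuousAlternatingMap.add_apply,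
    ContinuousLinearMap.comp_apply, derivExtL_apply]
  rw [Finset.sum_comm, ← Finset.sum_add_distrib]
  refine Finset.sum_congr rfl fun i _ ↦ ?_
  rw [Fin.sum_univ_succAbove _ i, Finset.smul_sum]
  congr 1
  · simp
  · refine Finset.sum_congr rfl fun l _ ↦ ?_
    rw [Function.update_of_ne (Fin.succAbove_ne i l).symm, Fin.removeNth_update_succAbove]
    rfl

/-- Vanishing torsion: symmetric Christoffel symbols cancel on alternation, so d may be computed
with ∇ in place of partial derivatives. In the inductive step, contraction produces Alt(i_{Γ(x)·}
α), which is the derivation Γ(x)_* α and cancels the other term. -/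
theorem alternatizeUncurryFin_derivExt_of_symm (Γ : V →L[ℝ] V →L[ℝ] V)
    (hΓ : ∀ u v, Γ u v = Γ v u) (α : V [⋀^Fin k]→L[ℝ] F) :
    alternatizeUncurryFin ((derivExtL V F k).flip α ∘L Γ) = 0 := by
  induction k with
  | zero =>
    have : (derivExtL V F 0).flip α ∘L Γ = 0 := by
      ext u : 1; simp [derivExt_degree_zero]
    rw [this]; ext; simp [alternatizeUncurryFin_apply]
  | succ k ih =>
    refine ext_curryLeft fun x ↦ ?_
    rw [curryLeft_alternatizeUncurryFin, curryLeft_zero, _root_.zero_apply]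
    have : contractL F k x ∘L ((derivExtL V F (k + 1)).flip α ∘L Γ) =
        (derivExtL V F k).flip (α.curryLeft x) ∘L Γ + α.curryLeft ∘L Γ x := by
      ext u : 1
      simp [derivExt_curryLeft, hΓ u x]
    rw [this, alternatizeUncurryFin_add, ih, alternatizeUncurryFin_curryLeft_comp]
    simp

end MultilinearAlgebra

/-! ### Matrices on the model space and the scalar product of covectors -/

section Pairing

open ContinuousAlternatingMap (alternatizeUncurryFin alternatizeUncurryFin_apply
  curryLeft_compContinuousLinearMap curryLeft_apply_apply)

/-- The model space of `m`-manifolds. -/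
abbrev Model (m : ℕ) : Type := EuclideanSpace ℝ (Fin m)

/-- The standard basis vectors of the model space. -/
abbrev bvec {m : ℕ} (a : Fin m) : Model m := EuclideanSpace.single a (1 : ℝ)

variable {m : ℕ}

theorem sum_smul_bvec (u : Model m) : ∑ a, u a • bvec a = u := by
  ext b
  simp [Finset.sum_apply, Pi.single_apply]

/-- The matrix of an endomorphism of the model space in the standard basis. -/
def toMat (A : Model m →L[ℝ] Model m) : Matrix (Fin m) (Fin m) ℝ :=
  Matrix.of fun c a ↦ A (bvec a) c

theorem toMat_apply (A : Model m →L[ℝ] Model m) (c a : Fin m) : toMat A c a = A (bvec a) c := rfl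

theorem map_bvec (A : Model m →L[ℝ] Model m) (a : Fin m) :
    A (bvec a) = ∑ c, toMat A c a • bvec c :=
  (sum_smul_bvec _).symm

theorem toMat_id : toMat (ContinuousLinearMap.id ℝ (Model m)) = 1 := by
  ext a b; simp [toMat_apply, PiLp.single_apply, Matrix.one_apply]

theorem toMat_comp (A B : Model m →L[ℝ] Model m) : toMat (A ∘L B) = toMat A * toMat B := by
  ext c a
  rw [toMat_apply, ContinuousLinearMap.comp_apply, map_bvec B, map_sum, Matrix.mul_apply]
  simp [toMat_apply, mul_comm]

theorem toMat_neg (A : Model m →L[ℝ] Model m) : toMat (-A) = -toMat A := by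
  ext c a; simp [toMat_apply]

/-- The endomorphism of the model space with a given matrix. -/
def ofMat (P : Matrix (Fin m) (Fin m) ℝ) : Model m →L[ℝ] Model m :=
  LinearMap.toContinuousLinearMap (Matrix.toLin (EuclideanSpace.basisFun (Fin m) ℝ).toBasis
    (EuclideanSpace.basisFun (Fin m) ℝ).toBasis P)

theorem toMat_ofMat (P : Matrix (Fin m) (Fin m) ℝ) : toMat (ofMat P) = P := by
  ext c a
  have := Matrix.toLin_self (EuclideanSpace.basisFun (Fin m) ℝ).toBasis
    (EuclideanSpace.basisFun (Fin m) ℝ).toBasis P a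
  simp only [OrthonormalBasis.coe_toBasis, EuclideanSpace.basisFun_apply] at this
  rw [toMat_apply, ofMat, LinearMap.coe_toContinuousLinearMap', this]
  simp [Finset.sum_apply, Pi.single_apply]

/-- Maps in the arguments of a bilinear map can be moved onto the contravariant 2-tensor P, which
they push forward. All index gymnastics with the inverse metric go through this. -/
theorem sum_smul_map_map {W : Type*} [AddCommGroup W] [Module ℝ W]
    (P : Matrix (Fin m) (Fin m) ℝ) (A B : Model m →L[ℝ] Model m)
    (F : Model m →ₗ[ℝ] Model m →ₗ[ℝ] W) :
    ∑ a, ∑ b, P a b • F (A (bvec a)) (B (bvec b)) =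
      ∑ c, ∑ d, (toMat A * P * (toMat B).transpose) c d • F (bvec c) (bvec d) := by
  have h : ∀ a b, P a b • F (A (bvec a)) (B (bvec b)) =
      ∑ c, ∑ d, (toMat A c a * P a b * toMat B d b) • F (bvec c) (bvec d) := by
    intro a b
    rw [map_bvec A, map_bvec B]
    simp only [map_sum, LinearMap.sum_apply, Finset.smul_sum, map_smul, LinearMap.smul_apply,
      smul_smul]
    rw [Finset.sum_comm]
    refine Finset.sum_congr rfl fun c _ ↦ Finset.sum_congr rfl fun d _ ↦ ?_
    congr 1
    ring
  simp only [h, Matrix.mul_apply, Matrix.transpose_apply, Finset.sum_mul, Finset.sum_smul]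
  rw [Finset.sum_congr rfl fun a _ ↦ Finset.sum_comm, Finset.sum_comm]
  refine Finset.sum_congr rfl fun c _ ↦ ?_
  rw [Finset.sum_congr rfl fun a _ ↦ Finset.sum_comm, Finset.sum_comm]
  refine Finset.sum_congr rfl fun d _ ↦ Finset.sum_comm

theorem sum_smul_map_left {W : Type*} [AddCommGroup W] [Module ℝ W]
    (P : Matrix (Fin m) (Fin m) ℝ) (A : Model m →L[ℝ] Model m)
    (F : Model m →ₗ[ℝ] Model m →ₗ[ℝ] W) :
    ∑ a, ∑ b, P a b • F (A (bvec a)) (bvec b) =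
      ∑ c, ∑ d, (toMat A * P) c d • F (bvec c) (bvec d) := by
  simpa [toMat_id] using sum_smul_map_map P A (ContinuousLinearMap.id ℝ _) F

theorem sum_smul_map_right {W : Type*} [AddCommGroup W] [Module ℝ W]
    (P : Matrix (Fin m) (Fin m) ℝ) (B : Model m →L[ℝ] Model m)
    (F : Model m →ₗ[ℝ] Model m →ₗ[ℝ] W) :
    ∑ a, ∑ b, P a b • F (bvec a) (B (bvec b)) =
      ∑ c, ∑ d, (P * (toMat B).transpose) c d • F (bvec c) (bvec d) := by
  simpa [toMat_id] using sum_smul_map_map P (ContinuousLinearMap.id ℝ _) B F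

variable {𝕜 : Type*} [RCLike 𝕜] {k : ℕ}

/-- The sesquilinear pairing `∑ H^{i₁j₁} ⋯ H^{i_kj_k} conj(α_{i₁…i_k}) β_{j₁…j_k}`. -/
def pair (H : Matrix (Fin m) (Fin m) ℝ) (α β : Model m [⋀^Fin k]→L[ℝ] 𝕜) : 𝕜 :=
  ∑ i : Fin k → Fin m, ∑ j : Fin k → Fin m, (∏ a, H (i a) (j a)) •
    (starRingEnd 𝕜 (α fun a ↦ bvec (i a)) * β fun a ↦ bvec (j a))

/-- `pair` as a real bilinear map. -/
def pairₗ (H : Matrix (Fin m) (Fin m) ℝ) (k : ℕ) :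
    (Model m [⋀^Fin k]→L[ℝ] 𝕜) →ₗ[ℝ] (Model m [⋀^Fin k]→L[ℝ] 𝕜) →ₗ[ℝ] 𝕜 :=
  LinearMap.mk₂ ℝ (pair H)
    (fun α β γ ↦ by simp [pair, add_mul, Finset.sum_add_distrib])
    (fun c α β ↦ by
      have h : ∀ z : 𝕜, starRingEnd 𝕜 (c • z) = c • starRingEnd 𝕜 z := fun z ↦ by
        simp [RCLike.real_smul_eq_coe_mul]
      simp [pair, Finset.smul_sum, smul_comm c, h])
    (fun α β γ ↦ by simp [pair, mul_add, Finset.sum_add_distrib])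
    (fun c α β ↦ by simp [pair, Finset.smul_sum, smul_comm c])

theorem pairₗ_apply (H : Matrix (Fin m) (Fin m) ℝ) (α β : Model m [⋀^Fin k]→L[ℝ] 𝕜) :
    pairₗ H k α β = pair H α β := rfl

/-- The l-th index is summed separately. An arbitrary position is needed for the terms of an
alternation, while position 0 gives the recursion in the degree. -/
theorem pair_insertNth (H : Matrix (Fin m) (Fin m) ℝ) (l : Fin (k + 1))
    (f g : (Fin (k + 1) → Fin m) → 𝕜) :
    ∑ i : Fin (k + 1) → Fin m, ∑ j : Fin (k + 1) → Fin m, (∏ a, H (i a) (j a)) • (f i * g j) =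
      ∑ a, ∑ b, H a b • ∑ i : Fin k → Fin m, ∑ j : Fin k → Fin m, (∏ a, H (i a) (j a)) •
        (f (l.insertNth a i) * g (l.insertNth b j)) := by
  rw [← (Fin.insertNthEquiv (fun _ ↦ Fin m) l).sum_comp, Fintype.sum_prod_type]
  refine Finset.sum_congr rfl fun a _ ↦ ?_
  simp_rw [← (Fin.insertNthEquiv (fun _ ↦ Fin m) l).sum_comp
    (fun j ↦ (∏ c, H _ (j c)) • (_ * g j)), Fintype.sum_prod_type, Finset.smul_sum]
  rw [Finset.sum_comm]
  refine Finset.sum_congr rfl fun b _ ↦ Finset.sum_congr rfl fun i _ ↦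
    Finset.sum_congr rfl fun j _ ↦ ?_
  simp [Fin.prod_univ_succAbove _ l, smul_smul, Fin.insertNthEquiv]

theorem pair_succ (H : Matrix (Fin m) (Fin m) ℝ) (α β : Model m [⋀^Fin (k + 1)]→L[ℝ] 𝕜) :
    pair H α β = ∑ a, ∑ b, H a b • pair H (α.curryLeft (bvec a)) (β.curryLeft (bvec b)) := by
  have e : ∀ (a : Fin m) (i : Fin k → Fin m), (fun c ↦ bvec ((0 : Fin (k + 1)).insertNth
      (α := fun _ ↦ Fin m) a i c)) = Matrix.vecCons (bvec a) (fun c ↦ bvec (i c)) := by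
    intro a i
    funext c
    refine Fin.cases ?_ (fun j ↦ ?_) c <;> simp [Matrix.vecCons]
  rw [pair, pair_insertNth H 0 (fun i ↦ starRingEnd 𝕜 (α fun a ↦ bvec (i a)))
    (fun j ↦ β fun a ↦ bvec (j a))]
  simp only [e]
  rfl

/-- Because β is alternating, all k + 1 terms of the alternation contribute equally. The factor k +
1 turns 1/(k+1)! into 1/k! in the normalised scalar product. -/
theorem pair_alternatizeUncurryFin (H : Matrix (Fin m) (Fin m) ℝ)
    (φ : Model m →L[ℝ] Model m [⋀^Fin k]→L[ℝ] 𝕜) (β : Model m [⋀^Fin (k + 1)]→L[ℝ] 𝕜) :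
    pair H (alternatizeUncurryFin φ) β =
      ((k : ℝ) + 1) • ∑ a, ∑ b, H a b • pair H (φ (bvec a)) (β.curryLeft (bvec b)) := by
  have h : ∀ i : Fin (k + 1) → Fin m, ∀ j : Fin (k + 1) → Fin m, (∏ a, H (i a) (j a)) •
      (starRingEnd 𝕜 (alternatizeUncurryFin φ fun a ↦ bvec (i a)) * β fun a ↦ bvec (j a)) =
      ∑ l : Fin (k + 1), (∏ a, H (i a) (j a)) • ((fun i ↦ starRingEnd 𝕜
        ((-1 : ℤ) ^ (l : ℕ) • φ (bvec (i l)) (l.removeNth fun a ↦ bvec (i a)))) i *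
          (fun j ↦ β fun a ↦ bvec (j a)) j) := by
    intro i j
    rw [alternatizeUncurryFin_apply, map_sum, Finset.sum_mul, Finset.smul_sum]
  rw [pair]
  simp only [h]
  rw [Finset.sum_congr rfl fun i _ ↦ Finset.sum_comm, Finset.sum_comm]
  rw [Finset.sum_congr rfl fun l _ ↦ pair_insertNth H l _ _]
  have h2 : ∀ l : Fin (k + 1), ∀ a b, ∀ i j : Fin k → Fin m,
      (starRingEnd 𝕜 ((-1 : ℤ) ^ (l : ℕ) • φ (bvec (l.insertNth (α := fun _ ↦ Fin m) a i l))
        (l.removeNth fun c ↦ bvec (l.insertNth (α := fun _ ↦ Fin m) a i c)))) *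
          β (fun c ↦ bvec (l.insertNth (α := fun _ ↦ Fin m) b j c)) =
      starRingEnd 𝕜 (φ (bvec a) fun c ↦ bvec (i c)) *
        (β.curryLeft (bvec b)) fun c ↦ bvec (j c) := by
    intro l a b i j
    have e1 : (fun c ↦ bvec (l.insertNth (α := fun _ ↦ Fin m) b j c)) =
        l.insertNth (bvec b) (fun c ↦ bvec (j c)) := by
      funext c
      refine Fin.succAboveCases l ?_ (fun c ↦ ?_) c <;> simp
    have e2 : (l.removeNth fun c ↦ bvec (l.insertNth (α := fun _ ↦ Fin m) a i c)) =
        fun c ↦ bvec (i c) := by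
      funext c; simp [Fin.removeNth]
    rw [e1, e2, Fin.insertNth_apply_same, curryLeft_apply_apply,
      ← ContinuousAlternatingMap.neg_one_pow_smul_map_insertNth β l]
    -- The sign of the alternation meets the sign from moving the inserted vector of β to the front,
    -- and the two multiply to 1.
    rcases neg_one_pow_eq_or ℤ (l : ℕ) with h | h <;> simp [h]
  simp only [h2]
  rw [Finset.sum_const, Finset.card_univ, Fintype.card_fin, ← Nat.cast_smul_eq_nsmul ℝ]
  push_cast
  rfl

theorem pair_degree_zero (H : Matrix (Fin m) (Fin m) ℝ) (α β : Model m [⋀^Fin 0]→L[ℝ] 𝕜) :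
    pair H α β = starRingEnd 𝕜 (α ![]) * β ![] := by
  simp [pair, Subsingleton.elim _ (![] : Fin 0 → Model m)]

/-- The bilinear map `(u, v) ↦ pair (i_u α) (i_v β)`. -/
def pairContract (H : Matrix (Fin m) (Fin m) ℝ) (α β : Model m [⋀^Fin (k + 1)]→L[ℝ] 𝕜) :
    Model m →ₗ[ℝ] Model m →ₗ[ℝ] 𝕜 :=
  ((pairₗ H k).compl₁₂ (α.curryLeft : Model m →ₗ[ℝ] Model m [⋀^Fin k]→L[ℝ] 𝕜)
    (β.curryLeft : Model m →ₗ[ℝ] Model m [⋀^Fin k]→L[ℝ] 𝕜))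

theorem pairContract_apply (H : Matrix (Fin m) (Fin m) ℝ)
    (α β : Model m [⋀^Fin (k + 1)]→L[ℝ] 𝕜) (u v : Model m) :
    pairContract H α β u v = pair H (α.curryLeft u) (β.curryLeft v) := rfl

theorem pair_compContinuousLinearMap (H : Matrix (Fin m) (Fin m) ℝ) (A : Model m →L[ℝ] Model m)
    (α β : Model m [⋀^Fin k]→L[ℝ] 𝕜) :
    pair H (α.compContinuousLinearMap A) (β.compContinuousLinearMap A) =
      pair (toMat A * H * (toMat A).transpose) α β := by
  induction k with
  | zero =>
    simp [pair_degree_zero, ContinuousAlternatingMap.compContinuousLinearMap_apply,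
      Subsingleton.elim _ (![] : Fin 0 → Model m)]
  | succ k ih =>
    rw [pair_succ, pair_succ]
    simp only [curryLeft_compContinuousLinearMap, ih]
    exact sum_smul_map_map H A A (pairContract _ α β)

/-- The hypothesis says that A and A' are adjoint for the inverse metric H on covectors; the
derivations they induce are then adjoint on all forms. -/
theorem pair_derivExt (H : Matrix (Fin m) (Fin m) ℝ) (A A' : Model m →L[ℝ] Model m)
    (hA : toMat A * H = H * (toMat A').transpose) (α β : Model m [⋀^Fin k]→L[ℝ] 𝕜) :
    pair H (derivExt A α) β = pair H α (derivExt A' β) := by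
  induction k with
  | zero =>
    rw [derivExt_degree_zero, derivExt_degree_zero]
    simp [pair]
  | succ k ih =>
    rw [pair_succ, pair_succ]
    simp only [derivExt_curryLeft, ← pairₗ_apply, map_add, LinearMap.add_apply, smul_add,
      Finset.sum_add_distrib]
    simp only [pairₗ_apply, ih]
    congr 1
    have h1 := sum_smul_map_left H A (pairContract H α β)
    have h2 := sum_smul_map_right H A' (pairContract H α β)
    simp only [pairContract_apply] at h1 h2
    rw [h1, h2, hA]

theorem pair_one_self (α : Model m [⋀^Fin k]→L[ℝ] 𝕜) :
    pair 1 α α = ((∑ i : Fin k → Fin m, ‖α fun a ↦ bvec (i a)‖ ^ 2 : ℝ) : 𝕜) := by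
  rw [pair]
  push_cast
  refine Finset.sum_congr rfl fun i _ ↦ ?_
  rw [Finset.sum_eq_single i]
  · simp [RCLike.conj_mul]
  · intro j _ hj
    obtain ⟨a, ha⟩ := Function.ne_iff.1 hj
    have h0 : ∏ a, (1 : Matrix (Fin m) (Fin m) ℝ) (i a) (j a) = 0 :=
      Finset.prod_eq_zero (Finset.mem_univ a) (Matrix.one_apply_ne ha.symm)
    exact (congrArg (· • _) h0).trans (zero_smul _ _)
  · simp

theorem ext_bvec {F : Type*} [NormedAddCommGroup F] [NormedSpace ℝ F]
    {α β : Model m [⋀^Fin k]→L[ℝ] F}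
    (h : ∀ i : Fin k → Fin m, (α fun a ↦ bvec (i a)) = β fun a ↦ bvec (i a)) : α = β := by
  apply ContinuousAlternatingMap.toAlternatingMap_injective
  refine Module.Basis.ext_alternating (EuclideanSpace.basisFun (Fin m) ℝ).toBasis fun v _ ↦ ?_
  simpa using h v

/-- A form of degree greater than the dimension vanishes. -/
theorem eq_zero_of_lt_degree {F : Type*} [NormedAddCommGroup F] [NormedSpace ℝ F]
    (hk : m < k) (α : Model m [⋀^Fin k]→L[ℝ] F) : α = 0 := by
  refine ext_bvec fun i ↦ ?_
  obtain ⟨a, b, hab, h⟩ := Fintype.exists_ne_map_eq_of_card_lt i (by simpa using hk)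
  exact α.map_eq_zero_of_eq _ (by simp [h]) hab

theorem toMat_injective {A B : Model m →L[ℝ] Model m} (h : toMat A = toMat B) : A = B := by
  ext1 u
  rw [← sum_smul_bvec u]
  simp only [map_sum, map_smul, map_bvec, h]

open scoped MatrixOrder Matrix.Norms.L2Operator in
theorem exists_eq_mul_transpose (H : Matrix (Fin m) (Fin m) ℝ) (hH : H.PosDef) :
    ∃ B : Matrix (Fin m) (Fin m) ℝ, IsUnit B ∧ H = B * B.transpose := by
  obtain ⟨B, hB⟩ := CStarAlgebra.nonneg_iff_eq_mul_star_self.1 hH.posSemidef.nonneg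
  have hB' : H = B * B.transpose := by
    rw [hB, Matrix.star_eq_conjTranspose, Matrix.conjTranspose_eq_transpose_of_trivial]
  refine ⟨B, ?_, hB'⟩
  rw [Matrix.isUnit_iff_isUnit_det, isUnit_iff_ne_zero]
  intro h0
  have := hH.det_pos
  rw [hB', Matrix.det_mul, h0, zero_mul] at this
  exact this.false

/-- Factoring H = B Bᵀ amounts to choosing an orthonormal frame, in which the pairing becomes the
standard one. This reduces positivity to a sum of squares. -/
theorem exists_pair_eq (H : Matrix (Fin m) (Fin m) ℝ) (hH : H.PosDef) :
    ∃ A : Model m →L[ℝ] Model m, Function.Surjective A ∧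
      ∀ (k : ℕ) (α β : Model m [⋀^Fin k]→L[ℝ] 𝕜), pair H α β =
        pair 1 (α.compContinuousLinearMap A) (β.compContinuousLinearMap A) := by
  obtain ⟨B, hB, hBH⟩ := exists_eq_mul_transpose H hH
  refine ⟨ofMat B, ?_, fun k α β ↦ ?_⟩
  · obtain ⟨D, hD⟩ := hB.exists_right_inv
    intro u
    have h : ofMat B ∘L ofMat D = ContinuousLinearMap.id ℝ (Model m) := toMat_injective <| by
      rw [toMat_comp, toMat_ofMat, toMat_ofMat, hD, toMat_id]
    exact ⟨ofMat D u, DFunLike.congr_fun h u⟩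
  · rw [pair_compContinuousLinearMap, toMat_ofMat, mul_one, hBH]

theorem pair_self_nonneg (H : Matrix (Fin m) (Fin m) ℝ) (hH : H.PosDef)
    (α : Model m [⋀^Fin k]→L[ℝ] 𝕜) :
    ∃ r : ℝ, 0 ≤ r ∧ pair H α α = (r : 𝕜) ∧ (r = 0 → α = 0) := by
  obtain ⟨A, hA, h⟩ := exists_pair_eq (𝕜 := 𝕜) H hH
  refine ⟨_, ?_, (h k α α).trans (pair_one_self _), fun h0 ↦ ?_⟩
  · positivity
  · rw [Finset.sum_eq_zero_iff_of_nonneg (fun _ _ ↦ by positivity)] at h0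
    have h1 : α.compContinuousLinearMap A = 0 := ext_bvec fun i ↦ by
      simpa using h0 i (Finset.mem_univ i)
    ext v
    choose w hw using fun a ↦ hA (v a)
    have := congrArg (fun γ ↦ γ w) h1
    simpa [ContinuousAlternatingMap.compContinuousLinearMap_apply, Function.comp_def, hw] using this

end Pairing

/-! ### Contraction with the bivector of a skew endomorphism -/

section Contraction

open ContinuousAlternatingMap (alternatizeUncurryFin alternatizeUncurryFin_apply
  curryLeft_compContinuousLinearMap curryLeft_apply_apply)

variable {m k : ℕ} {F : Type*} [NormedAddCommGroup F] [NormedSpace ℝ F]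

variable (m k F) in
/-- `ContinuousAlternatingMap.curryLeft` as a continuous linear map. -/
def curryLeftL : (Model m [⋀^Fin (k + 1)]→L[ℝ] F) →L[ℝ] Model m →L[ℝ] Model m [⋀^Fin k]→L[ℝ] F :=
  ContinuousAlternatingMap.curryLeftLI.toContinuousLinearMap

theorem curryLeft_sub (β γ : Model m [⋀^Fin (k + 1)]→L[ℝ] F) :
    (β - γ).curryLeft = β.curryLeft - γ.curryLeft := rfl

/-- Iterated contraction of a form with two vectors. -/
def curryTwo (β : Model m [⋀^Fin (k + 2)]→L[ℝ] F) :
    Model m →ₗ[ℝ] Model m →ₗ[ℝ] Model m [⋀^Fin k]→L[ℝ] F :=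
  LinearMap.mk₂ ℝ (fun u v ↦ (β.curryLeft u).curryLeft v)
    (fun u u' v ↦ by simp) (fun c u v ↦ by simp) (fun u v v' ↦ by simp) (fun c u v ↦ by simp)

theorem curryTwo_apply (β : Model m [⋀^Fin (k + 2)]→L[ℝ] F) (u v : Model m) :
    curryTwo β u v = (β.curryLeft u).curryLeft v := rfl

/-- The contraction `½ ∑ H^{ab} i_{e_b} i_{C e_a}` of forms with the bivector of a skew
endomorphism. -/
def lam (F : Type*) [NormedAddCommGroup F] [NormedSpace ℝ F] (k : ℕ)
    (H : Matrix (Fin m) (Fin m) ℝ) (C : Model m →L[ℝ] Model m) :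
    (Model m [⋀^Fin (k + 2)]→L[ℝ] F) →L[ℝ] Model m [⋀^Fin k]→L[ℝ] F :=
  (2⁻¹ : ℝ) • ∑ a, ∑ b, H a b • (contractL F k (bvec b) ∘L contractL F (k + 1) (C (bvec a)))

theorem lam_apply (H : Matrix (Fin m) (Fin m) ℝ) (C : Model m →L[ℝ] Model m)
    (β : Model m [⋀^Fin (k + 2)]→L[ℝ] F) :
    lam F k H C β = (2⁻¹ : ℝ) • ∑ a, ∑ b, H a b • curryTwo β (C (bvec a)) (bvec b) := by
  simp [lam, curryTwo_apply]

/-- Naturality: the bivector is pushed forward by A. It makes Λ compatible with passage to charts.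
-/
theorem lam_compContinuousLinearMap (H : Matrix (Fin m) (Fin m) ℝ)
    (C C' A : Model m →L[ℝ] Model m) (hC : A ∘L C = C' ∘L A)
    (β : Model m [⋀^Fin (k + 2)]→L[ℝ] F) :
    lam F k H C (β.compContinuousLinearMap A) =
      (lam F k (toMat A * H * (toMat A).transpose) C' β).compContinuousLinearMap A := by
  have h1 : ∀ u v, curryTwo (β.compContinuousLinearMap A) (C u) v =
      (curryTwo β (C' (A u)) (A v)).compContinuousLinearMap A := by
    intro u v
    simp only [curryTwo_apply, curryLeft_compContinuousLinearMap]
    rw [show A (C u) = C' (A u) from DFunLike.congr_fun hC u]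
  have h2 := sum_smul_map_map H A A ((curryTwo β).comp (C' : Model m →ₗ[ℝ] Model m))
  simp only [LinearMap.comp_apply, ContinuousLinearMap.coe_coe] at h2
  rw [lam_apply, lam_apply, ← h2]
  ext v
  simp [h1, ContinuousAlternatingMap.compContinuousLinearMap_apply]

/-- Contractions with the bivector of a skew endomorphism are antisymmetric. -/
theorem sum_smul_skew {W : Type*} [AddCommGroup W] [Module ℝ W]
    {H : Matrix (Fin m) (Fin m) ℝ} {C : Model m →L[ℝ] Model m} (hH : H.transpose = H)
    (hC : toMat C * H = -(H * (toMat C).transpose)) (T : Model m →ₗ[ℝ] Model m →ₗ[ℝ] W) :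
    ∑ a, ∑ b, H a b • T (bvec b) (C (bvec a)) =
      -∑ a, ∑ b, H a b • T (C (bvec a)) (bvec b) := by
  rw [sum_smul_map_left]
  have h1 := sum_smul_map_left H C T.flip
  simp only [LinearMap.flip_apply] at h1
  rw [h1, Finset.sum_comm, ← Finset.sum_neg_distrib]
  refine Finset.sum_congr rfl fun a _ ↦ ?_
  rw [← Finset.sum_neg_distrib]
  refine Finset.sum_congr rfl fun b _ ↦ ?_
  have h2 : (toMat C * H) b a = -(toMat C * H) a b := by
    calc (toMat C * H) b a = -(H * (toMat C).transpose) b a := by rw [hC]; rfl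
      _ = -((toMat C * H.transpose).transpose) b a := by
        rw [Matrix.transpose_mul, Matrix.transpose_transpose]
      _ = _ := by rw [hH]; rfl
  exact (congrArg (· • T (bvec a) (bvec b)) h2).trans (neg_smul _ _)

/-- Algebraic half of the Kähler identity. With φ = ∇β, contracting the alternation twice leaves two
terms in which one vector differentiates; they agree by skewness of the bivector and absorb the
factor ½. What remains is Alt of Λ∇β, which is dΛβ once Λ is parallel. -/
theorem lam_alternatizeUncurryFin {H : Matrix (Fin m) (Fin m) ℝ} {C : Model m →L[ℝ] Model m}
    (hH : H.transpose = H) (hC : toMat C * H = -(H * (toMat C).transpose))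
    (φ : Model m →L[ℝ] Model m [⋀^Fin (k + 2)]→L[ℝ] F) :
    lam F (k + 1) H C (alternatizeUncurryFin φ) =
      ∑ a, ∑ b, H a b • (φ (C (bvec a))).curryLeft (bvec b) +
        alternatizeUncurryFin (lam F k H C ∘L φ) := by
  let T : Model m →ₗ[ℝ] Model m →ₗ[ℝ] Model m [⋀^Fin (k + 1)]→L[ℝ] F :=
    LinearMap.mk₂ ℝ (fun u v ↦ (φ u).curryLeft v) (by simp) (by simp) (by simp) (by simp)
  have hT : ∀ u v, T u v = (φ u).curryLeft v := fun _ _ ↦ rfl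
  have h1 : ∀ u v, curryTwo (alternatizeUncurryFin φ) u v = T u v - T v u +
      alternatizeUncurryFin ((contractL F k v ∘L contractL F (k + 1) u) ∘L φ) := by
    intro u v
    rw [curryTwo_apply, curryLeft_alternatizeUncurryFin]
    have : ∀ β γ : Model m [⋀^Fin (k + 2)]→L[ℝ] F,
      (β - γ).curryLeft v = β.curryLeft v - γ.curryLeft v := fun _ _ ↦ rfl
    rw [this, curryLeft_alternatizeUncurryFin, hT, hT, ContinuousLinearMap.comp_assoc]
    simp only [ContinuousLinearMap.comp_apply, contractL_apply]
    abel
  have h2 : alternatizeUncurryFin (lam F k H C ∘L φ) =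
      (2⁻¹ : ℝ) • ∑ a, ∑ b, H a b • alternatizeUncurryFin
        ((contractL F k (bvec b) ∘L contractL F (k + 1) (C (bvec a))) ∘L φ) := by
    simp only [← ContinuousAlternatingMap.alternatizeUncurryFinCLM_apply, ← map_smul, ← map_sum]
    congr 1
    ext u : 1
    simp [lam]
  rw [lam_apply, h2]
  simp only [h1, smul_add, smul_sub, Finset.sum_add_distrib, Finset.sum_sub_distrib]
  rw [sum_smul_skew hH hC T]
  simp only [← hT]
  rw [smul_neg, sub_neg_eq_add, ← add_smul]
  norm_num

theorem lam_alternatizeUncurryFin_zero {H : Matrix (Fin m) (Fin m) ℝ}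
    {C : Model m →L[ℝ] Model m}
    (hH : H.transpose = H) (hC : toMat C * H = -(H * (toMat C).transpose))
    (φ : Model m →L[ℝ] Model m [⋀^Fin 1]→L[ℝ] F) :
    lam F 0 H C (alternatizeUncurryFin φ) =
      ∑ a, ∑ b, H a b • (φ (C (bvec a))).curryLeft (bvec b) := by
  let T : Model m →ₗ[ℝ] Model m →ₗ[ℝ] Model m [⋀^Fin 0]→L[ℝ] F :=
    LinearMap.mk₂ ℝ (fun u v ↦ (φ u).curryLeft v) (by simp) (by simp) (by simp) (by simp)
  have hT : ∀ u v, T u v = (φ u).curryLeft v := fun _ _ ↦ rfl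
  have h1 : ∀ u v, curryTwo (alternatizeUncurryFin φ) u v = T u v - T v u := by
    intro u v
    rw [curryTwo_apply, curryLeft_alternatizeUncurryFin]
    have : ∀ β γ : Model m [⋀^Fin 1]→L[ℝ] F,
      (β - γ).curryLeft v = β.curryLeft v - γ.curryLeft v := fun _ _ ↦ rfl
    rw [this, curryLeft_alternatizeUncurryFin_zero, hT, hT]
    rfl
  rw [lam_apply]
  simp only [h1, smul_sub, Finset.sum_sub_distrib]
  rw [sum_smul_skew hH hC T]
  simp only [← hT]
  rw [smul_neg, sub_neg_eq_add, ← add_smul]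
  norm_num

end Contraction

/-! ### Leibniz rules along a curve for a parallel metric and endomorphism -/

section CurveDerivatives

variable {m k : ℕ} {F : Type*} [NormedAddCommGroup F] [NormedSpace ℝ F]
  {𝕜 : Type*} [RCLike 𝕜] {H : ℝ → Matrix (Fin m) (Fin m) ℝ} {C : ℝ → Model m →L[ℝ] Model m}
  {Γ : Model m →L[ℝ] Model m} {t : ℝ}

theorem hasDerivAt_curryLeft {β : ℝ → Model m [⋀^Fin (k + 1)]→L[ℝ] F}
    {β' : Model m [⋀^Fin (k + 1)]→L[ℝ] F} (hβ : HasDerivAt β β' t) :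
    HasDerivAt (fun s ↦ (β s).curryLeft) β'.curryLeft t := by
  have h0 := (curryLeftL m k F).hasFDerivAt (x := β t)
  have h1 := HasFDerivAt.comp_hasDerivAt (l := curryLeftL m k F) (l' := curryLeftL m k F) t h0 hβ
  exact h1

/-- The matrix on the left is the derivative of a parallel contravariant metric H, so
differentiating a contraction with H subtracts Γ from each of the two slots. -/
theorem sum_smul_derivative {W : Type*} [AddCommGroup W] [Module ℝ W]
    (H : Matrix (Fin m) (Fin m) ℝ) (Γ : Model m →L[ℝ] Model m)
    (T : Model m →ₗ[ℝ] Model m →ₗ[ℝ] W) :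
    ∑ a, ∑ b, (-(toMat Γ * H + H * (toMat Γ).transpose)) a b • T (bvec a) (bvec b) =
      -∑ a, ∑ b, H a b • (T (Γ (bvec a)) (bvec b) + T (bvec a) (Γ (bvec b))) := by
  simp only [smul_add, Finset.sum_add_distrib]
  rw [sum_smul_map_left, sum_smul_map_right]
  simp only [Matrix.neg_apply, Matrix.add_apply, neg_smul, add_smul, Finset.sum_neg_distrib,
    Finset.sum_add_distrib]

/-- The hypotheses on H and C say that both are parallel along the curve, with connection matrix Γ.
Hence so is Λ, and only the covariant derivative of β is left inside it. -/
theorem hasDerivAt_lam {β : ℝ → Model m [⋀^Fin (k + 2)]→L[ℝ] F}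
    {β' : Model m [⋀^Fin (k + 2)]→L[ℝ] F}
    (hH : ∀ a b, HasDerivAt (fun s ↦ H s a b)
      ((-(toMat Γ * H t + H t * (toMat Γ).transpose)) a b) t)
    (hC : HasDerivAt C (C t ∘L Γ - Γ ∘L C t) t) (hβ : HasDerivAt β β' t) :
    HasDerivAt (fun s ↦ lam F k (H s) (C s) (β s))
      (lam F k (H t) (C t) (β' - derivExt Γ (β t)) + derivExt Γ (lam F k (H t) (C t) (β t))) t := by
  have hcurry : ∀ a b, HasDerivAt (fun s ↦ curryTwo (β s) (C s (bvec a)) (bvec b))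
      (curryTwo β' (C t (bvec a)) (bvec b) +
        curryTwo (β t) (C t (Γ (bvec a)) - Γ (C t (bvec a))) (bvec b)) t := by
    intro a b
    have h1 := hasDerivAt_curryLeft hβ
    have h2 := h1.clm_apply (hC.clm_apply (hasDerivAt_const t (bvec a)))
    have h3 := (contractL F k (bvec b)).hasFDerivAt.comp_hasDerivAt t h2
    convert! h3 using 1
    simp [curryTwo_apply, add_comm, curryLeft_sub]
  have hsum : HasDerivAt (fun s ↦ lam F k (H s) (C s) (β s)) ((2⁻¹ : ℝ) • ∑ a, ∑ b,
      (H t a b • (curryTwo β' (C t (bvec a)) (bvec b) +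
        curryTwo (β t) (C t (Γ (bvec a)) - Γ (C t (bvec a))) (bvec b)) +
        (-(toMat Γ * H t + H t * (toMat Γ).transpose)) a b •
          curryTwo (β t) (C t (bvec a)) (bvec b))) t := by
    simp only [lam_apply]
    exact (HasDerivAt.fun_sum fun a _ ↦ HasDerivAt.fun_sum fun b _ ↦
      (hH a b).fun_smul (hcurry a b)).fun_const_smul _
  convert! hsum using 1
  have h4 := sum_smul_derivative (H t) Γ ((curryTwo (β t)).comp (C t : Model m →ₗ[ℝ] Model m))
  simp only [LinearMap.comp_apply, ContinuousLinearMap.coe_coe] at h4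
  have h5 : ∀ u v, curryTwo (derivExt Γ (β t)) u v = derivExt Γ (curryTwo (β t) u v) +
      curryTwo (β t) (Γ u) v + curryTwo (β t) u (Γ v) := by
    intro u v
    simp only [curryTwo_apply, derivExt_curryLeft, ContinuousAlternatingMap.curryLeft_add,
      _root_.add_apply]
    abel
  have h6 : derivExt Γ (lam F k (H t) (C t) (β t)) = (2⁻¹ : ℝ) • ∑ a, ∑ b,
      H t a b • derivExt Γ (curryTwo (β t) (C t (bvec a)) (bvec b)) := by
    rw [← derivExtL_apply, lam_apply, map_smul, map_sum]
    simp only [map_sum, map_smul, derivExtL_apply]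
  simp only [Finset.sum_add_distrib, h4]
  rw [map_sub, h6, lam_apply, lam_apply]
  simp only [h5, smul_add, Finset.sum_add_distrib, map_sub, LinearMap.sub_apply, smul_sub,
    Finset.sum_sub_distrib, smul_neg]
  abel

/-- Metric compatibility on forms, by induction on the degree: each contraction produces the Γ
corrections for one more slot. -/
theorem hasDerivAt_pair {α β : ℝ → Model m [⋀^Fin k]→L[ℝ] 𝕜}
    {α' β' : Model m [⋀^Fin k]→L[ℝ] 𝕜}
    (hH : ∀ a b, HasDerivAt (fun s ↦ H s a b)
      ((-(toMat Γ * H t + H t * (toMat Γ).transpose)) a b) t)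
    (hα : HasDerivAt α α' t) (hβ : HasDerivAt β β' t) :
    HasDerivAt (fun s ↦ pair (H s) (α s) (β s))
      (pair (H t) (α' - derivExt Γ (α t)) (β t) +
        pair (H t) (α t) (β' - derivExt Γ (β t))) t := by
  induction k with
  | zero =>
    simp only [pair_degree_zero, derivExt_degree_zero, sub_zero]
    have ev : ∀ {γ : ℝ → Model m [⋀^Fin 0]→L[ℝ] 𝕜} {γ' : Model m [⋀^Fin 0]→L[ℝ] 𝕜},
        HasDerivAt γ γ' t → HasDerivAt (fun s ↦ γ s ![]) (γ' ![]) t := fun {γ γ'} h ↦ by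
      rw [Subsingleton.elim (![] : Fin 0 → Model m) 0]
      exact (ContinuousAlternatingMap.constOfIsEmptyLIE ℝ (Model m) 𝕜
        (Fin 0)).symm.toContinuousLinearEquiv.toContinuousLinearMap.hasFDerivAt.comp_hasDerivAt t h
    exact ((RCLike.conjCLE (K := 𝕜)).toContinuousLinearMap.hasFDerivAt.comp_hasDerivAt t
      (ev hα)).mul (ev hβ)
  | succ k ih =>
    have hc : ∀ {γ : ℝ → Model m [⋀^Fin (k + 1)]→L[ℝ] 𝕜} {γ' : Model m [⋀^Fin (k + 1)]→L[ℝ] 𝕜},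
        HasDerivAt γ γ' t → ∀ u, HasDerivAt (fun s ↦ (γ s).curryLeft u) (γ'.curryLeft u) t :=
      fun {γ γ'} h u ↦ (contractL 𝕜 k u).hasFDerivAt.comp_hasDerivAt t h
    have hsum := HasDerivAt.fun_sum (u := Finset.univ) fun (a : Fin m) _ ↦
      HasDerivAt.fun_sum (u := Finset.univ) fun (b : Fin m) _ ↦
        (hH a b).fun_smul (ih (hc hα (bvec a)) (hc hβ (bvec b)))
    simp only [pair_succ (k := k)]
    convert! hsum using 1
    have h4 := sum_smul_derivative (H t) Γ (pairContract (H t) (α t) (β t))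
    simp only [pairContract_apply] at h4
    have hd : ∀ γ γ' : Model m [⋀^Fin (k + 1)]→L[ℝ] 𝕜, ∀ u,
        (γ' - derivExt Γ γ).curryLeft u = γ'.curryLeft u - derivExt Γ (γ.curryLeft u) -
          γ.curryLeft (Γ u) := fun γ γ' u ↦ by
      have : (γ' - derivExt Γ γ).curryLeft u =
        γ'.curryLeft u - (derivExt Γ γ).curryLeft u := rfl
      rw [this, derivExt_curryLeft, sub_sub]
    simp only [Finset.sum_add_distrib, h4, hd]
    simp only [← pairₗ_apply, map_sub, LinearMap.sub_apply, smul_add, smul_sub,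
      Finset.sum_sub_distrib, Finset.sum_add_distrib]
    ring

/-- The derivative of the components of the vector field `X` with
`⟨X, ·⟩ = ⟨(C ·) ∧ α, β⟩`. -/
theorem hasDerivAt_sum_pair {α : ℝ → Model m [⋀^Fin k]→L[ℝ] 𝕜}
    {β : ℝ → Model m [⋀^Fin (k + 1)]→L[ℝ] 𝕜} {α' : Model m [⋀^Fin k]→L[ℝ] 𝕜}
    {β' : Model m [⋀^Fin (k + 1)]→L[ℝ] 𝕜}
    (hH : ∀ a b, HasDerivAt (fun s ↦ H s a b)
      ((-(toMat Γ * H t + H t * (toMat Γ).transpose)) a b) t)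
    (hC : HasDerivAt C (C t ∘L Γ - Γ ∘L C t) t)
    (hα : HasDerivAt α α' t) (hβ : HasDerivAt β β' t) (a : Fin m) :
    HasDerivAt (fun s ↦ ∑ b, H s a b • pair (H s) (α s) ((β s).curryLeft (C s (bvec b))))
      (∑ b, H t a b • (pair (H t) (α' - derivExt Γ (α t)) ((β t).curryLeft (C t (bvec b))) +
          pair (H t) (α t) ((β' - derivExt Γ (β t)).curryLeft (C t (bvec b)))) -
        ∑ b, (toMat Γ * H t) a b • pair (H t) (α t) ((β t).curryLeft (C t (bvec b)))) t := by
  have hcurry : ∀ b, HasDerivAt (fun s ↦ (β s).curryLeft (C s (bvec b)))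
      (β'.curryLeft (C t (bvec b)) + (β t).curryLeft (C t (Γ (bvec b)) - Γ (C t (bvec b)))) t := by
    intro b
    have h1 := hasDerivAt_curryLeft hβ
    have h2 := h1.clm_apply (hC.clm_apply (hasDerivAt_const t (bvec b)))
    convert! h2 using 1
    simp
  have hsum := HasDerivAt.fun_sum (u := Finset.univ) fun (b : Fin m) _ ↦
    (hH a b).fun_smul (hasDerivAt_pair hH hα (hcurry b))
  convert! hsum using 1
  have hd : ∀ u, (β' - derivExt Γ (β t)).curryLeft u =
      β'.curryLeft u - derivExt Γ ((β t).curryLeft u) - (β t).curryLeft (Γ u) := fun u ↦ by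
    have : (β' - derivExt Γ (β t)).curryLeft u =
      β'.curryLeft u - (derivExt Γ (β t)).curryLeft u := rfl
    rw [this, derivExt_curryLeft, sub_sub]
  have hT : ∑ b, (H t * (toMat Γ).transpose) a b •
        pair (H t) (α t) ((β t).curryLeft (C t (bvec b))) =
      ∑ b, H t a b • pair (H t) (α t) ((β t).curryLeft (C t (Γ (bvec b)))) := by
    have : ∀ b, pair (H t) (α t) ((β t).curryLeft (C t (Γ (bvec b)))) =
        ∑ c, toMat Γ c b • pair (H t) (α t) ((β t).curryLeft (C t (bvec c))) := by
      intro b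
      rw [map_bvec Γ b]
      simp only [← pairₗ_apply, map_sum, map_smul]
    simp only [this, Finset.smul_sum, Matrix.mul_apply, Finset.sum_smul, smul_smul,
      Matrix.transpose_apply]
    exact Finset.sum_comm
  simp only [Matrix.neg_apply, Matrix.add_apply, hd, neg_smul, add_smul, Finset.sum_add_distrib,
    Finset.sum_neg_distrib, hT]
  simp only [← pairₗ_apply, map_sub, map_add, LinearMap.sub_apply, smul_add, smul_sub,
    Finset.sum_sub_distrib, Finset.sum_add_distrib]
  ring

end CurveDerivatives

/-! ### Calculus of inverse matrices and determinants -/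

section MatrixCalculus

open Topology Filter

variable {m : ℕ} {E : Type*} [NormedAddCommGroup E] [NormedSpace ℝ E]

theorem contDiffWithinAt_det {n : WithTop ℕ∞} {A : E → Matrix (Fin m) (Fin m) ℝ} {s : Set E} {x : E}
    (hA : ∀ i j, ContDiffWithinAt ℝ n (fun y ↦ A y i j) s x) :
    ContDiffWithinAt ℝ n (fun y ↦ (A y).det) s x := by
  simp only [Matrix.det_apply]
  exact ContDiffWithinAt.sum fun σ _ ↦ (contDiffWithinAt_prod fun i _ ↦ hA _ _).const_smul _

theorem contDiffWithinAt_inv_apply {n : WithTop ℕ∞} {A : E → Matrix (Fin m) (Fin m) ℝ} {s : Set E}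
    {x : E} (hA : ∀ i j, ContDiffWithinAt ℝ n (fun y ↦ A y i j) s x) (h0 : (A x).det ≠ 0)
    (i j : Fin m) : ContDiffWithinAt ℝ n (fun y ↦ (A y)⁻¹ i j) s x := by
  have h : (fun y ↦ (A y)⁻¹ i j) =
      fun y ↦ (A y).det⁻¹ * ((A y).updateRow j (Pi.single i 1)).det := by
    funext y
    rw [Matrix.inv_def, Ring.inverse_eq_inv', ← Matrix.adjugate_apply]
    rfl
  rw [h]
  refine ((contDiffWithinAt_det hA).inv h0).mul (contDiffWithinAt_det fun a b ↦ ?_)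
  by_cases ha : a = j
  · subst ha
    simpa using contDiffWithinAt_const
  · simpa [Matrix.updateRow_ne ha] using hA a b

/-- Differentiability of the entries is an input, available from the cofactor formula; the value
then follows by differentiating A⁻¹A = 1. -/
theorem hasDerivAt_inv_apply {A : ℝ → Matrix (Fin m) (Fin m) ℝ} {A' : Matrix (Fin m) (Fin m) ℝ}
    {t : ℝ} (hd : ∀ i j, DifferentiableAt ℝ (fun s ↦ (A s)⁻¹ i j) t)
    (hA : ∀ i j, HasDerivAt (fun s ↦ A s i j) (A' i j) t) (h0 : ∀ᶠ s in 𝓝 t, (A s).det ≠ 0)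
    (i j : Fin m) : HasDerivAt (fun s ↦ (A s)⁻¹ i j) (-((A t)⁻¹ * A' * (A t)⁻¹) i j) t := by
  set B' : Matrix (Fin m) (Fin m) ℝ := Matrix.of fun i j ↦ deriv (fun s ↦ (A s)⁻¹ i j) t
  have hB : ∀ i j, HasDerivAt (fun s ↦ (A s)⁻¹ i j) (B' i j) t := fun i j ↦ (hd i j).hasDerivAt
  have h1 : B' * A t + (A t)⁻¹ * A' = 0 := by
    ext i j
    have h2 : HasDerivAt (fun s ↦ ((A s)⁻¹ * A s) i j) ((B' * A t + (A t)⁻¹ * A') i j) t := by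
      simp only [Matrix.mul_apply, Matrix.add_apply, ← Finset.sum_add_distrib]
      exact HasDerivAt.fun_sum fun c _ ↦ (hB i c).fun_mul (hA c j)
    have h3 : (fun s ↦ ((A s)⁻¹ * A s) i j) =ᶠ[𝓝 t]
        fun _ ↦ (1 : Matrix (Fin m) (Fin m) ℝ) i j := by
      filter_upwards [h0] with s hs
      rw [Matrix.nonsing_inv_mul _ (isUnit_iff_ne_zero.2 hs)]
    exact (h2.congr_of_eventuallyEq h3.symm).unique (hasDerivAt_const _ _)
  have h4 : B' = -((A t)⁻¹ * A' * (A t)⁻¹) := by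
    have h5 : B' * A t * (A t)⁻¹ = B' := by
      rw [mul_assoc, Matrix.mul_nonsing_inv _ (isUnit_iff_ne_zero.2 h0.self_of_nhds), mul_one]
    rw [← h5, eq_neg_of_add_eq_zero_left h1, neg_mul]
  have := hB i j
  rw [h4] at this
  exact this

/-- Jacobi's formula, from multilinearity of the determinant in the rows and Cramer's rule. -/
theorem hasDerivAt_det {A : ℝ → Matrix (Fin m) (Fin m) ℝ} {A' : Matrix (Fin m) (Fin m) ℝ}
    {t : ℝ} (hA : ∀ i j, HasDerivAt (fun s ↦ A s i j) (A' i j) t) :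
    HasDerivAt (fun s ↦ (A s).det) (((A t).adjugate * A').trace) t := by
  let f : ContinuousMultilinearMap ℝ (fun _ : Fin m ↦ Fin m → ℝ) ℝ :=
    { toMultilinearMap :=
        (Matrix.detRowAlternating (n := Fin m) (R := ℝ)).toMultilinearMap
      cont := (continuous_id (X := Matrix (Fin m) (Fin m) ℝ)).matrix_det }
  have hf : ∀ B : Matrix (Fin m) (Fin m) ℝ, f B = B.det := fun B ↦ rfl
  have hA' : HasDerivAt (fun s ↦ (A s : Fin m → Fin m → ℝ)) (A' : Fin m → Fin m → ℝ) t :=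
    hasDerivAt_pi.2 fun i ↦ hasDerivAt_pi.2 fun j ↦ hA i j
  have h1 := (f.hasFDerivAt (x := (A t : Fin m → Fin m → ℝ))).comp_hasDerivAt t hA'
  convert! h1 using 1
  refine Eq.trans ?_ (f.linearDeriv_apply (A t) A').symm
  rw [Matrix.trace_mul_comm]
  refine Finset.sum_congr rfl fun i _ ↦ ?_
  have h2 : f (Function.update (A t : Fin m → Fin m → ℝ) i (A' i)) =
      Matrix.cramer (A t).transpose (A' i) i := by
    rw [Matrix.cramer_transpose_apply]; rfl
  rw [h2, Matrix.cramer_eq_adjugate_mulVec, ← Matrix.adjugate_transpose]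
  simp [Matrix.mulVec, dotProduct, Matrix.mul_apply, mul_comm]

end MatrixCalculus

/-! ### One-jets: Christoffel symbols and parallelism of the complex structure -/

section Connection

variable {m : ℕ}

/-- The Gram matrix of a bilinear form on the model space. -/
def gramMat (G : Model m →L[ℝ] Model m →L[ℝ] ℝ) : Matrix (Fin m) (Fin m) ℝ :=
  Matrix.of fun a b ↦ G (bvec a) (bvec b)

theorem gramMat_apply (G : Model m →L[ℝ] Model m →L[ℝ] ℝ) (a b : Fin m) :
    gramMat G a b = G (bvec a) (bvec b) := rfl

theorem apply_eq_sum_gramMat (G : Model m →L[ℝ] Model m →L[ℝ] ℝ) (u v : Model m) :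
    G u v = ∑ a, ∑ b, u a * v b * gramMat G a b := by
  conv_lhs => rw [← sum_smul_bvec u, ← sum_smul_bvec v]
  simp only [map_sum, map_smul, sum_apply, smul_apply, smul_eq_mul, Finset.mul_sum]
  rw [Finset.sum_comm]
  exact Finset.sum_congr rfl fun a _ ↦ Finset.sum_congr rfl fun b _ ↦ by
    rw [gramMat_apply]; ring

theorem gramMat_posDef {G : Model m →L[ℝ] Model m →L[ℝ] ℝ} (hs : ∀ u v, G u v = G v u)
    (hp : ∀ u, u ≠ 0 → 0 < G u u) : (gramMat G).PosDef := by
  refine Matrix.PosDef.of_dotProduct_mulVec_pos ?_ fun x hx ↦ ?_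
  · ext a b
    simp [gramMat_apply, hs (bvec b)]
  · have h := hp (WithLp.toLp 2 x) (by simpa using hx)
    rw [apply_eq_sum_gramMat] at h
    convert! h using 1
    simp only [dotProduct, Matrix.mulVec, Finset.mul_sum]
    exact Finset.sum_congr rfl fun a _ ↦ Finset.sum_congr rfl fun b _ ↦ by simp; ring

theorem gramMat_bilinearComp (G : Model m →L[ℝ] Model m →L[ℝ] ℝ) (A B : Model m →L[ℝ] Model m) :
    gramMat (G.bilinearComp A B) = (toMat A).transpose * gramMat G * toMat B := by
  ext a b
  rw [gramMat_apply, ContinuousLinearMap.bilinearComp_apply, apply_eq_sum_gramMat]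
  simp only [Matrix.mul_apply, Matrix.transpose_apply, toMat_apply, Finset.sum_mul]
  rw [Finset.sum_comm]
  exact Finset.sum_congr rfl fun c _ ↦ Finset.sum_congr rfl fun d _ ↦ by ring

/-- Existence of the Levi-Civita connection, as a statement on the one-jet of the metric. -/
theorem exists_christoffel {G : Model m →L[ℝ] Model m →L[ℝ] ℝ} (hs : ∀ u v, G u v = G v u)
    (hp : ∀ u, u ≠ 0 → 0 < G u u) (G' : Model m →L[ℝ] Model m →L[ℝ] Model m →L[ℝ] ℝ)
    (hs' : ∀ u v w, G' u v w = G' u w v) :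
    ∃ Γ : Model m →L[ℝ] Model m →L[ℝ] Model m, (∀ u v, Γ u v = Γ v u) ∧
      ∀ u v w, G' u v w = G (Γ u v) w + G v (Γ u w) := by
  have hinj : Function.Injective (G : Model m →ₗ[ℝ] Model m →L[ℝ] ℝ) := by
    rw [injective_iff_map_eq_zero]
    intro u hu
    by_contra h
    have := hp u h
    rw [show G u = 0 from hu] at this
    simp at this
  have hfin : Module.finrank ℝ (Model m) = Module.finrank ℝ (Model m →L[ℝ] ℝ) := by
    rw [← (LinearMap.toContinuousLinearMap (𝕜 := ℝ) (E := Model m) (F' := ℝ)).finrank_eq]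
    exact (Subspace.dual_finrank_eq (K := ℝ) (V := Model m)).symm
  let e := LinearEquiv.ofInjectiveOfFinrankEq _ hinj hfin
  have he : ∀ φ w, G (e.symm φ) w = φ w := fun φ w ↦
    DFunLike.congr_fun (e.apply_symm_apply φ) w
  -- The Koszul formula gives the Christoffel symbols of the first kind; nondegeneracy of G raises
  -- the index.
  let κ : Model m →ₗ[ℝ] Model m →ₗ[ℝ] Model m →L[ℝ] ℝ :=
    LinearMap.mk₂ ℝ (fun u v ↦ (2⁻¹ : ℝ) • (G' u v + G' v u - (G'.flip u).flip v))
      (fun u u' v ↦ by ext w; simp; ring) (fun c u v ↦ by ext w; simp; ring)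
      (fun u v v' ↦ by ext w; simp; ring) (fun c u v ↦ by ext w; simp; ring)
  have hκ : ∀ u v w, κ u v w = 2⁻¹ * (G' u v w + G' v u w - G' w u v) := fun u v w ↦ rfl
  let Γ : Model m →L[ℝ] Model m →L[ℝ] Model m :=
    LinearMap.toContinuousLinearMap
      ((LinearMap.toContinuousLinearMap : (Model m →ₗ[ℝ] Model m) ≃ₗ[ℝ] _).toLinearMap ∘ₗ
        (κ.compr₂ e.symm.toLinearMap))
  have hΓ : ∀ u v w, G (Γ u v) w = 2⁻¹ * (G' u v w + G' v u w - G' w u v) := fun u v w ↦ by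
    rw [← hκ]; exact he (κ u v) w
  refine ⟨Γ, fun u v ↦ ?_, fun u v w ↦ ?_⟩
  · apply hinj
    ext w
    change G (Γ u v) w = G (Γ v u) w
    rw [hΓ, hΓ, hs' w u v]; ring
  · rw [hs v, hΓ, hΓ, hs' u w v]
    ring

/-- The Kähler condition, as a statement on the one-jets of the metric and of the complex
structure: the complex structure is parallel. -/
theorem parallel_of_kahler {G : Model m →L[ℝ] Model m →L[ℝ] ℝ} (hs : ∀ u v, G u v = G v u)
    (hp : ∀ u, u ≠ 0 → 0 < G u u) {G' : Model m →L[ℝ] Model m →L[ℝ] Model m →L[ℝ] ℝ}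
    {Γ : Model m →L[ℝ] Model m →L[ℝ] Model m} (hΓ : ∀ u v, Γ u v = Γ v u)
    (hG' : ∀ u v w, G' u v w = G (Γ u v) w + G v (Γ u w))
    {C : Model m →L[ℝ] Model m} {C' : Model m →L[ℝ] Model m →L[ℝ] Model m}
    (sq : ∀ v, C (C v) = -v) (herm : ∀ v w, G (C v) (C w) = G v w)
    (sq' : ∀ u v, C' u (C v) + C (C' u v) = 0)
    (herm' : ∀ u v w, G' u (C v) (C w) + G (C' u v) (C w) + G (C v) (C' u w) = G' u v w)
    (closed : ∀ u v w, (G' u (C v) w + G (C' u v) w) - (G' v (C u) w + G (C' v u) w) +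
      (G' w (C u) v + G (C' w u) v) = 0)
    (nij : ∀ v w, C' (C v) w - C' (C w) v + C (C' w v) - C (C' v w) = 0) (u : Model m) :
    C' u = C ∘L Γ u - Γ u ∘L C := by
  have skew : ∀ v w, G (C v) w = -G v (C w) := fun v w ↦ by
    have := herm v (C w)
    rw [sq, map_neg] at this
    linarith
  -- S is ∇C, and T below is the covariant derivative of the Kähler form; the goal is S = 0.
  let S : Model m → Model m → Model m := fun u v ↦ C' u v - C (Γ u v) + Γ u (C v)
  have hSC : ∀ u v, S u (C v) = -C (S u v) := fun u v ↦ by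
    have := sq' u v
    simp only [S, map_add, map_sub, sq, map_neg]
    rw [eq_neg_of_add_eq_zero_left this]
    abel
  let T : Model m → Model m → Model m → ℝ := fun u v w ↦ G (S u v) w
  have hT1 : ∀ u v w, T u v w = -T u w v := by
    have key : ∀ u v w, G (S u v) (C w) + G (C v) (S u w) = 0 := by
      intro u v w
      have h1 := herm' u v w
      have h2 := herm (Γ u v) w
      have h3 := herm v (Γ u w)
      rw [hG', hG'] at h1
      simp only [S, map_add, map_sub, _root_.add_apply, _root_.sub_apply]
      linarith
    intro u v w
    have h1 := key u v (C w)
    rw [hSC, sq, map_neg, map_neg, herm, hs v] at h1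
    change G (S u v) w = -G (S u w) v
    linarith
  have hT2 : ∀ u v w, T u (C v) w = T u v (C w) := fun u v w ↦ by
    change G (S u (C v)) w = G (S u v) (C w)
    rw [hSC, map_neg, _root_.neg_apply, skew, neg_neg]
  -- Closedness of the Kähler form, with ordinary derivatives replaced by covariant ones; the Γ
  -- terms cancel by symmetry.
  have hT3 : ∀ u v w, T u v w + T v w u + T w u v = 0 := by
    intro u v w
    have h1 := closed u v w
    rw [hG', hG', hG'] at h1
    have h2 := hT1 v w u
    have e : ∀ u v w, T u v w = G (C' u v) w - G (C (Γ u v)) w + G (Γ u (C v)) w :=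
      fun u v w ↦ by simp [T, S]
    rw [h2]
    simp only [e]
    rw [hs (C v), hs (C u), hs (C u)] at h1
    have a1 := skew (Γ u v) w
    have a2 := skew (Γ v u) w
    have a3 := skew (Γ w u) v
    rw [hΓ v u] at *
    rw [hΓ w u] at *
    rw [hΓ w v] at *
    linarith
  -- Vanishing of the Nijenhuis tensor, rewritten in the same way in terms of ∇C.
  have hT4 : ∀ u v w, T (C u) v w - T (C v) u w - T v u (C w) + T u v (C w) = 0 := by
    intro u v w
    have h1 := congrArg (fun z ↦ G z w) (nij u v)
    have e : ∀ u v w, T u v w = G (C' u v) w - G (C (Γ u v)) w + G (Γ u (C v)) w :=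
      fun u v w ↦ by simp [T, S]
    simp only [map_add, map_sub, _root_.add_apply, _root_.sub_apply, map_zero,
      _root_.zero_apply] at h1
    simp only [e]
    rw [skew (C' v u), skew (C' u v)] at h1
    have b1 := herm (Γ v u) w
    have b2 := herm (Γ u v) w
    have b3 := skew (Γ (C u) v) w
    have b4 := skew (Γ (C v) u) w
    rw [hΓ v u] at *
    rw [hΓ v (C u)] at *
    rw [hΓ u (C v)] at *
    rw [hΓ (C u) (C v)]
    linarith
  -- This expression is symmetric in u, v by the Nijenhuis condition and skew in v, w. A trilinear
  -- form with both symmetries vanishes, by alternating the two exchanges three times each.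
  have hS0 : ∀ u v w, T (C u) v w + T u v (C w) = 0 := by
    have s1 : ∀ u v w, T (C u) v w + T u v (C w) = T (C v) u w + T v u (C w) := fun u v w ↦ by
      linarith [hT4 u v w]
    have s2 : ∀ u v w, T (C u) v w + T u v (C w) = -(T (C u) w v + T u w (C v)) := fun u v w ↦ by
      rw [hT1 (C u) v w, ← hT2 u v w, hT1 u (C v) w]; ring
    intro u v w
    linarith [s1 u v w, s2 v u w, s1 v w u, s2 w v u, s1 w u v, s2 u w v]
  -- Put C u for u in the cyclic identity. Writing a, b, c for the three cyclic values of T u v (C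
  -- w), this reads -a + b + c = 0 together with its rotations, which forces a = b = c = 0.
  have hU : ∀ u v w, T u v (C w) = 0 := by
    have c : ∀ u v w, -T u v (C w) + T v w (C u) + T w u (C v) = 0 := fun u v w ↦ by
      have := hT3 (C u) v w
      rw [hT2 w u v] at this
      linarith [hS0 u v w]
    intro u v w
    linarith [c u v w, c v w u, c w u v]
  have hS : ∀ v, S u v = 0 := by
    intro v
    by_contra h
    have h1 := hp _ h
    have h2 := hU u v (C (S u v))
    rw [sq] at h2
    change G (S u v) (-S u v) = 0 at h2
    rw [map_neg] at h2
    linarith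
  ext1 v
  have := hS v
  simp only [S] at this
  simp only [_root_.sub_apply, ContinuousLinearMap.comp_apply]
  rw [← sub_eq_zero, ← this]
  abel

end Connection

/-! ### Forms, endomorphisms and metrics in charts -/

section Charts

open Set Filter Topology

variable {m : ℕ} {M : Type*} [TopologicalSpace M] [ChartedSpace (EuclideanSpace ℝ (Fin m)) M]
  [IsManifold (𝓡 m) ∞ M]

/-- The differential of the preferred chart at `c`, at the point of coordinates `y`. -/
def chartDerivAt (c : M) (y : Model m) :
    TangentSpace (𝓡 m) ((extChartAt (𝓡 m) c).symm y) →L[ℝ] Model m :=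
  mfderiv (𝓡 m) 𝓘(ℝ, Model m) (extChartAt (𝓡 m) c) ((extChartAt (𝓡 m) c).symm y)

theorem chartInvDeriv_eq_mfderivWithin (c : M) (y : Model m) :
    chartInvDeriv c y =
      mfderivWithin 𝓘(ℝ, Model m) (𝓡 m) (extChartAt (𝓡 m) c).symm (range (𝓡 m)) y := by
  rw [ModelWithCorners.range_eq_univ, mfderivWithin_univ]
  rfl

theorem chartDerivAt_comp_chartInvDeriv {c : M} {y : Model m}
    (hy : y ∈ (extChartAt (𝓡 m) c).target) :
    chartDerivAt c y ∘L chartInvDeriv c y = ContinuousLinearMap.id ℝ (Model m) := by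
  rw [chartInvDeriv_eq_mfderivWithin]
  exact mfderiv_extChartAt_comp_mfderivWithin_extChartAt_symm hy

theorem chartInvDeriv_comp_chartDerivAt {c : M} {y : Model m}
    (hy : y ∈ (extChartAt (𝓡 m) c).target) :
    chartInvDeriv c y ∘L chartDerivAt c y = ContinuousLinearMap.id ℝ _ := by
  rw [chartInvDeriv_eq_mfderivWithin]
  exact mfderivWithin_extChartAt_symm_comp_mfderiv_extChartAt hy

theorem chartDerivAt_chartInvDeriv {c : M} {y : Model m}
    (hy : y ∈ (extChartAt (𝓡 m) c).target) (v : Model m) :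
    chartDerivAt c y (chartInvDeriv c y v) = v :=
  DFunLike.congr_fun (chartDerivAt_comp_chartInvDeriv hy) v

theorem chartInvDeriv_chartDerivAt {c : M} {y : Model m}
    (hy : y ∈ (extChartAt (𝓡 m) c).target)
    (v : TangentSpace (𝓡 m) ((extChartAt (𝓡 m) c).symm y)) :
    chartInvDeriv c y (chartDerivAt c y v) = v :=
  DFunLike.congr_fun (chartInvDeriv_comp_chartDerivAt hy) v

theorem isOpen_target (c : M) : IsOpen (extChartAt (𝓡 m) c).target := isOpen_extChartAt_target c

theorem target_mem_nhds {c : M} {y : Model m} (hy : y ∈ (extChartAt (𝓡 m) c).target) :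
    (extChartAt (𝓡 m) c).target ∈ 𝓝 y := (isOpen_target c).mem_nhds hy

/-! ### Changes of charts -/

/-- The change of coordinates from the preferred chart at `c` to the one at `c'`. -/
def transition (c c' : M) : Model m → Model m :=
  extChartAt (𝓡 m) c' ∘ (extChartAt (𝓡 m) c).symm

theorem contDiffAt_transition {c c' : M} {y : Model m} (hy : y ∈ (extChartAt (𝓡 m) c).target)
    (hy' : (extChartAt (𝓡 m) c).symm y ∈ (extChartAt (𝓡 m) c').source) :
    ContDiffAt ℝ ∞ (transition c c') y := by
  have h := contDiffWithinAt_ext_coord_change (I := 𝓡 m) (n := ∞) c' c (y := y) ⟨hy, hy'⟩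
  rwa [ModelWithCorners.range_eq_univ, contDiffWithinAt_univ] at h

theorem transition_symm {c c' : M} {y : Model m}
    (hy' : (extChartAt (𝓡 m) c).symm y ∈ (extChartAt (𝓡 m) c').source) :
    (extChartAt (𝓡 m) c').symm (transition c c' y) = (extChartAt (𝓡 m) c).symm y :=
  (extChartAt (𝓡 m) c').left_inv hy'

theorem transition_mem {c c' : M} {y : Model m}
    (hy' : (extChartAt (𝓡 m) c).symm y ∈ (extChartAt (𝓡 m) c').source) :
    transition c c' y ∈ (extChartAt (𝓡 m) c').target :=
  (extChartAt (𝓡 m) c').map_source hy'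

/-- `chartInvDeriv` as an endomorphism of the model space. -/
def frame (c : M) (y : Model m) : Model m →L[ℝ] Model m := chartInvDeriv c y

/-- `chartDerivAt` as an endomorphism of the model space. -/
def coframe (c : M) (y : Model m) : Model m →L[ℝ] Model m := chartDerivAt c y

theorem frame_comp_coframe {c : M} {y : Model m} (hy : y ∈ (extChartAt (𝓡 m) c).target) :
    frame c y ∘L coframe c y = ContinuousLinearMap.id ℝ (Model m) :=
  chartInvDeriv_comp_chartDerivAt hy

theorem mdifferentiableAt_extChartAt_symm {c : M} {y : Model m}
    (hy : y ∈ (extChartAt (𝓡 m) c).target) :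
    MDifferentiableAt 𝓘(ℝ, Model m) (𝓡 m) (extChartAt (𝓡 m) c).symm y := by
  have := mdifferentiableWithinAt_extChartAt_symm (I := 𝓡 m) hy
  rwa [ModelWithCorners.range_eq_univ, mdifferentiableWithinAt_univ] at this

theorem coframe_of_symm_eq {c : M} {y : Model m} {x : M} (hx : (extChartAt (𝓡 m) c).symm y = x) :
    coframe c y = mfderiv (𝓡 m) 𝓘(ℝ, Model m) (extChartAt (𝓡 m) c) x := by
  subst hx; rfl

theorem fderiv_transition {c c' : M} {y : Model m} (hy : y ∈ (extChartAt (𝓡 m) c).target)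
    (hy' : (extChartAt (𝓡 m) c).symm y ∈ (extChartAt (𝓡 m) c').source) :
    fderiv ℝ (transition c c') y = coframe c' (transition c c' y) ∘L frame c y := by
  rw [coframe_of_symm_eq (transition_symm hy'), ← mfderiv_eq_fderiv]
  exact mfderiv_comp y (mdifferentiableAt_extChartAt (by simpa using hy'))
    (mdifferentiableAt_extChartAt_symm hy)

/-- Chain rule for the two coordinate frames; the transformation laws of forms and metrics all come
from it. -/
theorem frame_eq {c c' : M} {y : Model m} (hy : y ∈ (extChartAt (𝓡 m) c).target)
    (hy' : (extChartAt (𝓡 m) c).symm y ∈ (extChartAt (𝓡 m) c').source) :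
    frame c y = frame c' (transition c c' y) ∘L fderiv ℝ (transition c c') y := by
  rw [fderiv_transition hy hy', ← ContinuousLinearMap.comp_assoc,
    frame_comp_coframe (transition_mem hy'), ContinuousLinearMap.id_comp]

/-- The tangent space at x is identified with the model space through the preferred chart at x, so a
tensor at x is its own expression in that chart. -/
theorem frame_self (x : M) : frame x (extChartAt (𝓡 m) x x) = ContinuousLinearMap.id ℝ _ := by
  have := mfderivWithin_range_extChartAt_symm (I := 𝓡 m) (x := x)
  rwa [← chartInvDeriv_eq_mfderivWithin] at this

variable {𝕜 : Type*} [RCLike 𝕜] {k : ℕ}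

/-- A form as a family of forms on the model space. -/
def KForm.val (η : KForm m M 𝕜 k) (x : M) : Model m [⋀^Fin k]→L[ℝ] 𝕜 := η x

theorem KForm.inChart_eq (η : KForm m M 𝕜 k) (c : M) (y : Model m) :
    η.inChart c y =
      (η.val ((extChartAt (𝓡 m) c).symm y)).compContinuousLinearMap (frame c y) := rfl

theorem KForm.inChart_transition (η : KForm m M 𝕜 k) {c c' : M} {y : Model m}
    (hy : y ∈ (extChartAt (𝓡 m) c).target)
    (hy' : (extChartAt (𝓡 m) c).symm y ∈ (extChartAt (𝓡 m) c').source) :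
    η.inChart c y = (η.inChart c' (transition c c' y)).compContinuousLinearMap
      (fderiv ℝ (transition c c') y) := by
  rw [KForm.inChart_eq, KForm.inChart_eq, transition_symm hy', frame_eq hy hy']
  rfl

theorem KForm.IsSmooth.contDiffAt {η : KForm m M 𝕜 k} (hη : η.IsSmooth) {c : M} {y : Model m}
    (hy : y ∈ (extChartAt (𝓡 m) c).target) : ContDiffAt ℝ ∞ (η.inChart c) y :=
  (hη c).contDiffAt (target_mem_nhds hy)

/-- The exterior derivative in charts. -/
theorem KForm.d_inChart {η : KForm m M 𝕜 k} (hη : η.IsSmooth) {c : M} {y : Model m}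
    (hy : y ∈ (extChartAt (𝓡 m) c).target) :
    (KForm.d η).inChart c y = extDeriv (η.inChart c) y := by
  set x := (extChartAt (𝓡 m) c).symm y with hx
  have hxs : x ∈ (extChartAt (𝓡 m) x).source := mem_extChartAt_source x
  have hτ : transition c x y = extChartAt (𝓡 m) x x := rfl
  -- The definition of d at x uses the chart centred at x. Near y the expression in the chart at c
  -- is a pullback of that one by the transition map, and the exterior derivative commutes with
  -- pullbacks.
  have h1 : η.inChart c =ᶠ[𝓝 y] fun z ↦ (η.inChart x (transition c x z)).compContinuousLinearMap
      (fderiv ℝ (transition c x) z) := by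
    have h2 : ContinuousAt (extChartAt (𝓡 m) c).symm y := continuousAt_extChartAt_symm'' hy
    filter_upwards [target_mem_nhds hy, h2.preimage_mem_nhds
      ((isOpen_extChartAt_source (I := 𝓡 m) x).mem_nhds hxs)] with z hz hz'
    exact η.inChart_transition hz hz'
  rw [h1.extDeriv_eq, extDeriv_pullback (r := ∞)
    ((hη.contDiffAt (transition_mem hxs)).differentiableAt (by simp))
    (contDiffAt_transition hy hxs) (by simpa using (WithTop.coe_le_coe (α := ℕ∞)).2 (le_top (a := 2))), fderiv_transition hy hxs, hτ,
    coframe_of_symm_eq (extChartAt_to_inv x)]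
  rfl

/-- The vector field with constant coordinates `v` in the preferred chart at `c`. -/
def coordField (c : M) (v : Model m) (p : M) : TangentSpace (𝓡 m) p :=
  (trivializationAt (Model m) (TangentSpace (𝓡 m)) c).symmL ℝ p v

theorem coordField_symm {c : M} {y : Model m} (hy : y ∈ (extChartAt (𝓡 m) c).target)
    (v : Model m) : coordField c v ((extChartAt (𝓡 m) c).symm y) = chartInvDeriv c y v := by
  have hs : (extChartAt (𝓡 m) c).symm y ∈ (chartAt (Model m) c).source := by
    simpa using (extChartAt (𝓡 m) c).map_target hy
  have h : (trivializationAt (Model m) (TangentSpace (𝓡 m)) c).continuousLinearMapAt ℝ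
      ((extChartAt (𝓡 m) c).symm y) = chartDerivAt c y :=
    TangentBundle.continuousLinearMapAt_trivializationAt hs
  have hb : (extChartAt (𝓡 m) c).symm y ∈
      (trivializationAt (Model m) (TangentSpace (𝓡 m)) c).baseSet := by simpa using hs
  have h2 := (trivializationAt (Model m) (TangentSpace (𝓡 m)) c).symmL_continuousLinearMapAt
    (R := ℝ) hb (chartInvDeriv c y v)
  rw [h] at h2
  erw [chartDerivAt_chartInvDeriv hy] at h2
  exact h2

theorem isSmoothFieldAt_coordField {c p : M} (hp : p ∈ (extChartAt (𝓡 m) c).source) (v : Model m) :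
    IsSmoothFieldAt (coordField c v) p := by
  have hb : p ∈ (trivializationAt (Model m) (TangentSpace (𝓡 m)) c).baseSet := by simpa using hp
  refine ((trivializationAt (Model m) (TangentSpace (𝓡 m)) c).contMDiffAt_section_iff hb).2 ?_
  refine (contMDiffAt_const (c := v)).congr_of_eventuallyEq ?_
  filter_upwards [(trivializationAt (Model m) (TangentSpace (𝓡 m)) c).open_baseSet.mem_nhds hb]
    with q hq
  have h := (trivializationAt (Model m) (TangentSpace (𝓡 m)) c).continuousLinearMapAt_symmL
    (R := ℝ) hq v
  rwa [Bundle.Trivialization.continuousLinearMapAt_apply,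
    Bundle.Trivialization.linearMapAt_apply, if_pos hq] at h

/-- A field of endomorphisms in the preferred chart at `c`. -/
def EndField.inChart (C : EndField m M) (c : M) (y : Model m) : Model m →L[ℝ] Model m :=
  chartDerivAt c y ∘L C ((extChartAt (𝓡 m) c).symm y) ∘L chartInvDeriv c y

/-- A metric as a family of bilinear forms on the model space. -/
def Metric.val (g : Metric m M) (x : M) : Model m →L[ℝ] Model m →L[ℝ] ℝ := g.inner x

/-- The metric in the preferred chart at `c`. -/
def Metric.inChart (g : Metric m M) (c : M) (y : Model m) : Model m →L[ℝ] Model m →L[ℝ] ℝ :=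
  (g.val ((extChartAt (𝓡 m) c).symm y)).bilinearComp (frame c y) (frame c y)

theorem EndField.IsSmooth.apply {C : EndField m M} (hC : C.IsSmooth)
    {V : (x : M) → TangentSpace (𝓡 m) x} {x : M} (hV : IsSmoothFieldAt V x) :
    IsSmoothFieldAt (fun p ↦ C p (V p)) x :=
  ContMDiffAt.clm_bundle_apply (F₁ := Model m) (F₂ := Model m) hC.contMDiffAt hV

theorem IsSmoothFieldAt.contDiffAt {V : (x : M) → TangentSpace (𝓡 m) x} {c : M} {y : Model m}
    (hy : y ∈ (extChartAt (𝓡 m) c).target)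
    (hV : IsSmoothFieldAt V ((extChartAt (𝓡 m) c).symm y)) :
    ContDiffAt ℝ ∞ (fun z ↦ chartDerivAt c z (V ((extChartAt (𝓡 m) c).symm z))) y := by
  have hs : (extChartAt (𝓡 m) c).symm y ∈ (extChartAt (𝓡 m) c).source :=
    (extChartAt (𝓡 m) c).map_target hy
  have hb : (extChartAt (𝓡 m) c).symm y ∈
      (trivializationAt (Model m) (TangentSpace (𝓡 m)) c).baseSet := by simpa using hs
  have h := ((trivializationAt (Model m) (TangentSpace (𝓡 m)) c).contMDiffAt_section_iff hb).1 hV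
  have h2 := h.comp y ((contMDiffOn_extChartAt_symm c).contMDiffAt (target_mem_nhds hy))
  refine h2.contDiffAt.congr_of_eventuallyEq ?_
  filter_upwards [target_mem_nhds hy] with z hz
  have hs : (extChartAt (𝓡 m) c).symm z ∈ (chartAt (Model m) c).source := by
    simpa using (extChartAt (𝓡 m) c).map_target hz
  have h : (trivializationAt (Model m) (TangentSpace (𝓡 m)) c).continuousLinearMapAt ℝ
      ((extChartAt (𝓡 m) c).symm z) = chartDerivAt c z :=
    TangentBundle.continuousLinearMapAt_trivializationAt hs
  rw [← h, Bundle.Trivialization.continuousLinearMapAt_apply,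
    Bundle.Trivialization.linearMapAt_apply, if_pos (by simpa using hs)]
  rfl

/-- As F has finite dimension, a basis identifies operators with tuples of values; smoothness can
then be tested on the coordinate fields. -/
theorem contDiffAt_clm_apply {n : WithTop ℕ∞} {E F G : Type*} [NormedAddCommGroup E]
    [NormedSpace ℝ E] [NormedAddCommGroup F] [NormedSpace ℝ F] [FiniteDimensional ℝ F]
    [NormedAddCommGroup G] [NormedSpace ℝ G] {f : E → F →L[ℝ] G} {x : E} :
    ContDiffAt ℝ n f x ↔ ∀ v, ContDiffAt ℝ n (fun y ↦ f y v) x := by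
  refine ⟨fun h v ↦ h.clm_apply contDiffAt_const, fun h ↦ ?_⟩
  let d := Module.finrank ℝ F
  let e₁ : F ≃L[ℝ] (Fin d → ℝ) := ContinuousLinearEquiv.ofFinrankEq (by simp [d])
  let e₂ := (e₁.arrowCongr (1 : G ≃L[ℝ] G)).trans (ContinuousLinearEquiv.piRing (Fin d))
  rw [← e₂.comp_contDiffAt_iff, contDiffAt_pi]
  intro i
  exact h _

theorem EndField.IsSmooth.contDiffAt {C : EndField m M} (hC : C.IsSmooth) {c : M} {y : Model m}
    (hy : y ∈ (extChartAt (𝓡 m) c).target) : ContDiffAt ℝ ∞ (C.inChart c) y := by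
  rw [contDiffAt_clm_apply]
  intro v
  refine (IsSmoothFieldAt.contDiffAt hy (hC.apply (isSmoothFieldAt_coordField
    ((extChartAt (𝓡 m) c).map_target hy) v))).congr_of_eventuallyEq ?_
  filter_upwards [target_mem_nhds hy] with z hz
  rw [coordField_symm hz]
  rfl

theorem Metric.contDiffAt_inChart (g : Metric m M) {c : M} {y : Model m}
    (hy : y ∈ (extChartAt (𝓡 m) c).target) : ContDiffAt ℝ ∞ (g.inChart c) y := by
  rw [contDiffAt_clm_apply]
  intro v
  rw [contDiffAt_clm_apply]
  intro w
  have hs : (extChartAt (𝓡 m) c).symm y ∈ (extChartAt (𝓡 m) c).source :=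
    (extChartAt (𝓡 m) c).map_target hy
  have h : ContMDiffAt (𝓡 m) ((𝓡 m).prod 𝓘(ℝ)) ∞ (fun p ↦ Bundle.TotalSpace.mk' ℝ
      (E := Bundle.Trivial M ℝ) p (g.inner p (coordField c v p) (coordField c w p)))
      ((extChartAt (𝓡 m) c).symm y) :=
    ContMDiffAt.clm_bundle_apply₂ (F₁ := Model m) (F₂ := Model m) g.contMDiff.contMDiffAt
      (isSmoothFieldAt_coordField hs v) (isSmoothFieldAt_coordField hs w)
  rw [Bundle.contMDiffAt_totalSpace] at h
  refine (h.2.comp y ((contMDiffOn_extChartAt_symm c).contMDiffAt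
    (target_mem_nhds hy))).contDiffAt.congr_of_eventuallyEq ?_
  filter_upwards [target_mem_nhds hy] with z hz
  change g.inner _ (chartInvDeriv c z v) (chartInvDeriv c z w) = _
  rw [← coordField_symm hz, ← coordField_symm hz]
  rfl

end Charts

/-! ### Smoothness of alternating forms from their values -/

section Alternating

open ContinuousAlternatingMap

/-- By induction the contractions are smooth, and the form is recovered from them: alternating
`curryLeft` multiplies a form of degree k + 1 by k + 1. -/
theorem contDiffAt_alternating {n : WithTop ℕ∞} {E V F : Type*} [NormedAddCommGroup E]
    [NormedSpace ℝ E] [NormedAddCommGroup V] [NormedSpace ℝ V] [FiniteDimensional ℝ V]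
    [NormedAddCommGroup F] [NormedSpace ℝ F] {k : ℕ} {f : E → V [⋀^Fin k]→L[ℝ] F} {x : E}
    (h : ∀ v, ContDiffAt ℝ n (fun y ↦ f y v) x) : ContDiffAt ℝ n f x := by
  induction k with
  | zero =>
    have h1 := (constOfIsEmptyLIE ℝ V F (Fin 0)).contDiff.contDiffAt.comp x (h ![])
    convert! h1 using 1
    funext y
    ext v
    simp [Subsingleton.elim v ![]]
  | succ k ih =>
    have h1 : ContDiffAt ℝ n (fun y ↦ (f y).curryLeft) x := by
      rw [contDiffAt_clm_apply]
      exact fun v ↦ ih fun w ↦ h (Matrix.vecCons v w)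
    have h2 := ((alternatizeUncurryFinCLM ℝ V F (n := k)).contDiff.contDiffAt.comp x h1).const_smul
      ((k + 1 : ℝ)⁻¹)
    convert! h2 using 1
    funext y
    have h3 := alternatizeUncurryFin_curryLeft_comp (ContinuousLinearMap.id ℝ V) (f y)
    rw [ContinuousLinearMap.comp_id] at h3
    change f y = (k + 1 : ℝ)⁻¹ • alternatizeUncurryFin (f y).curryLeft
    rw [h3, eq_inv_smul_iff₀ (by positivity)]
    ext v
    simp [derivExt_apply, Finset.sum_const]
    module

end Alternating

/-! ### The Kähler condition in charts -/

section Charts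

open Set Filter Topology

variable {m : ℕ} {M : Type*} [TopologicalSpace M] [ChartedSpace (EuclideanSpace ℝ (Fin m)) M]
  [IsManifold (𝓡 m) ∞ M]

theorem mlieBracket_eq_lieBracket (V W : (x : Model m) → TangentSpace 𝓘(ℝ, Model m) x) :
    VectorField.mlieBracket 𝓘(ℝ, Model m) V W = VectorField.lieBracket ℝ V W := by
  rw [← VectorField.mlieBracketWithin_univ, VectorField.mlieBracketWithin_eq_lieBracketWithin]
  exact VectorField.lieBracketWithin_univ

theorem mlieBracket_inChart {V W : (x : M) → TangentSpace (𝓡 m) x} {c : M} {y : Model m}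
    (hy : y ∈ (extChartAt (𝓡 m) c).target)
    (hV : IsSmoothFieldAt V ((extChartAt (𝓡 m) c).symm y))
    (hW : IsSmoothFieldAt W ((extChartAt (𝓡 m) c).symm y)) :
    chartDerivAt c y (VectorField.mlieBracket (𝓡 m) V W ((extChartAt (𝓡 m) c).symm y)) =
      VectorField.lieBracket ℝ (fun z ↦ chartDerivAt c z (V ((extChartAt (𝓡 m) c).symm z)))
        (fun z ↦ chartDerivAt c z (W ((extChartAt (𝓡 m) c).symm z))) y := by
  have hinv : ∀ z ∈ (extChartAt (𝓡 m) c).target,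
      (mfderiv 𝓘(ℝ, Model m) (𝓡 m) (extChartAt (𝓡 m) c).symm z).inverse = chartDerivAt c z :=
    fun z hz ↦ ContinuousLinearMap.inverse_eq (chartInvDeriv_comp_chartDerivAt hz)
      (chartDerivAt_comp_chartInvDeriv hz)
  have hp : ∀ U : (x : M) → TangentSpace (𝓡 m) x,
      VectorField.mpullback 𝓘(ℝ, Model m) (𝓡 m) (extChartAt (𝓡 m) c).symm U =ᶠ[𝓝 y]
        fun z ↦ chartDerivAt c z (U ((extChartAt (𝓡 m) c).symm z)) := fun U ↦ by
    filter_upwards [target_mem_nhds hy] with z hz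
    rw [VectorField.mpullback_apply, hinv z hz]
    rfl
  have hle : minSmoothness ℝ 2 ≤ ∞ := by
    simpa using (WithTop.coe_le_coe (α := ℕ∞)).2 (le_top (a := 2))
  have : IsManifold (𝓡 m) (minSmoothness ℝ 2) M := IsManifold.of_le hle
  have h := VectorField.mpullback_mlieBracket (hV.mdifferentiableAt (by simp))
    (hW.mdifferentiableAt (by simp))
    ((contMDiffOn_extChartAt_symm (n := ∞) c).contMDiffAt (target_mem_nhds hy)) hle
  rw [VectorField.mpullback_apply, hinv y hy] at h
  refine Eq.trans h ?_
  exact ((hp V).mlieBracket_vectorField_eq (hp W)).trans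
    (congrFun (mlieBracket_eq_lieBracket _ _) y)

theorem EndField.inChart_apply (C : EndField m M) (c : M) (y v : Model m) :
    C.inChart c y v =
      chartDerivAt c y (C ((extChartAt (𝓡 m) c).symm y) (chartInvDeriv c y v)) := rfl

theorem chartInvDeriv_inChart (C : EndField m M) {c : M} {y : Model m}
    (hy : y ∈ (extChartAt (𝓡 m) c).target) (v : Model m) :
    chartInvDeriv c y (C.inChart c y v) =
      C ((extChartAt (𝓡 m) c).symm y) (chartInvDeriv c y v) :=
  chartInvDeriv_chartDerivAt hy _

theorem Metric.inChart_apply (g : Metric m M) (c : M) (y v w : Model m) :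
    g.inChart c y v w =
      g.inner ((extChartAt (𝓡 m) c).symm y) (chartInvDeriv c y v) (chartInvDeriv c y w) := rfl

theorem Metric.inChart_symm (g : Metric m M) (c : M) (y v w : Model m) :
    g.inChart c y v w = g.inChart c y w v := g.symm _ _ _

theorem Metric.inChart_pos (g : Metric m M) {c : M} {y : Model m}
    (hy : y ∈ (extChartAt (𝓡 m) c).target) (v : Model m) (hv : v ≠ 0) :
    0 < g.inChart c y v v := by
  refine g.pos _ _ fun h ↦ hv ?_
  have h' : chartInvDeriv c y v = 0 := h
  rw [← chartDerivAt_chartInvDeriv hy v, h', map_zero]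

theorem gramInChart_eq (g : Metric m M) (c : M) (y : Model m) :
    gramInChart g c y = gramMat (g.inChart c y) := rfl

/-- Integrability is tested on coordinate fields. These have constant components and commute, so
only first derivatives of C remain in the brackets. -/
theorem IsComplexStructure.nijenhuis_inChart {C : EndField m M} (hC : IsComplexStructure C) {c : M}
    {y : Model m} (hy : y ∈ (extChartAt (𝓡 m) c).target) (v w : Model m) :
    fderiv ℝ (C.inChart c) y (C.inChart c y v) w - fderiv ℝ (C.inChart c) y (C.inChart c y w) v
      + C.inChart c y (fderiv ℝ (C.inChart c) y w v)
      - C.inChart c y (fderiv ℝ (C.inChart c) y v w) = 0 := by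
  have hs : (extChartAt (𝓡 m) c).symm y ∈ (extChartAt (𝓡 m) c).source :=
    (extChartAt (𝓡 m) c).map_target hy
  have hv := isSmoothFieldAt_coordField hs v
  have hw := isSmoothFieldAt_coordField hs w
  have hCv := hC.smooth.apply hv
  have hCw := hC.smooth.apply hw
  have e0 : ∀ u, (fun z ↦ chartDerivAt c z (coordField c u ((extChartAt (𝓡 m) c).symm z)))
      =ᶠ[𝓝 y] fun _ ↦ u := fun u ↦ by
    filter_upwards [target_mem_nhds hy] with z hz
    rw [coordField_symm hz, chartDerivAt_chartInvDeriv hz]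
  have e1 : ∀ u, (fun z ↦ chartDerivAt c z (C ((extChartAt (𝓡 m) c).symm z)
      (coordField c u ((extChartAt (𝓡 m) c).symm z)))) =ᶠ[𝓝 y] fun z ↦ C.inChart c z u := fun u ↦ by
    filter_upwards [target_mem_nhds hy] with z hz
    rw [coordField_symm hz]
    rfl
  have hd : DifferentiableAt ℝ (C.inChart c) y :=
    (hC.smooth.contDiffAt hy).differentiableAt (by simp)
  have hf : ∀ u, fderiv ℝ (fun z ↦ C.inChart c z u) y = (fderiv ℝ (C.inChart c) y).flip u :=
    fun u ↦ by
    rw [fderiv_clm_apply hd (differentiableAt_const u)]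
    simp
  have hmove : ∀ X : TangentSpace (𝓡 m) ((extChartAt (𝓡 m) c).symm y),
      chartDerivAt c y (C ((extChartAt (𝓡 m) c).symm y) X) =
        C.inChart c y (chartDerivAt c y X) := fun X ↦ by
    rw [EndField.inChart_apply, chartInvDeriv_chartDerivAt hy]
  have h := congrArg (chartDerivAt c y) (hC.integrable _ _ _ hv hw)
  rw [nijenhuis, map_sub, map_sub, map_sub, map_zero, hmove, hmove, mlieBracket_inChart hy hCv hCw,
    mlieBracket_inChart hy hCv hw, mlieBracket_inChart hy hv hCw, mlieBracket_inChart hy hv hw,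
    (e1 v).lieBracket_vectorField_eq (e1 w), (e1 v).lieBracket_vectorField_eq (e0 w),
    (e0 v).lieBracket_vectorField_eq (e1 w), (e0 v).lieBracket_vectorField_eq (e0 w)] at h
  simp only [VectorField.lieBracket, hf, fderiv_fun_const, Pi.zero_apply, zero_apply,
    ContinuousLinearMap.flip_apply, zero_sub, sub_zero, map_neg, sub_neg_eq_add] at h
  exact h

theorem IsComplexStructure.inChart_sq {C : EndField m M} (hC : IsComplexStructure C) {c : M}
    {y : Model m} (hy : y ∈ (extChartAt (𝓡 m) c).target) (v : Model m) :
    C.inChart c y (C.inChart c y v) = -v := by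
  rw [EndField.inChart_apply, chartInvDeriv_inChart C hy, hC.sq, map_neg,
    chartDerivAt_chartInvDeriv hy]

theorem IsKahler.inChart_hermitian {g : Metric m M} {C : EndField m M} (hC : IsKahler g C) {c : M}
    {y : Model m} (hy : y ∈ (extChartAt (𝓡 m) c).target) (v w : Model m) :
    g.inChart c y (C.inChart c y v) (C.inChart c y w) = g.inChart c y v w := by
  rw [Metric.inChart_apply, chartInvDeriv_inChart C hy, chartInvDeriv_inChart C hy, hC.hermitian]
  rfl

/-- The one-jet at `y` of the expression of `g` in the chart at `c` is given by `Γ`. -/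
structure IsChristoffel (g : Metric m M) (c : M) (y : Model m)
    (Γ : Model m →L[ℝ] Model m →L[ℝ] Model m) : Prop where
  symm : ∀ u v, Γ u v = Γ v u
  metric : ∀ u v w, fderiv ℝ (g.inChart c) y u v w =
    g.inChart c y (Γ u v) w + g.inChart c y v (Γ u w)

theorem exists_isChristoffel (g : Metric m M) {c : M} {y : Model m}
    (hy : y ∈ (extChartAt (𝓡 m) c).target) : ∃ Γ, IsChristoffel g c y Γ := by
  have hd : DifferentiableAt ℝ (g.inChart c) y :=
    (g.contDiffAt_inChart hy).differentiableAt (by simp)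
  obtain ⟨Γ, h1, h2⟩ := exists_christoffel (g.inChart_symm c y) (g.inChart_pos hy)
    (fderiv ℝ (g.inChart c) y) fun u v w ↦ by
      have h := ((hd.hasFDerivAt.clm_apply (hasFDerivAt_const v y)).clm_apply
        (hasFDerivAt_const w y))
      have h' := ((hd.hasFDerivAt.clm_apply (hasFDerivAt_const w y)).clm_apply
        (hasFDerivAt_const v y))
      simp only [g.inChart_symm c _ w v] at h'
      simpa using congrArg (fun L ↦ L u) (h.unique h')
  exact ⟨Γ, h1, h2⟩

theorem IsKahler.closed_inChart {g : Metric m M} {C : EndField m M} (hC : IsKahler g C) {c : M}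
    {y : Model m} (hy : y ∈ (extChartAt (𝓡 m) c).target) (u v w : Model m) :
    (fderiv ℝ (g.inChart c) y u (C.inChart c y v) w
        + g.inChart c y (fderiv ℝ (C.inChart c) y u v) w)
      - (fderiv ℝ (g.inChart c) y v (C.inChart c y u) w
        + g.inChart c y (fderiv ℝ (C.inChart c) y v u) w)
      + (fderiv ℝ (g.inChart c) y w (C.inChart c y u) v
        + g.inChart c y (fderiv ℝ (C.inChart c) y w u) v) = 0 := by
  obtain ⟨η, h1, h2⟩ := hC.closed
  have hval : ∀ c', ∀ z ∈ (extChartAt (𝓡 m) c').target, ∀ v : Fin 2 → Model m,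
      η.inChart c' z v = g.inChart c' z (C.inChart c' z (v 0)) (v 1) := fun c' z hz v ↦ by
    rw [Metric.inChart_apply, chartInvDeriv_inChart C hz, ← h1]
    change η _ _ = _
    congr 1
    ext i
    fin_cases i <;> rfl
  -- The closed form η is not assumed smooth in the definition; this follows from its expression
  -- through g and C, and is needed before d can be computed in the chart at c.
  have hsm : η.IsSmooth := fun c' z hz ↦ by
    refine (contDiffAt_alternating fun v ↦ ?_).contDiffWithinAt
    have h3 := ((g.contDiffAt_inChart hz).clm_apply ((hC.complex.smooth.contDiffAt hz).clm_apply
      (contDiffAt_const (c := v 0)))).clm_apply (contDiffAt_const (c := v 1))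
    refine h3.congr_of_eventuallyEq ?_
    filter_upwards [target_mem_nhds hz] with z' hz'
    exact hval c' z' hz' v
  have hz : (KForm.d η).inChart c y = 0 := by
    rw [h2]
    rfl
  rw [KForm.d_inChart hsm hy] at hz
  have hd : DifferentiableAt ℝ (g.inChart c) y :=
    (g.contDiffAt_inChart hy).differentiableAt (by simp)
  have hdC : DifferentiableAt ℝ (C.inChart c) y :=
    (hC.complex.smooth.contDiffAt hy).differentiableAt (by simp)
  have hf : ∀ v : Fin 2 → Model m, ∀ u, fderiv ℝ (fun z ↦ η.inChart c z v) y u =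
      fderiv ℝ (g.inChart c) y u (C.inChart c y (v 0)) (v 1)
        + g.inChart c y (fderiv ℝ (C.inChart c) y u (v 0)) (v 1) := fun v u ↦ by
    have e : (fun z ↦ η.inChart c z v) =ᶠ[𝓝 y]
        fun z ↦ g.inChart c z (C.inChart c z (v 0)) (v 1) := by
      filter_upwards [target_mem_nhds hy] with z' hz'
      exact hval c z' hz' v
    have h3 := (hd.hasFDerivAt.clm_apply (hdC.hasFDerivAt.clm_apply
      (hasFDerivAt_const (v 0) y))).clm_apply (hasFDerivAt_const (v 1) y)
    rw [e.fderiv_eq, h3.fderiv]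
    simp [add_comm]
  have h4 := congrArg (fun α ↦ α ![u, v, w]) hz
  rw [extDeriv_apply ((hsm.contDiffAt hy).differentiableAt (by simp))] at h4
  simp only [hf] at h4
  refine Eq.trans ?_ ((Fin.sum_univ_three _).symm.trans h4)
  simp [Fin.removeNth, Fin.succAbove]
  ring

/-- The complex structures of a Kähler manifold are parallel. -/
theorem IsKahler.fderiv_inChart {g : Metric m M} {C : EndField m M} (hC : IsKahler g C) {c : M}
    {y : Model m} (hy : y ∈ (extChartAt (𝓡 m) c).target)
    {Γ : Model m →L[ℝ] Model m →L[ℝ] Model m} (hΓ : IsChristoffel g c y Γ) (u : Model m) :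
    fderiv ℝ (C.inChart c) y u = C.inChart c y ∘L Γ u - Γ u ∘L C.inChart c y := by
  have hd : DifferentiableAt ℝ (g.inChart c) y :=
    (g.contDiffAt_inChart hy).differentiableAt (by simp)
  have hdC : DifferentiableAt ℝ (C.inChart c) y :=
    (hC.complex.smooth.contDiffAt hy).differentiableAt (by simp)
  have hdv : ∀ v, HasFDerivAt (fun z ↦ C.inChart c z v) _ y :=
    fun v ↦ hdC.hasFDerivAt.clm_apply (hasFDerivAt_const v y)
  refine parallel_of_kahler (g.inChart_symm c y) (g.inChart_pos hy) hΓ.symm hΓ.metric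
    (hC.complex.inChart_sq hy) (hC.inChart_hermitian hy) (fun u v ↦ ?_) (fun u v w ↦ ?_)
    (hC.closed_inChart hy) (hC.complex.nijenhuis_inChart hy) u
  · have h := hdC.hasFDerivAt.clm_apply (hdv v)
    -- C² = -1 and, below, the Hermitian identity hold throughout the chart, so they can be
    -- differentiated to give the one-jet conditions.
    have e : (fun z ↦ C.inChart c z (C.inChart c z v)) =ᶠ[𝓝 y] fun _ ↦ -v := by
      filter_upwards [target_mem_nhds hy] with z hz
      exact hC.complex.inChart_sq hz v
    have h' := congrArg (fun L ↦ L u) ((h.congr_of_eventuallyEq e.symm).unique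
      (hasFDerivAt_const (-v) y))
    simpa [add_comm] using h'
  · have h := (hd.hasFDerivAt.clm_apply (hdv v)).clm_apply (hdv w)
    have e : (fun z ↦ g.inChart c z (C.inChart c z v) (C.inChart c z w)) =ᶠ[𝓝 y]
        fun z ↦ g.inChart c z v w := by
      filter_upwards [target_mem_nhds hy] with z hz
      exact hC.inChart_hermitian hz v w
    have h' := congrArg (fun L ↦ L u) ((h.congr_of_eventuallyEq e.symm).unique
      ((hd.hasFDerivAt.clm_apply (hasFDerivAt_const v y)).clm_apply (hasFDerivAt_const w y)))
    simp at h'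
    linarith

end Charts

/-! ### Covariant derivatives and twisted differentials in a vector space -/

section Covariant

open ContinuousAlternatingMap Filter Topology

variable {V F : Type*} [NormedAddCommGroup V] [NormedSpace ℝ V] [NormedAddCommGroup F]
  [NormedSpace ℝ F] {k : ℕ}

/-- The covariant derivative at `y` of a form, for the connection `d + Γ`. -/
def covd (Γ : V →L[ℝ] V →L[ℝ] V) (σ : V → V [⋀^Fin k]→L[ℝ] F) (y : V) :
    V →L[ℝ] V [⋀^Fin k]→L[ℝ] F :=
  fderiv ℝ σ y - (derivExtL V F k).flip (σ y) ∘L Γ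

theorem covd_apply (Γ : V →L[ℝ] V →L[ℝ] V) (σ : V → V [⋀^Fin k]→L[ℝ] F) (y u : V) :
    covd Γ σ y u = fderiv ℝ σ y u - derivExt (Γ u) (σ y) := rfl

theorem alternatizeUncurryFin_sub (f g : V →L[ℝ] V [⋀^Fin k]→L[ℝ] F) :
    alternatizeUncurryFin (f - g) = alternatizeUncurryFin f - alternatizeUncurryFin g :=
  (alternatizeUncurryFinCLM ℝ V F (n := k)).map_sub f g

theorem contDiffAt_alternatizeUncurryFin {n : WithTop ℕ∞} {E : Type*} [NormedAddCommGroup E]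
    [NormedSpace ℝ E] {f : E → V →L[ℝ] V [⋀^Fin k]→L[ℝ] F} {x : E} (hf : ContDiffAt ℝ n f x) :
    ContDiffAt ℝ n (fun z ↦ alternatizeUncurryFin (f z)) x :=
  ContDiffAt.comp (g := fun f ↦ alternatizeUncurryFinCLM ℝ V F (n := k) f) x
    (ContinuousLinearMap.contDiff _).contDiffAt hf

theorem contDiffAt_derivExt {n : WithTop ℕ∞} {E : Type*} [NormedAddCommGroup E]
    [NormedSpace ℝ E] {A : E → V →L[ℝ] V} {f : E → V [⋀^Fin k]→L[ℝ] F} {x : E}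
    (hA : ContDiffAt ℝ n A x) (hf : ContDiffAt ℝ n f x) :
    ContDiffAt ℝ n (fun z ↦ derivExt (A z) (f z)) x :=
  (ContDiffAt.comp (g := fun f ↦ derivExtL V F k f) x
    (ContinuousLinearMap.contDiff _).contDiffAt hA).clm_apply hf

theorem extDeriv_eq_covd {Γ : V →L[ℝ] V →L[ℝ] V} (hΓ : ∀ u v, Γ u v = Γ v u)
    (σ : V → V [⋀^Fin k]→L[ℝ] F) (y : V) :
    extDeriv σ y = alternatizeUncurryFin (covd Γ σ y) := by
  rw [covd, alternatizeUncurryFin_sub, alternatizeUncurryFin_derivExt_of_symm Γ hΓ, sub_zero]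
  rfl

/-- The second hypothesis says that A is parallel at y. The derivative of A then contributes exactly
the commutator of Γ(u)_* with A_*. -/
theorem covd_derivExt {Γ : V →L[ℝ] V →L[ℝ] V} {A : V → V →L[ℝ] V} {y : V}
    (hA : DifferentiableAt ℝ A y) (hA' : ∀ u, fderiv ℝ A y u = A y ∘L Γ u - Γ u ∘L A y)
    {σ : V → V [⋀^Fin k]→L[ℝ] F} (hσ : DifferentiableAt ℝ σ y) :
    covd Γ (fun z ↦ derivExt (A z) (σ z)) y = derivExtL V F k (A y) ∘L covd Γ σ y := by
  have h : HasFDerivAt (fun z ↦ derivExtL V F k (A z) (σ z)) _ y :=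
    (((derivExtL V F k).hasFDerivAt (x := A y)).comp y hA.hasFDerivAt).clm_apply hσ.hasFDerivAt
  ext1 u
  have h' : fderiv ℝ (fun z ↦ derivExt (A z) (σ z)) y u =
      derivExt (A y) (fderiv ℝ σ y u) + derivExt (fderiv ℝ A y u) (σ y) :=
    congrArg (fun L ↦ L u) h.fderiv
  rw [covd_apply, h', ContinuousLinearMap.comp_apply, covd_apply, map_sub, derivExtL_apply,
    derivExtL_apply, hA', ← derivExt_derivExt_sub]
  abel

/-- Formula for d_C when A = -C: the part of A_* acting on the form slots of ∇σ commutes with ∇ and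
cancels, leaving A on the differentiation slot. -/
theorem derivExt_extDeriv_sub {Γ : V →L[ℝ] V →L[ℝ] V} (hΓ : ∀ u v, Γ u v = Γ v u)
    {A : V → V →L[ℝ] V} {y : V}
    (hA : DifferentiableAt ℝ A y) (hA' : ∀ u, fderiv ℝ A y u = A y ∘L Γ u - Γ u ∘L A y)
    {σ : V → V [⋀^Fin k]→L[ℝ] F} (hσ : DifferentiableAt ℝ σ y) :
    derivExt (A y) (extDeriv σ y) - extDeriv (fun z ↦ derivExt (A z) (σ z)) y =
      alternatizeUncurryFin (covd Γ σ y ∘L A y) := by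
  rw [extDeriv_eq_covd hΓ, extDeriv_eq_covd hΓ, covd_derivExt hA hA' hσ,
    derivExt_alternatizeUncurryFin, add_sub_cancel_right]

theorem derivExt_twisted_sub {Γ : V →L[ℝ] V →L[ℝ] V}
    {A : V → V →L[ℝ] V} {y : V}
    (hA : DifferentiableAt ℝ A y) (hA' : ∀ u, fderiv ℝ A y u = A y ∘L Γ u - Γ u ∘L A y)
    {σ : V → V [⋀^Fin k]→L[ℝ] F} (hσ : DifferentiableAt ℝ σ y) (B : V →L[ℝ] V) :
    derivExt (A y) (alternatizeUncurryFin (covd Γ σ y ∘L B)) -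
        alternatizeUncurryFin (covd Γ (fun z ↦ derivExt (A z) (σ z)) y ∘L B) =
      alternatizeUncurryFin (covd Γ σ y ∘L (B ∘L A y)) := by
  rw [covd_derivExt hA hA' hσ, derivExt_alternatizeUncurryFin, ContinuousLinearMap.comp_assoc,
    ContinuousLinearMap.comp_assoc, add_sub_cancel_right]

end Covariant

/-! ### Operators on forms of fixed degree -/

section Operators

open Set Filter Topology ContinuousAlternatingMap

variable {m : ℕ} {M : Type*} [TopologicalSpace M] [ChartedSpace (EuclideanSpace ℝ (Fin m)) M]
  [IsManifold (𝓡 m) ∞ M] {𝕜 : Type*} [RCLike 𝕜] {k : ℕ}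

theorem KForm.ext_inChart {η η' : KForm m M 𝕜 k}
    (h : ∀ c, ∀ y ∈ (extChartAt (𝓡 m) c).target, η.inChart c y = η'.inChart c y) : η = η' := by
  funext x
  have h1 := h x _ (mem_extChartAt_target x)
  rw [KForm.inChart_eq, KForm.inChart_eq, frame_self, extChartAt_to_inv] at h1
  exact h1

theorem KForm.isSmooth_of_contDiffAt {η : KForm m M 𝕜 k}
    (h : ∀ c, ∀ y ∈ (extChartAt (𝓡 m) c).target, ContDiffAt ℝ ∞ (η.inChart c) y) : η.IsSmooth :=
  fun c y hy ↦ (h c y hy).contDiffWithinAt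

theorem KForm.inChart_add (η η' : KForm m M 𝕜 k) (c : M) (y : Model m) :
    (η + η').inChart c y = η.inChart c y + η'.inChart c y := rfl

theorem KForm.inChart_sub (η η' : KForm m M 𝕜 k) (c : M) (y : Model m) :
    (η - η').inChart c y = η.inChart c y - η'.inChart c y := rfl

theorem KForm.inChart_smul (r : ℝ) (η : KForm m M 𝕜 k) (c : M) (y : Model m) :
    (r • η).inChart c y = r • η.inChart c y := rfl

theorem KForm.inChart_zero (c : M) (y : Model m) : (0 : KForm m M 𝕜 k).inChart c y = 0 := rfl

theorem KForm.IsSmooth.add {η η' : KForm m M 𝕜 k} (h : η.IsSmooth) (h' : η'.IsSmooth) :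
    (η + η').IsSmooth := fun c ↦ (h c).add (h' c)

theorem KForm.IsSmooth.smul {η : KForm m M 𝕜 k} (r : ℝ) (h : η.IsSmooth) :
    (r • η).IsSmooth := fun c ↦ (h c).const_smul r

theorem KForm.isSmooth_zero : (0 : KForm m M 𝕜 k).IsSmooth := fun _ ↦ contDiffOn_const (c := 0)

theorem KForm.IsSmooth.d {η : KForm m M 𝕜 k} (h : η.IsSmooth) : (KForm.d η).IsSmooth := by
  refine KForm.isSmooth_of_contDiffAt fun c y hy ↦ ?_
  have h1 : ContDiffAt ℝ ∞ (extDeriv (η.inChart c)) y :=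
    contDiffAt_alternatizeUncurryFin ((h.contDiffAt hy).fderiv_right (m := ∞) (by simp))
  refine h1.congr_of_eventuallyEq ?_
  filter_upwards [target_mem_nhds hy] with z hz
  exact KForm.d_inChart h hz

theorem KForm.d_add {η η' : KForm m M 𝕜 k} (h : η.IsSmooth) (h' : η'.IsSmooth) :
    KForm.d (η + η') = KForm.d η + KForm.d η' := by
  refine KForm.ext_inChart fun c y hy ↦ ?_
  rw [KForm.inChart_add, KForm.d_inChart (h.add h') hy, KForm.d_inChart h hy,
    KForm.d_inChart h' hy, ← extDeriv_add ((h.contDiffAt hy).differentiableAt (by simp))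
    ((h'.contDiffAt hy).differentiableAt (by simp))]
  rfl

theorem KForm.d_smul (r : ℝ) {η : KForm m M 𝕜 k} (h : η.IsSmooth) :
    KForm.d (r • η) = r • KForm.d η := by
  refine KForm.ext_inChart fun c y hy ↦ ?_
  rw [KForm.inChart_smul, KForm.d_inChart (h.smul r) hy, KForm.d_inChart h hy, ← extDeriv_smul]
  rfl

theorem KForm.d_d {η : KForm m M 𝕜 k} (h : η.IsSmooth) : KForm.d (KForm.d η) = 0 := by
  refine KForm.ext_inChart fun c y hy ↦ ?_
  have e : (KForm.d η).inChart c =ᶠ[𝓝 y] extDeriv (η.inChart c) := by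
    filter_upwards [target_mem_nhds hy] with z hz
    exact KForm.d_inChart h hz
  rw [KForm.d_inChart h.d hy, e.extDeriv_eq, KForm.inChart_zero]
  exact extDeriv_extDeriv_apply (h.contDiffAt hy)
    (by simpa using (WithTop.coe_le_coe (α := ℕ∞)).2 (le_top (a := 2)))

/-- The action of a field of endomorphisms on forms of degree `k`. -/
def KForm.ad (C : EndField m M) (η : KForm m M 𝕜 k) : KForm m M 𝕜 k :=
  fun x ↦ derivExt (-(C x)) (η x)

theorem derivExt_compContinuousLinearMap {V W F : Type*} [AddCommGroup V] [Module ℝ V]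
    [TopologicalSpace V] [AddCommGroup W] [Module ℝ W] [TopologicalSpace W]
    [AddCommGroup F] [Module ℝ F] [TopologicalSpace F] [IsTopologicalAddGroup F]
    {B : V →L[ℝ] V} {B' : W →L[ℝ] W} {A : W →L[ℝ] V} (h : ∀ w, A (B' w) = B (A w))
    (α : V [⋀^Fin k]→L[ℝ] F) :
    (derivExt B α).compContinuousLinearMap A = derivExt B' (α.compContinuousLinearMap A) := by
  ext v
  simp only [compContinuousLinearMap_apply, derivExt_apply]
  refine Finset.sum_congr rfl fun i _ ↦ congrArg α ?_
  funext j
  by_cases hj : j = i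
  · subst hj; simp [h]
  · simp [hj]

/-- A field of endomorphisms as a family of endomorphisms of the model space. -/
def EndField.val (C : EndField m M) (x : M) : Model m →L[ℝ] Model m := C x

theorem KForm.ad_val (C : EndField m M) (η : KForm m M 𝕜 k) (x : M) :
    (KForm.ad C η).val x = derivExt (-C.val x) (η.val x) := rfl

theorem KForm.ad_inChart (C : EndField m M) (η : KForm m M 𝕜 k) {c : M} {y : Model m}
    (hy : y ∈ (extChartAt (𝓡 m) c).target) :
    (KForm.ad C η).inChart c y = derivExt (-C.inChart c y) (η.inChart c y) := by
  rw [KForm.inChart_eq, KForm.inChart_eq, KForm.ad_val]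
  refine derivExt_compContinuousLinearMap (fun w ↦ ?_) _
  have h : frame c y (C.inChart c y w) = C.val ((extChartAt (𝓡 m) c).symm y) (frame c y w) :=
    chartInvDeriv_inChart C hy w
  rw [_root_.neg_apply, _root_.neg_apply, map_neg, h]

theorem KForm.IsSmooth.ad {C : EndField m M} (hC : C.IsSmooth) {η : KForm m M 𝕜 k}
    (h : η.IsSmooth) : (KForm.ad C η).IsSmooth := by
  refine KForm.isSmooth_of_contDiffAt fun c y hy ↦ ?_
  have h1 : ContDiffAt ℝ ∞ (fun z ↦ derivExt (-C.inChart c z) (η.inChart c z)) y :=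
    contDiffAt_derivExt (hC.contDiffAt hy).neg (h.contDiffAt hy)
  refine h1.congr_of_eventuallyEq ?_
  filter_upwards [target_mem_nhds hy] with z hz
  exact KForm.ad_inChart C η hz

theorem KForm.ad_add (C : EndField m M) (η η' : KForm m M 𝕜 k) :
    KForm.ad C (η + η') = KForm.ad C η + KForm.ad C η' := by
  funext x
  refine ContinuousAlternatingMap.ext fun v ↦ ?_
  simp [KForm.ad, derivExt_apply, Finset.sum_add_distrib]

theorem KForm.ad_smul (C : EndField m M) (r : ℝ) (η : KForm m M 𝕜 k) :
    KForm.ad C (r • η) = r • KForm.ad C η := by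
  funext x
  refine ContinuousAlternatingMap.ext fun v ↦ ?_
  simp [KForm.ad, derivExt_apply, Finset.smul_sum]

end Operators

/-! ### Twisted differentials and their brackets with the derivations -/

section Operators

open Set Filter Topology ContinuousAlternatingMap

variable {m : ℕ} {M : Type*} [TopologicalSpace M] [ChartedSpace (EuclideanSpace ℝ (Fin m)) M]
  [IsManifold (𝓡 m) ∞ M] {𝕜 : Type*} [RCLike 𝕜] {k : ℕ}

/-- The twisted differential `[ad_C, d]` on forms of degree `k`. -/
def KForm.dC (C : EndField m M) (η : KForm m M 𝕜 k) : KForm m M 𝕜 (k + 1) :=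
  KForm.ad C (KForm.d η) - KForm.d (KForm.ad C η)

theorem KForm.IsSmooth.sub {η η' : KForm m M 𝕜 k} (h : η.IsSmooth) (h' : η'.IsSmooth) :
    (η - η').IsSmooth := fun c ↦ (h c).sub (h' c)

theorem KForm.IsSmooth.dC {C : EndField m M} (hC : C.IsSmooth) {η : KForm m M 𝕜 k}
    (h : η.IsSmooth) : (KForm.dC C η).IsSmooth := (h.d.ad hC).sub (h.ad hC).d

theorem KForm.d_inChart_eq_covd {g : Metric m M} {η : KForm m M 𝕜 k} (h : η.IsSmooth) {c : M}
    {y : Model m} (hy : y ∈ (extChartAt (𝓡 m) c).target) {Γ} (hΓ : IsChristoffel g c y Γ) :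
    (KForm.d η).inChart c y = alternatizeUncurryFin (covd Γ (η.inChart c) y) := by
  rw [KForm.d_inChart h hy, extDeriv_eq_covd hΓ.symm]

theorem IsKahler.fderiv_neg_inChart {g : Metric m M} {C : EndField m M} (hC : IsKahler g C) {c : M}
    {y : Model m} (hy : y ∈ (extChartAt (𝓡 m) c).target)
    {Γ : Model m →L[ℝ] Model m →L[ℝ] Model m} (hΓ : IsChristoffel g c y Γ) (u : Model m) :
    fderiv ℝ (fun z ↦ -C.inChart c z) y u =
      (-C.inChart c y) ∘L Γ u - Γ u ∘L (-C.inChart c y) := by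
  have h : fderiv ℝ (fun z ↦ -C.inChart c z) y = -fderiv ℝ (C.inChart c) y := fderiv_fun_neg
  rw [h, _root_.neg_apply, hC.fderiv_inChart hy hΓ]
  ext1 v
  simp
  abel

theorem KForm.ad_inChart_eventuallyEq (C : EndField m M) (η : KForm m M 𝕜 k) {c : M} {y : Model m}
    (hy : y ∈ (extChartAt (𝓡 m) c).target) :
    (KForm.ad C η).inChart c =ᶠ[𝓝 y] fun z ↦ derivExt (-C.inChart c z) (η.inChart c z) := by
  filter_upwards [target_mem_nhds hy] with z hz
  exact KForm.ad_inChart C η hz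

theorem KForm.dC_inChart {g : Metric m M} {C : EndField m M} (hC : IsKahler g C)
    {η : KForm m M 𝕜 k} (h : η.IsSmooth) {c : M}
    {y : Model m} (hy : y ∈ (extChartAt (𝓡 m) c).target) {Γ} (hΓ : IsChristoffel g c y Γ) :
    (KForm.dC C η).inChart c y =
      alternatizeUncurryFin (covd Γ (η.inChart c) y ∘L (-C.inChart c y)) := by
  rw [KForm.dC, KForm.inChart_sub, KForm.ad_inChart C _ hy, KForm.d_inChart h hy,
    KForm.d_inChart (h.ad hC.complex.smooth) hy,
    (KForm.ad_inChart_eventuallyEq C η hy).extDeriv_eq,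
    derivExt_extDeriv_sub hΓ.symm
      (((hC.complex.smooth.contDiffAt hy).neg).differentiableAt (by simp))
      (hC.fderiv_neg_inChart hy hΓ) ((h.contDiffAt hy).differentiableAt (by simp))]

theorem KForm.covd_ad (C : EndField m M) {η : KForm m M 𝕜 k} {c : M}
    {y : Model m} (hy : y ∈ (extChartAt (𝓡 m) c).target) (Γ) :
    covd Γ ((KForm.ad C η).inChart c) y =
      covd Γ (fun z ↦ derivExt (-C.inChart c z) (η.inChart c z)) y := by
  rw [covd, covd, (KForm.ad_inChart_eventuallyEq C η hy).fderiv_eq, KForm.ad_inChart C η hy]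

/-- The two minus signs in ad_C and d_{C'} cancel in the composite. Precomposition reverses the
order, so [ad_C, d_{C'}] involves C'C. -/
theorem KForm.ad_dC_sub_inChart {g : Metric m M} {C C' : EndField m M} (hC : IsKahler g C)
    (hC' : IsKahler g C') {η : KForm m M 𝕜 k} (h : η.IsSmooth) {c : M}
    {y : Model m} (hy : y ∈ (extChartAt (𝓡 m) c).target) {Γ} (hΓ : IsChristoffel g c y Γ) :
    (KForm.ad C (KForm.dC C' η) - KForm.dC C' (KForm.ad C η)).inChart c y =
      alternatizeUncurryFin (covd Γ (η.inChart c) y ∘L (C'.inChart c y ∘L C.inChart c y)) := by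
  rw [KForm.inChart_sub, KForm.ad_inChart C _ hy, KForm.dC_inChart hC' h hy hΓ,
    KForm.dC_inChart hC' (h.ad hC.complex.smooth) hy hΓ, KForm.covd_ad C hy,
    derivExt_twisted_sub
      (((hC.complex.smooth.contDiffAt hy).neg).differentiableAt (by simp))
      (hC.fderiv_neg_inChart hy hΓ) ((h.contDiffAt hy).differentiableAt (by simp))]
  congr 2
  ext1 v
  simp

theorem EndField.inChart_inChart (C C' : EndField m M) {c : M}
    {y : Model m} (hy : y ∈ (extChartAt (𝓡 m) c).target) (v : Model m) :
    C'.inChart c y (C.inChart c y v) = chartDerivAt c y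
      (C' ((extChartAt (𝓡 m) c).symm y) (C ((extChartAt (𝓡 m) c).symm y)
        (chartInvDeriv c y v))) := by
  rw [EndField.inChart_apply C', chartInvDeriv_inChart C hy]

theorem KForm.ad_dC_sub_self {g : Metric m M} {C : EndField m M} (hC : IsKahler g C)
    {η : KForm m M 𝕜 k} (h : η.IsSmooth) :
    KForm.ad C (KForm.dC C η) - KForm.dC C (KForm.ad C η) = -KForm.d η := by
  refine KForm.ext_inChart fun c y hy ↦ ?_
  obtain ⟨Γ, hΓ⟩ := exists_isChristoffel g hy
  rw [KForm.ad_dC_sub_inChart hC hC h hy hΓ]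
  refine Eq.trans ?_ (congrArg Neg.neg (KForm.d_inChart_eq_covd h hy hΓ)).symm
  rw [← neg_eq_iff_eq_neg, ← (alternatizeUncurryFinCLM_apply (𝕜 := ℝ)), ← map_neg,
    ← (alternatizeUncurryFinCLM_apply (𝕜 := ℝ))]
  congr 1
  ext1 v
  simp [hC.complex.inChart_sq hy]

/-- The sign in the hypothesis on C'C compensates the one in d_{C''}, which is built from -C''. For
instance JI = -K gives [ad_I, d_J] = d_K. -/
theorem KForm.ad_dC_sub_of_comp {g : Metric m M} {C C' C'' : EndField m M} (hC : IsKahler g C)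
    (hC' : IsKahler g C') (hC'' : IsKahler g C'') (r : ℝ)
    (hr : ∀ x v, C' x (C x v) = -(r • C'' x v)) {η : KForm m M 𝕜 k} (h : η.IsSmooth) :
    KForm.ad C (KForm.dC C' η) - KForm.dC C' (KForm.ad C η) = r • KForm.dC C'' η := by
  refine KForm.ext_inChart fun c y hy ↦ ?_
  obtain ⟨Γ, hΓ⟩ := exists_isChristoffel g hy
  rw [KForm.ad_dC_sub_inChart hC hC' h hy hΓ, KForm.inChart_smul, KForm.dC_inChart hC'' h hy hΓ,
    ← (alternatizeUncurryFinCLM_apply (𝕜 := ℝ)), ← (alternatizeUncurryFinCLM_apply (𝕜 := ℝ)),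
    ← map_smul]
  congr 1
  ext1 v
  have h1 : C'.inChart c y (C.inChart c y v) = -(r • C''.inChart c y v) := by
    rw [EndField.inChart_inChart C C' hy, hr, map_neg, map_smul]
    rfl
  simp [h1]

variable (m M 𝕜) in
/-- Differential forms, as families of alternating forms on the model space. -/
def ModelForm : Type _ := (k : ℕ) → M → Model m [⋀^Fin k]→L[ℝ] 𝕜

instance : AddCommGroup (ModelForm m M 𝕜) :=
  inferInstanceAs (AddCommGroup ((k : ℕ) → M → Model m [⋀^Fin k]→L[ℝ] 𝕜))

instance : Module ℝ (ModelForm m M 𝕜) where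
  smul r η := fun k x ↦ r • η k x
  one_smul η := funext fun k ↦ funext fun x ↦ one_smul ℝ (η k x)
  mul_smul r s η := funext fun k ↦ funext fun x ↦ mul_smul r s (η k x)
  smul_zero r := funext fun k ↦ funext fun _ ↦
    smul_zero (A := Model m [⋀^Fin k]→L[ℝ] 𝕜) r
  smul_add r η η' := funext fun k ↦ funext fun x ↦ smul_add r (η k x) (η' k x)
  add_smul r s η := funext fun k ↦ funext fun x ↦ add_smul r s (η k x)
  zero_smul η := funext fun k ↦ funext fun x ↦ zero_smul ℝ (η k x)

variable (m M 𝕜) in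
/-- The space of smooth differential forms. -/
def smoothForms : Submodule ℝ (ModelForm m M 𝕜) where
  carrier := {η | Form.IsSmooth (M := M) η}
  add_mem' h h' k := (h k).add (h' k)
  zero_mem' _ := KForm.isSmooth_zero
  smul_mem' r _ h k := KForm.IsSmooth.smul r (h k)

/-- The component of degree `k` of a smooth form. -/
def component (η : smoothForms m M 𝕜) (k : ℕ) : KForm m M 𝕜 k := η.1 k

theorem isSmooth_component (η : smoothForms m M 𝕜) (k : ℕ) :
    (component η k).IsSmooth := η.2 k

theorem ext_component {η η' : smoothForms m M 𝕜}
    (h : ∀ k, component η k = component η' k) : η = η' := Subtype.ext (funext h)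

theorem component_sub (η η' : smoothForms m M 𝕜) (k : ℕ) :
    component (η - η') k = component η k - component η' k := rfl

theorem component_neg (η : smoothForms m M 𝕜) (k : ℕ) : component (-η) k = -component η k := rfl

theorem component_smul (r : ℝ) (η : smoothForms m M 𝕜) (k : ℕ) :
    component (r • η) k = r • component η k := rfl

theorem component_zero (k : ℕ) : component (0 : smoothForms m M 𝕜) k = 0 := rfl

theorem KForm.smul_zero (r : ℝ) : r • (0 : KForm m M 𝕜 k) = 0 :=
  funext fun _ ↦ _root_.smul_zero (A := Model m [⋀^Fin k]→L[ℝ] 𝕜) r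

theorem KForm.smul_sub_smul (r s : ℝ) (η : KForm m M 𝕜 k) : r • η - s • η = (r - s) • η :=
  funext fun x ↦ (sub_smul r s (η.val x)).symm

theorem KForm.one_smul (η : KForm m M 𝕜 k) : (1 : ℝ) • η = η :=
  funext fun x ↦ _root_.one_smul ℝ (η.val x)

theorem KForm.ad_zero (C : EndField m M) : KForm.ad C (0 : KForm m M 𝕜 k) = 0 := by
  have h := KForm.ad_add C (0 : KForm m M 𝕜 k) 0
  rw [add_zero] at h
  exact left_eq_add.1 h

theorem KForm.d_zero : KForm.d (0 : KForm m M 𝕜 k) = 0 := by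
  have h := KForm.d_add (KForm.isSmooth_zero (m := m) (M := M) (𝕜 := 𝕜) (k := k))
    KForm.isSmooth_zero
  rw [add_zero] at h
  exact left_eq_add.1 h

theorem Form.IsSmooth.d {η : Form m M 𝕜} (h : η.IsSmooth) : (Form.d η).IsSmooth
  | 0 => KForm.isSmooth_zero
  | k + 1 => (h k).d

theorem Form.IsSmooth.ad {C : EndField m M} (hC : C.IsSmooth) {η : Form m M 𝕜} (h : η.IsSmooth) :
    (Form.ad C η).IsSmooth := fun k ↦ (h k).ad hC

theorem Form.IsSmooth.grading {η : Form m M 𝕜} (h : η.IsSmooth) : (Form.grading η).IsSmooth :=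
  fun k ↦ (h k).smul k

/-- The exterior derivative on smooth forms. -/
def dEnd : Module.End ℝ (smoothForms m M 𝕜) where
  toFun η := ⟨Form.d η.1, η.2.d⟩
  map_add' η η' := ext_component fun
    | 0 => (add_zero (0 : KForm m M 𝕜 0)).symm
    | k + 1 => KForm.d_add (isSmooth_component η k) (isSmooth_component η' k)
  map_smul' r η := ext_component fun
    | 0 => (smul_zero (A := KForm m M 𝕜 0) r).symm
    | k + 1 => KForm.d_smul r (isSmooth_component η k)

/-- The derivation `ad_C` on smooth forms. -/
def adEnd (C : EndField m M) (hC : C.IsSmooth) : Module.End ℝ (smoothForms m M 𝕜) where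
  toFun η := ⟨Form.ad C η.1, η.2.ad hC⟩
  map_add' η η' := ext_component fun k ↦ KForm.ad_add C (component η k) (component η' k)
  map_smul' r η := ext_component fun k ↦ KForm.ad_smul C r (component η k)

/-- The grading operator on smooth forms. -/
def gradingEnd : Module.End ℝ (smoothForms m M 𝕜) where
  toFun η := ⟨Form.grading η.1, η.2.grading⟩
  map_add' η η' := ext_component fun k ↦ smul_add (k : ℝ) (component η k) (component η' k)
  map_smul' r η := ext_component fun k ↦ smul_comm (k : ℝ) r (component η k)

theorem component_dEnd_zero (η : smoothForms m M 𝕜) : component (dEnd η) 0 = 0 := rfl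

theorem component_dEnd_succ (η : smoothForms m M 𝕜) (k : ℕ) :
    component (dEnd η) (k + 1) = KForm.d (component η k) := rfl

theorem component_adEnd (C : EndField m M) (hC : C.IsSmooth) (η : smoothForms m M 𝕜) (k : ℕ) :
    component (adEnd C hC η) k = KForm.ad C (component η k) := rfl

theorem component_gradingEnd (η : smoothForms m M 𝕜) (k : ℕ) :
    component (gradingEnd η) k = (k : ℝ) • component η k := rfl

theorem dEnd_mul_dEnd : dEnd * dEnd = (0 : Module.End ℝ (smoothForms m M 𝕜)) :=
  LinearMap.ext fun η ↦ ext_component fun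
    | 0 => by rw [Module.End.mul_apply, component_dEnd_zero, LinearMap.zero_apply, component_zero]
    | 1 => by rw [Module.End.mul_apply, component_dEnd_succ, component_dEnd_zero, KForm.d_zero,
        LinearMap.zero_apply, component_zero]
    | k + 2 => by rw [Module.End.mul_apply, component_dEnd_succ, component_dEnd_succ,
        KForm.d_d (isSmooth_component η k), LinearMap.zero_apply, component_zero]

theorem gradingEnd_mul_dEnd :
    (gradingEnd * dEnd - dEnd * gradingEnd : Module.End ℝ (smoothForms m M 𝕜)) = dEnd :=
  LinearMap.ext fun η ↦ ext_component fun
    | 0 => by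
      rw [LinearMap.sub_apply, Module.End.mul_apply, Module.End.mul_apply, component_sub,
        component_gradingEnd, component_dEnd_zero, component_dEnd_zero, KForm.smul_zero, sub_zero]
    | k + 1 => by
      rw [LinearMap.sub_apply, Module.End.mul_apply, Module.End.mul_apply, component_sub,
        component_gradingEnd, component_dEnd_succ, component_dEnd_succ, component_gradingEnd,
        KForm.d_smul _ (isSmooth_component η k), KForm.smul_sub_smul, Nat.cast_succ,
        add_sub_cancel_left, KForm.one_smul]

theorem gradingEnd_mul_adEnd (C : EndField m M) (hC : C.IsSmooth) :
    (gradingEnd * adEnd C hC : Module.End ℝ (smoothForms m M 𝕜)) = adEnd C hC * gradingEnd :=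
  LinearMap.ext fun η ↦ ext_component fun k ↦ (KForm.ad_smul C (k : ℝ) (component η k)).symm

/-- The twisted differential on smooth forms. -/
def dCEnd (C : EndField m M) (hC : C.IsSmooth) : Module.End ℝ (smoothForms m M 𝕜) :=
  adEnd C hC * dEnd - dEnd * adEnd C hC

theorem gradingEnd_mul_dCEnd (C : EndField m M) (hC : C.IsSmooth) :
    (gradingEnd * dCEnd C hC - dCEnd C hC * gradingEnd : Module.End ℝ (smoothForms m M 𝕜)) =
      dCEnd C hC := by
  have h1 := gradingEnd_mul_adEnd (𝕜 := 𝕜) C hC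
  have h2 := gradingEnd_mul_dEnd (m := m) (M := M) (𝕜 := 𝕜)
  rw [sub_eq_iff_eq_add] at h2
  rw [dCEnd, mul_sub, sub_mul, ← mul_assoc, ← mul_assoc, h1, h2, add_mul, mul_assoc, h2,
    mul_assoc dEnd gradingEnd, h1, mul_add, mul_assoc, mul_assoc]
  abel

theorem component_dCEnd_zero (C : EndField m M) (hC : C.IsSmooth) (η : smoothForms m M 𝕜) :
    component (dCEnd C hC η) 0 = 0 := by
  rw [dCEnd, LinearMap.sub_apply, Module.End.mul_apply, Module.End.mul_apply, component_sub,
    component_adEnd, component_dEnd_zero, component_dEnd_zero, KForm.ad_zero, sub_zero]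

theorem component_dCEnd_succ (C : EndField m M) (hC : C.IsSmooth) (η : smoothForms m M 𝕜) (k : ℕ) :
    component (dCEnd C hC η) (k + 1) = KForm.dC C (component η k) := rfl

theorem adEnd_mul_dCEnd_self {g : Metric m M} {C : EndField m M} (hC : IsKahler g C) :
    (adEnd C hC.complex.smooth * dCEnd C hC.complex.smooth -
      dCEnd C hC.complex.smooth * adEnd C hC.complex.smooth :
        Module.End ℝ (smoothForms m M 𝕜)) = -dEnd :=
  LinearMap.ext fun η ↦ ext_component fun
    | 0 => by
      rw [LinearMap.sub_apply, Module.End.mul_apply, Module.End.mul_apply, component_sub,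
        component_adEnd, component_dCEnd_zero, component_dCEnd_zero, KForm.ad_zero, sub_zero,
        LinearMap.neg_apply, component_neg, component_dEnd_zero, neg_zero]
    | k + 1 => by
      rw [LinearMap.sub_apply, Module.End.mul_apply, Module.End.mul_apply, component_sub,
        component_adEnd, component_dCEnd_succ, component_dCEnd_succ, component_adEnd,
        LinearMap.neg_apply, component_neg, component_dEnd_succ,
        KForm.ad_dC_sub_self hC (isSmooth_component η k)]

theorem adEnd_mul_dCEnd_of_comp {g : Metric m M} {C C' C'' : EndField m M} (hC : IsKahler g C)
    (hC' : IsKahler g C') (hC'' : IsKahler g C'') (r : ℝ)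
    (hr : ∀ x v, C' x (C x v) = -(r • C'' x v)) :
    (adEnd C hC.complex.smooth * dCEnd C' hC'.complex.smooth -
      dCEnd C' hC'.complex.smooth * adEnd C hC.complex.smooth :
        Module.End ℝ (smoothForms m M 𝕜)) = r • dCEnd C'' hC''.complex.smooth :=
  LinearMap.ext fun η ↦ ext_component fun
    | 0 => by
      rw [LinearMap.sub_apply, Module.End.mul_apply, Module.End.mul_apply, component_sub,
        component_adEnd, component_dCEnd_zero, component_dCEnd_zero, KForm.ad_zero, sub_zero,
        LinearMap.smul_apply, component_smul, component_dCEnd_zero, KForm.smul_zero]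
    | k + 1 => by
      rw [LinearMap.sub_apply, Module.End.mul_apply, Module.End.mul_apply, component_sub,
        component_adEnd, component_dCEnd_succ, component_dCEnd_succ, component_adEnd,
        LinearMap.smul_apply, component_smul, component_dCEnd_succ,
        KForm.ad_dC_sub_of_comp hC hC' hC'' r hr (isSmooth_component η k)]

end Operators

/-! ### The Riemannian measure -/

section Volume

open Set Filter Topology MeasureTheory

variable {m : ℕ} {M : Type*} [TopologicalSpace M] [ChartedSpace (EuclideanSpace ℝ (Fin m)) M]
  [IsManifold (𝓡 m) ∞ M]

theorem det_toMat (A : Model m →L[ℝ] Model m) : (toMat A).det = A.det := by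
  have h : toMat A = LinearMap.toMatrix (EuclideanSpace.basisFun (Fin m) ℝ).toBasis
      (EuclideanSpace.basisFun (Fin m) ℝ).toBasis (A : Model m →ₗ[ℝ] Model m) := by
    ext i j
    rw [LinearMap.toMatrix_apply]
    simp [toMat_apply]
  rw [h, LinearMap.det_toMatrix]

theorem Metric.inChart_transition (g : Metric m M) {c c' : M} {y : Model m}
    (hy : y ∈ (extChartAt (𝓡 m) c).target)
    (hy' : (extChartAt (𝓡 m) c).symm y ∈ (extChartAt (𝓡 m) c').source) :
    g.inChart c y = (g.inChart c' (transition c c' y)).bilinearComp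
      (fderiv ℝ (transition c c') y) (fderiv ℝ (transition c c') y) := by
  rw [Metric.inChart, Metric.inChart, transition_symm hy', frame_eq hy hy']
  rfl

/-- The density of the Riemannian measure in the chart at `c`. -/
def density (g : Metric m M) (c : M) (y : Model m) : ℝ := Real.sqrt (gramInChart g c y).det

theorem gramInChart_posDef (g : Metric m M) {c : M} {y : Model m}
    (hy : y ∈ (extChartAt (𝓡 m) c).target) : (gramInChart g c y).PosDef := by
  rw [gramInChart_eq]
  exact gramMat_posDef (g.inChart_symm c y) (g.inChart_pos hy)

theorem density_pos (g : Metric m M) {c : M} {y : Model m}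
    (hy : y ∈ (extChartAt (𝓡 m) c).target) : 0 < density g c y :=
  Real.sqrt_pos.2 (gramInChart_posDef g hy).det_pos

theorem contDiffAt_gramInChart (g : Metric m M) {c : M} {y : Model m}
    (hy : y ∈ (extChartAt (𝓡 m) c).target) (a b : Fin m) :
    ContDiffAt ℝ ∞ (fun z ↦ gramInChart g c z a b) y :=
  ((g.contDiffAt_inChart hy).clm_apply contDiffAt_const).clm_apply contDiffAt_const

theorem contDiffAt_det_gramInChart (g : Metric m M) {c : M} {y : Model m}
    (hy : y ∈ (extChartAt (𝓡 m) c).target) :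
    ContDiffAt ℝ ∞ (fun z ↦ (gramInChart g c z).det) y :=
  contDiffWithinAt_univ.1
    (contDiffWithinAt_det fun a b ↦ (contDiffAt_gramInChart g hy a b).contDiffWithinAt)

theorem contDiffAt_density (g : Metric m M) {c : M} {y : Model m}
    (hy : y ∈ (extChartAt (𝓡 m) c).target) : ContDiffAt ℝ ∞ (density g c) y :=
  (contDiffAt_det_gramInChart g hy).sqrt (gramInChart_posDef g hy).det_pos.ne'

theorem density_transition (g : Metric m M) {c c' : M} {y : Model m}
    (hy : y ∈ (extChartAt (𝓡 m) c).target)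
    (hy' : (extChartAt (𝓡 m) c).symm y ∈ (extChartAt (𝓡 m) c').source) :
    density g c y = |(fderiv ℝ (transition c c') y).det| * density g c' (transition c c' y) := by
  rw [density, density, gramInChart_eq, gramInChart_eq, g.inChart_transition hy hy',
    gramMat_bilinearComp, Matrix.det_mul, Matrix.det_mul, Matrix.det_transpose, det_toMat,
    mul_right_comm, ← sq, Real.sqrt_mul (sq_nonneg _), Real.sqrt_sq_eq_abs]

variable [MeasurableSpace M] [BorelSpace M]

theorem measurableSet_target (c : M) : MeasurableSet (extChartAt (𝓡 m) c).target :=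
  (isOpen_target c).measurableSet

theorem measurableSet_source (c : M) : MeasurableSet (extChartAt (𝓡 m) c).source :=
  (isOpen_extChartAt_source c).measurableSet

theorem measurableSet_symm_preimage_inter (c : M) {A : Set M} (hA : MeasurableSet A) :
    MeasurableSet ((extChartAt (𝓡 m) c).symm ⁻¹' A ∩ (extChartAt (𝓡 m) c).target) := by
  have h := (continuousOn_extChartAt_symm (I := 𝓡 m) c).domRestrict.measurable hA
  have h2 := (measurableSet_target (m := m) c).subtype_image h
  convert! h2 using 1
  ext y
  simp [Set.domRestrict, and_comm]

theorem aemeasurable_symm (c : M) (ν : Measure (Model m))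
    (hν : ν ≪ volume.restrict (extChartAt (𝓡 m) c).target) :
    AEMeasurable (extChartAt (𝓡 m) c).symm ν :=
  ((continuousOn_extChartAt_symm c).aemeasurable (measurableSet_target c)).mono_ac hν

theorem chartVolume_eq (g : Metric m M) (c : M) :
    chartVolume g c = ((volume.restrict (extChartAt (𝓡 m) c).target).withDensity
      fun y ↦ ENNReal.ofReal (density g c y)).map (extChartAt (𝓡 m) c).symm := rfl

theorem chartVolume_apply (g : Metric m M) (c : M) {A : Set M} (hA : MeasurableSet A) :
    chartVolume g c A = ∫⁻ y in (extChartAt (𝓡 m) c).symm ⁻¹' A ∩ (extChartAt (𝓡 m) c).target,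
      ENNReal.ofReal (density g c y) := by
  rw [chartVolume, Measure.map_apply_of_aemeasurable
    (aemeasurable_symm c _ (withDensity_absolutelyContinuous _ _)) hA, withDensity_apply',
    Measure.restrict_restrict' (measurableSet_target c)]
  rfl

theorem chartVolume_compl_source (g : Metric m M) (c : M) :
    chartVolume g c (extChartAt (𝓡 m) c).sourceᶜ = 0 := by
  rw [chartVolume_apply g c (measurableSet_source c).compl]
  have : (extChartAt (𝓡 m) c).symm ⁻¹' (extChartAt (𝓡 m) c).sourceᶜ ∩
      (extChartAt (𝓡 m) c).target = ∅ := by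
    ext y
    simp only [mem_inter_iff, mem_preimage, mem_compl_iff, mem_empty_iff_false, iff_false, not_and]
    exact fun h hy ↦ h ((extChartAt (𝓡 m) c).map_target hy)
  rw [this]
  simp

/-- Change of variables along the transition map, whose Jacobian is compensated by the
transformation law of the density. -/
theorem chartVolume_eq_of_subset (g : Metric m M) {c c' : M} {A : Set M} (hA : MeasurableSet A)
    (hc : A ⊆ (extChartAt (𝓡 m) c).source) (hc' : A ⊆ (extChartAt (𝓡 m) c').source) :
    chartVolume g c' A = chartVolume g c A := by
  have him : (extChartAt (𝓡 m) c').symm ⁻¹' A ∩ (extChartAt (𝓡 m) c').target =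
      transition c c' '' ((extChartAt (𝓡 m) c).symm ⁻¹' A ∩ (extChartAt (𝓡 m) c).target) := by
    ext z
    constructor
    · rintro ⟨h1, h2⟩
      refine ⟨transition c' c z, ⟨?_, transition_mem (hc h1)⟩, ?_⟩
      · rw [mem_preimage, transition_symm (hc h1)]
        exact h1
      · rw [transition, Function.comp_apply, transition_symm (hc h1)]
        exact (extChartAt (𝓡 m) c').right_inv h2
    · rintro ⟨y, ⟨h1, h2⟩, rfl⟩
      refine ⟨?_, transition_mem (hc' h1)⟩
      rw [mem_preimage, transition_symm (hc' h1)]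
      exact h1
  rw [chartVolume_apply g c' hA, chartVolume_apply g c hA, him,
    lintegral_image_eq_lintegral_abs_det_fderiv_mul volume
      (measurableSet_symm_preimage_inter c hA) (f' := fderiv ℝ (transition c c'))]
  · refine setLIntegral_congr_fun (measurableSet_symm_preimage_inter c hA) fun y hy ↦ ?_
    rw [density_transition g hy.2 (hc' hy.1), ENNReal.ofReal_mul (abs_nonneg _)]
  · exact fun y hy ↦ ((contDiffAt_transition hy.2 (hc' hy.1)).differentiableAt
      (by simp)).hasFDerivAt.hasFDerivWithinAt
  · intro y hy z hz h
    have h1 := congrArg (extChartAt (𝓡 m) c').symm h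
    rw [transition_symm (hc' hy.1), transition_symm (hc' hz.1)] at h1
    have h2 := congrArg (extChartAt (𝓡 m) c) h1
    rwa [(extChartAt (𝓡 m) c).right_inv hy.2, (extChartAt (𝓡 m) c).right_inv hz.2] at h2

/-- Every chart measure is bounded by that of c plus a measure living off the domain of c, because
the chart measures agree on overlaps. Hence the supremum adds nothing on this domain. -/
theorem riemannianVolume_restrict_source (g : Metric m M) (c : M) :
    (riemannianVolume g).restrict (extChartAt (𝓡 m) c).source = chartVolume g c := by
  have hS := measurableSet_source (m := m) c
  have hself : (chartVolume g c).restrict (extChartAt (𝓡 m) c).source = chartVolume g c :=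
    Measure.restrict_eq_self_of_ae_mem (chartVolume_compl_source g c)
  apply le_antisymm
  · have hle : riemannianVolume g ≤
        chartVolume g c + (riemannianVolume g).restrict (extChartAt (𝓡 m) c).sourceᶜ := by
      refine iSup_le fun c' ↦ ?_
      rw [← Measure.restrict_add_restrict_compl (μ := chartVolume g c') hS]
      refine add_le_add ?_ (Measure.restrict_mono subset_rfl (le_iSup (chartVolume g) c'))
      refine Measure.le_iff.2 fun A hA ↦ ?_
      have hS' := measurableSet_source (m := m) c'
      rw [Measure.restrict_apply hA, ← measure_inter_add_sdiff (A ∩ _) hS',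
        measure_mono_null (s := (A ∩ _) \ _) (fun x hx ↦ hx.2) (chartVolume_compl_source g c'), add_zero,
        chartVolume_eq_of_subset g ((hA.inter hS).inter hS') (fun x hx ↦ hx.1.2)
          (fun x hx ↦ hx.2)]
      exact measure_mono fun x hx ↦ hx.1.1
    have h := Measure.restrict_mono (subset_refl (extChartAt (𝓡 m) c).source) hle
    rw [Measure.restrict_add, hself, Measure.restrict_restrict hS, inter_compl_self,
      Measure.restrict_empty, add_zero] at h
    exact h
  · rw [← hself]
    exact Measure.restrict_mono subset_rfl (le_iSup (chartVolume g) c)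

theorem continuousOn_density (g : Metric m M) (c : M) :
    ContinuousOn (density g c) (extChartAt (𝓡 m) c).target :=
  fun _ hy ↦ (contDiffAt_density g hy).continuousAt.continuousWithinAt

/-- In a chart the continuous density is integrable on a compact neighbourhood. Local finiteness
makes continuous compactly supported functions integrable. -/
theorem isLocallyFiniteMeasure_riemannianVolume (g : Metric m M) :
    IsLocallyFiniteMeasure (riemannianVolume g) := by
  refine ⟨fun x ↦ ?_⟩
  obtain ⟨K, hKx, hKt, hK⟩ := local_compact_nhds (target_mem_nhds (mem_extChartAt_target (I := 𝓡 m) x))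
  obtain ⟨U, hUK, hU, hxU⟩ := mem_nhds_iff.1 hKx
  refine ⟨(extChartAt (𝓡 m) x).source ∩ extChartAt (𝓡 m) x ⁻¹' U, ?_, ?_⟩
  · exact inter_mem (extChartAt_source_mem_nhds x)
      ((continuousAt_extChartAt x).preimage_mem_nhds (hU.mem_nhds hxU))
  · have hm : MeasurableSet ((extChartAt (𝓡 m) x).source ∩ extChartAt (𝓡 m) x ⁻¹' U) :=
      ((continuousOn_extChartAt x).isOpen_inter_preimage (isOpen_extChartAt_source x)
        hU).measurableSet
    rw [← inter_self (extChartAt (𝓡 m) x).source, inter_assoc, inter_comm,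
      ← Measure.restrict_apply hm, riemannianVolume_restrict_source, chartVolume_apply g x hm]
    have hint : IntegrableOn (density g x) K := 
      ((continuousOn_density g x).mono hKt).integrableOn_compact hK
    refine lt_of_le_of_lt (lintegral_mono_set (t := K) ?_) hint.lintegral_lt_top
    rintro y ⟨⟨_, h2⟩, h3⟩
    rw [mem_preimage, (extChartAt (𝓡 m) x).right_inv h3] at h2
    exact hUK h2

/-- Integrals of functions supported in the domain of a chart, in coordinates. -/
theorem integral_riemannianVolume_eq {F : Type*} [NormedAddCommGroup F] [NormedSpace ℝ F]
    (g : Metric m M) (c : M) {f : M → F} (hf : AEStronglyMeasurable f (riemannianVolume g))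
    (h0 : ∀ x ∉ (extChartAt (𝓡 m) c).source, f x = 0) :
    ∫ x, f x ∂(riemannianVolume g) =
      ∫ y in (extChartAt (𝓡 m) c).target, density g c y • f ((extChartAt (𝓡 m) c).symm y) := by
  rw [← setIntegral_eq_integral_of_forall_compl_eq_zero h0]
  have hf' : AEStronglyMeasurable f (chartVolume g c) := by
    rw [← riemannianVolume_restrict_source]
    exact hf.restrict
  rw [chartVolume_eq] at hf'
  rw [riemannianVolume_restrict_source, chartVolume_eq, integral_map
    (aemeasurable_symm c _ (withDensity_absolutelyContinuous _ _)) hf',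
    integral_withDensity_eq_integral_toReal_smul₀
      ((continuousOn_density g c).aemeasurable (measurableSet_target c)).ennreal_ofReal
      (Eventually.of_forall fun _ ↦ ENNReal.ofReal_lt_top)]
  refine integral_congr_ae (Eventually.of_forall fun y ↦ ?_)
  exact congrArg (· • _) (ENNReal.toReal_ofReal (Real.sqrt_nonneg _))

end Volume

/-! ### Scalar product, bivector contraction and derivatives of the metric in charts -/

section Local

open Set Filter Topology ContinuousAlternatingMap

variable {m : ℕ} {M : Type*} [TopologicalSpace M] [ChartedSpace (EuclideanSpace ℝ (Fin m)) M]
  [IsManifold (𝓡 m) ∞ M] {𝕜 : Type*} [RCLike 𝕜] {k : ℕ}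

theorem gram_posDef (g : Metric m M) (x : M) : (gram g x).PosDef :=
  gramMat_posDef (G := g.val x) (fun u v ↦ g.symm x u v) (fun u hu ↦ g.pos x u hu)

/-- The inverse metric is contravariant, so the frame pushes its chart expression forward. With
`pair_compContinuousLinearMap` this makes the scalar product of forms chart independent. -/
theorem frame_mul_inv_gramInChart (g : Metric m M) {c : M} {y : Model m}
    (hy : y ∈ (extChartAt (𝓡 m) c).target) :
    toMat (frame c y) * (gramInChart g c y)⁻¹ * (toMat (frame c y)).transpose =
      (gram g ((extChartAt (𝓡 m) c).symm y))⁻¹ := by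
  have h1 : toMat (frame c y) * toMat (coframe c y) = 1 := by
    rw [← toMat_comp, frame_comp_coframe hy, toMat_id]
  have h2 : IsUnit (toMat (frame c y)).det := by
    have := congrArg Matrix.det h1
    rw [Matrix.det_mul, Matrix.det_one] at this
    exact IsUnit.of_mul_eq_one _ this
  have h3 : gramInChart g c y = (toMat (frame c y)).transpose *
      gram g ((extChartAt (𝓡 m) c).symm y) * toMat (frame c y) := by
    rw [gramInChart_eq, Metric.inChart, gramMat_bilinearComp]
    rfl
  rw [h3, Matrix.mul_inv_rev, Matrix.mul_inv_rev, ← mul_assoc, Matrix.mul_nonsing_inv _ h2,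
    one_mul, mul_assoc, Matrix.nonsing_inv_mul, mul_one]
  rwa [Matrix.det_transpose]

/-- The pointwise scalar product of two forms. -/
def KForm.inner (g : Metric m M) (α β : KForm m M 𝕜 k) (x : M) : 𝕜 := formInner g x (α x) (β x)

theorem KForm.inner_eq_pair (g : Metric m M) (α β : KForm m M 𝕜 k) (x : M) :
    KForm.inner g α β x = ((k.factorial : ℝ)⁻¹) • pair (gram g x)⁻¹ (α.val x) (β.val x) := rfl

theorem KForm.inner_symm_eq (g : Metric m M) (α β : KForm m M 𝕜 k) {c : M} {y : Model m}
    (hy : y ∈ (extChartAt (𝓡 m) c).target) :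
    KForm.inner g α β ((extChartAt (𝓡 m) c).symm y) =
      ((k.factorial : ℝ)⁻¹) • pair (gramInChart g c y)⁻¹ (α.inChart c y) (β.inChart c y) := by
  rw [KForm.inner_eq_pair, KForm.inChart_eq, KForm.inChart_eq, pair_compContinuousLinearMap,
    frame_mul_inv_gramInChart g hy]

theorem contDiffAt_pair {n : WithTop ℕ∞} {E : Type*} [NormedAddCommGroup E] [NormedSpace ℝ E]
    {H : E → Matrix (Fin m) (Fin m) ℝ} {α β : E → Model m [⋀^Fin k]→L[ℝ] 𝕜} {x : E}
    (hH : ∀ a b, ContDiffAt ℝ n (fun y ↦ H y a b) x) (hα : ContDiffAt ℝ n α x)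
    (hβ : ContDiffAt ℝ n β x) : ContDiffAt ℝ n (fun y ↦ pair (H y) (α y) (β y)) x := by
  have ev : ∀ {γ : E → Model m [⋀^Fin k]→L[ℝ] 𝕜}, ContDiffAt ℝ n γ x → ∀ v,
      ContDiffAt ℝ n (fun y ↦ γ y v) x := fun {γ} h v ↦
    ContDiffAt.comp (g := fun α ↦ ContinuousAlternatingMap.apply ℝ (Model m) 𝕜 v α) x
      (ContinuousLinearMap.contDiff _).contDiffAt h
  refine ContDiffAt.sum fun i _ ↦ ContDiffAt.sum fun j _ ↦ ContDiffAt.fun_smul ?_ ?_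
  · exact contDiffAt_prod fun a _ ↦ hH _ _
  · exact ContDiffAt.mul ((RCLike.conjCLE (K := 𝕜)).contDiff.contDiffAt.comp x (ev hα _)) (ev hβ _)

theorem contDiffAt_inv_gramInChart (g : Metric m M) {c : M} {y : Model m}
    (hy : y ∈ (extChartAt (𝓡 m) c).target) (a b : Fin m) :
    ContDiffAt ℝ ∞ (fun z ↦ (gramInChart g c z)⁻¹ a b) y :=
  contDiffWithinAt_univ.1 (contDiffWithinAt_inv_apply
    (fun a b ↦ (contDiffAt_gramInChart g hy a b).contDiffWithinAt)
    (gramInChart_posDef g hy).det_pos.ne' a b)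

theorem KForm.contDiffAt_inner (g : Metric m M) {α β : KForm m M 𝕜 k} (hα : α.IsSmooth)
    (hβ : β.IsSmooth) {c : M} {y : Model m} (hy : y ∈ (extChartAt (𝓡 m) c).target) :
    ContDiffAt ℝ ∞ (fun z ↦ KForm.inner g α β ((extChartAt (𝓡 m) c).symm z)) y := by
  have h := (contDiffAt_pair (contDiffAt_inv_gramInChart g hy) (hα.contDiffAt hy)
    (hβ.contDiffAt hy)).const_smul ((k.factorial : ℝ)⁻¹)
  refine h.congr_of_eventuallyEq ?_
  filter_upwards [target_mem_nhds hy] with z hz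
  exact KForm.inner_symm_eq g α β hz

theorem KForm.continuous_inner (g : Metric m M) {α β : KForm m M 𝕜 k} (hα : α.IsSmooth)
    (hβ : β.IsSmooth) : Continuous (KForm.inner g α β) := by
  refine continuous_iff_continuousAt.2 fun x ↦ ?_
  have h := (KForm.contDiffAt_inner g hα hβ (mem_extChartAt_target (I := 𝓡 m) x)).continuousAt
  have h2 : ContinuousAt (fun z ↦ KForm.inner g α β
      ((extChartAt (𝓡 m) x).symm (extChartAt (𝓡 m) x z))) x :=
    ContinuousAt.comp (g := fun y ↦ KForm.inner g α β ((extChartAt (𝓡 m) x).symm y)) h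
      (continuousAt_extChartAt x)
  have h3 : (fun z ↦ KForm.inner g α β ((extChartAt (𝓡 m) x).symm (extChartAt (𝓡 m) x z)))
      =ᶠ[𝓝 x] KForm.inner g α β := by
    filter_upwards [extChartAt_source_mem_nhds (I := 𝓡 m) x] with z hz
    rw [(extChartAt (𝓡 m) x).left_inv hz]
  exact h2.congr h3

/-- The contraction of forms with the bivector of a field of skew endomorphisms. -/
def KForm.lam (g : Metric m M) (C : EndField m M) (η : KForm m M 𝕜 (k + 2)) : KForm m M 𝕜 k :=
  fun x ↦ HK.lam 𝕜 k (gram g x)⁻¹ (C.val x) (η.val x)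

theorem KForm.lam_val (g : Metric m M) (C : EndField m M) (η : KForm m M 𝕜 (k + 2)) (x : M) :
    (KForm.lam g C η).val x = HK.lam 𝕜 k (gram g x)⁻¹ (C.val x) (η.val x) := rfl

theorem KForm.lam_inChart (g : Metric m M) (C : EndField m M) (η : KForm m M 𝕜 (k + 2)) {c : M}
    {y : Model m} (hy : y ∈ (extChartAt (𝓡 m) c).target) :
    (KForm.lam g C η).inChart c y =
      HK.lam 𝕜 k (gramInChart g c y)⁻¹ (C.inChart c y) (η.inChart c y) := by
  rw [KForm.inChart_eq, KForm.inChart_eq, KForm.lam_val,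
    lam_compContinuousLinearMap _ _ (C.val ((extChartAt (𝓡 m) c).symm y)) (frame c y),
    frame_mul_inv_gramInChart g hy]
  ext1 w
  exact chartInvDeriv_inChart C hy w

theorem contDiffAt_lam {n : WithTop ℕ∞} {E F : Type*} [NormedAddCommGroup E] [NormedSpace ℝ E]
    [NormedAddCommGroup F] [NormedSpace ℝ F]
    {H : E → Matrix (Fin m) (Fin m) ℝ} {C : E → Model m →L[ℝ] Model m}
    {β : E → Model m [⋀^Fin (k + 2)]→L[ℝ] F} {x : E}
    (hH : ∀ a b, ContDiffAt ℝ n (fun y ↦ H y a b) x) (hC : ContDiffAt ℝ n C x)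
    (hβ : ContDiffAt ℝ n β x) : ContDiffAt ℝ n (fun y ↦ HK.lam F k (H y) (C y) (β y)) x := by
  have hc : ∀ {j : ℕ} {γ : E → Model m [⋀^Fin (j + 1)]→L[ℝ] F}, ContDiffAt ℝ n γ x →
      ContDiffAt ℝ n (fun y ↦ (γ y).curryLeft) x := fun {j γ} h ↦
    ContDiffAt.comp (g := fun α ↦ curryLeftL m j F α) x
      (ContinuousLinearMap.contDiff _).contDiffAt h
  simp only [lam_apply, curryTwo_apply]
  refine ContDiffAt.const_smul _ (ContDiffAt.sum fun a _ ↦ ContDiffAt.sum fun b _ ↦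
    (hH a b).smul ?_)
  exact (hc ((hc hβ).clm_apply (hC.clm_apply contDiffAt_const))).clm_apply contDiffAt_const

theorem KForm.lam_inChart_eventuallyEq (g : Metric m M) (C : EndField m M)
    (η : KForm m M 𝕜 (k + 2)) {c : M} {y : Model m} (hy : y ∈ (extChartAt (𝓡 m) c).target) :
    (KForm.lam g C η).inChart c =ᶠ[𝓝 y]
      fun z ↦ HK.lam 𝕜 k (gramInChart g c z)⁻¹ (C.inChart c z) (η.inChart c z) := by
  filter_upwards [target_mem_nhds hy] with z hz
  exact KForm.lam_inChart g C η hz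

theorem KForm.IsSmooth.lam (g : Metric m M) {C : EndField m M} (hC : C.IsSmooth)
    {η : KForm m M 𝕜 (k + 2)} (h : η.IsSmooth) : (KForm.lam g C η).IsSmooth :=
  KForm.isSmooth_of_contDiffAt fun _ _ hy ↦
    (contDiffAt_lam (contDiffAt_inv_gramInChart g hy) (hC.contDiffAt hy)
      (h.contDiffAt hy)).congr_of_eventuallyEq (KForm.lam_inChart_eventuallyEq g C η hy)

theorem inv_gramInChart_transpose (g : Metric m M) {c : M} {y : Model m} :
    ((gramInChart g c y)⁻¹).transpose = (gramInChart g c y)⁻¹ := by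
  rw [Matrix.transpose_nonsing_inv]
  congr 1
  ext a b
  exact g.inChart_symm c y _ _

/-- An isometry with square -1 is skew for g; multiplying by g⁻¹ on both sides makes it skew for the
inverse metric. -/
theorem IsKahler.toMat_mul_inv {g : Metric m M} {C : EndField m M} (hC : IsKahler g C) {c : M}
    {y : Model m} (hy : y ∈ (extChartAt (𝓡 m) c).target) :
    toMat (C.inChart c y) * (gramInChart g c y)⁻¹ =
      -((gramInChart g c y)⁻¹ * (toMat (C.inChart c y)).transpose) := by
  have hu : IsUnit (gramInChart g c y).det :=
    isUnit_iff_ne_zero.2 (gramInChart_posDef g hy).det_pos.ne'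
  have h1 : (g.inChart c y).bilinearComp (C.inChart c y) (ContinuousLinearMap.id ℝ _) =
      -(g.inChart c y).bilinearComp (ContinuousLinearMap.id ℝ _) (C.inChart c y) := by
    ext1 v
    ext1 w
    have h := hC.inChart_hermitian hy v (C.inChart c y w)
    rw [hC.complex.inChart_sq hy, map_neg] at h
    simp only [_root_.neg_apply, ContinuousLinearMap.bilinearComp_apply, ContinuousLinearMap.id_apply]
    rw [← h, neg_neg]
  have h2 := congrArg gramMat h1
  have h3 : ∀ G : Model m →L[ℝ] Model m →L[ℝ] ℝ, gramMat (-G) = -gramMat G := fun G ↦ rfl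
  rw [h3, gramMat_bilinearComp, gramMat_bilinearComp, toMat_id, Matrix.transpose_one, mul_one,
    one_mul, ← gramInChart_eq] at h2
  calc toMat (C.inChart c y) * (gramInChart g c y)⁻¹
      = (gramInChart g c y)⁻¹ * (gramInChart g c y * toMat (C.inChart c y)) *
          (gramInChart g c y)⁻¹ := by
        rw [← mul_assoc, Matrix.nonsing_inv_mul _ hu, one_mul]
    _ = _ := by
        rw [← neg_eq_iff_eq_neg.2 h2, mul_neg, neg_mul, mul_assoc, mul_assoc,
          Matrix.mul_nonsing_inv _ hu, mul_one]

/-! ### Derivatives of the metric -/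

theorem hasDerivAt_line {F : Type*} [NormedAddCommGroup F] [NormedSpace ℝ F] {f : Model m → F} {y : Model m}
    (hf : DifferentiableAt ℝ f y) (u : Model m) :
    HasDerivAt (fun s : ℝ ↦ f (y + s • u)) (fderiv ℝ f y u) 0 :=
  hf.hasFDerivAt.hasLineDerivAt u

variable {g : Metric m M} {c : M} {y : Model m}
  {Γ : Model m →L[ℝ] Model m →L[ℝ] Model m}

theorem IsChristoffel.hasDerivAt_gramInChart (hΓ : IsChristoffel g c y Γ)
    (hy : y ∈ (extChartAt (𝓡 m) c).target) (u : Model m) (a b : Fin m) :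
    HasDerivAt (fun s : ℝ ↦ gramInChart g c (y + s • u) a b)
      (((toMat (Γ u)).transpose * gramInChart g c y + gramInChart g c y * toMat (Γ u)) a b) 0 := by
  have hd : DifferentiableAt ℝ (g.inChart c) y :=
    (g.contDiffAt_inChart hy).differentiableAt (by simp)
  have h0 : HasDerivAt (fun s : ℝ ↦ g.inChart c (y + s • u)) (fderiv ℝ (g.inChart c) y u) 0 :=
    hasDerivAt_line (F := Model m →L[ℝ] Model m →L[ℝ] ℝ) hd u
  have h := (h0.clm_apply (hasDerivAt_const (0 : ℝ) (bvec a))).clm_apply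
    (hasDerivAt_const (0 : ℝ) (bvec b))
  rw [ContinuousLinearMap.map_zero, ContinuousLinearMap.map_zero, add_zero, add_zero] at h
  have h2 := gramMat_bilinearComp (g.inChart c y) (Γ u) (ContinuousLinearMap.id ℝ _)
  have h3 := gramMat_bilinearComp (g.inChart c y) (ContinuousLinearMap.id ℝ _) (Γ u)
  rw [toMat_id, mul_one] at h2
  rw [toMat_id, Matrix.transpose_one, one_mul] at h3
  have h4 : ((toMat (Γ u)).transpose * gramInChart g c y + gramInChart g c y * toMat (Γ u)) a b =
      fderiv ℝ (g.inChart c) y u (bvec a) (bvec b) := by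
    rw [hΓ.metric, gramInChart_eq, ← h2, ← h3]
    rfl
  rw [h4]
  exact h

theorem eventually_mem_target (hy : y ∈ (extChartAt (𝓡 m) c).target) (u : Model m) :
    ∀ᶠ s : ℝ in 𝓝 0, y + s • u ∈ (extChartAt (𝓡 m) c).target := by
  have h : ContinuousAt (fun s : ℝ ↦ y + s • u) 0 := by fun_prop
  refine h.preimage_mem_nhds ?_
  simpa using target_mem_nhds hy

theorem IsChristoffel.hasDerivAt_inv_gramInChart (hΓ : IsChristoffel g c y Γ)
    (hy : y ∈ (extChartAt (𝓡 m) c).target) (u : Model m) (a b : Fin m) :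
    HasDerivAt (fun s : ℝ ↦ (gramInChart g c (y + s • u))⁻¹ a b)
      ((-(toMat (Γ u) * (gramInChart g c y)⁻¹ +
        (gramInChart g c y)⁻¹ * (toMat (Γ u)).transpose)) a b) 0 := by
  have hu : IsUnit (gramInChart g c y).det :=
    isUnit_iff_ne_zero.2 (gramInChart_posDef g hy).det_pos.ne'
  have h := hasDerivAt_inv_apply (A := fun s : ℝ ↦ gramInChart g c (y + s • u)) (t := 0)
    (fun i j ↦ (((contDiffAt_inv_gramInChart g hy i j).differentiableAt
      (by simp)).hasFDerivAt.hasLineDerivAt u).differentiableAt)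
    (hΓ.hasDerivAt_gramInChart hy u)
    (by filter_upwards [eventually_mem_target hy u] with s hs
        exact (gramInChart_posDef g hs).det_pos.ne') a b
  convert! h using 2
  rw [zero_smul, add_zero, mul_add, add_mul, ← mul_assoc, ← mul_assoc (gramInChart g c y)⁻¹
    (gramInChart g c y), Matrix.nonsing_inv_mul _ hu, one_mul, mul_assoc _ (gramInChart g c y),
    Matrix.mul_nonsing_inv _ hu, mul_one, add_comm]
  rfl

/-- Jacobi's formula gives twice the trace of Γ(u) as logarithmic derivative of det g, and the
square root removes the 2. -/
theorem IsChristoffel.hasDerivAt_density (hΓ : IsChristoffel g c y Γ)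
    (hy : y ∈ (extChartAt (𝓡 m) c).target) (u : Model m) :
    HasDerivAt (fun s : ℝ ↦ density g c (y + s • u))
      ((toMat (Γ u)).trace * density g c y) 0 := by
  have hp := (gramInChart_posDef g hy).det_pos
  have hu : IsUnit (gramInChart g c y).det := isUnit_iff_ne_zero.2 hp.ne'
  have h := hasDerivAt_det (hΓ.hasDerivAt_gramInChart hy u)
  have h2 := h.sqrt (by simpa using hp.ne')
  convert! h2 using 1
  have h3 : ((gramInChart g c y).adjugate * ((toMat (Γ u)).transpose * gramInChart g c y +
      gramInChart g c y * toMat (Γ u))).trace =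
        2 * ((gramInChart g c y).det * (toMat (Γ u)).trace) := by
    rw [mul_add, Matrix.trace_add, Matrix.trace_mul_comm, mul_assoc, Matrix.mul_adjugate,
      ← mul_assoc, Matrix.adjugate_mul]
    simp
    ring
  simp only [zero_smul, add_zero]
  rw [h3, density]
  have h4 := Real.sq_sqrt hp.le
  have h5 := Real.sqrt_pos.2 hp
  field_simp
  rw [h4]

end Local

/-! ### The Kähler identity as a pointwise divergence formula -/

section Divergence

open Set Filter Topology ContinuousAlternatingMap

variable {m : ℕ} {M : Type*} [TopologicalSpace M] [ChartedSpace (EuclideanSpace ℝ (Fin m)) M]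
  [IsManifold (𝓡 m) ∞ M] {𝕜 : Type*} [RCLike 𝕜] {k : ℕ} {g : Metric m M} {C : EndField m M}
  {c : M} {y : Model m} {Γ : Model m →L[ℝ] Model m →L[ℝ] Model m}

theorem IsKahler.hasDerivAt_inChart (hC : IsKahler g C)
    (hy : y ∈ (extChartAt (𝓡 m) c).target) (hΓ : IsChristoffel g c y Γ) (u : Model m) :
    HasDerivAt (fun s : ℝ ↦ C.inChart c (y + s • u))
      (C.inChart c y ∘L Γ u - Γ u ∘L C.inChart c y) 0 := by
  rw [← hC.fderiv_inChart hy hΓ]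
  exact hasDerivAt_line ((hC.complex.smooth.contDiffAt hy).differentiableAt (by simp)) u

/-- Λ is built from the parallel tensors g and C, hence commutes with ∇. The directional derivatives
reduce this to the one-variable rule `hasDerivAt_lam`. -/
theorem IsKahler.covd_lam (hC : IsKahler g C) (hy : y ∈ (extChartAt (𝓡 m) c).target)
    (hΓ : IsChristoffel g c y Γ) {σ : Model m → Model m [⋀^Fin (k + 2)]→L[ℝ] 𝕜}
    (hσ' : ContDiffAt ℝ 1 σ y) :
    covd Γ (fun z ↦ lam 𝕜 k (gramInChart g c z)⁻¹ (C.inChart c z) (σ z)) y =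
      lam 𝕜 k (gramInChart g c y)⁻¹ (C.inChart c y) ∘L covd Γ σ y := by
  have hσ : DifferentiableAt ℝ σ y := hσ'.differentiableAt (by simp)
  ext1 u
  have hd : DifferentiableAt ℝ (fun z ↦ lam 𝕜 k (gramInChart g c z)⁻¹ (C.inChart c z) (σ z)) y := by
    have h := contDiffAt_lam (n := 1) (F := 𝕜) (k := k)
      (fun a b ↦ (contDiffAt_inv_gramInChart g hy a b).of_le (by simp))
      ((hC.complex.smooth.contDiffAt hy).of_le (by simp)) hσ'
    exact h.differentiableAt (by simp)
  have h0 : y + (0 : ℝ) • u = y := by simp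
  have h := hasDerivAt_lam (F := 𝕜) (k := k) (t := 0) (Γ := Γ u)
    (H := fun s ↦ (gramInChart g c (y + s • u))⁻¹) (C := fun s ↦ C.inChart c (y + s • u))
    (β := fun s ↦ σ (y + s • u)) (β' := fderiv ℝ σ y u)
    (fun a b ↦ by rw [h0]; exact hΓ.hasDerivAt_inv_gramInChart hy u a b)
    (by rw [h0]; exact hC.hasDerivAt_inChart hy hΓ u) (hasDerivAt_line hσ u)
  rw [h0] at h
  have h1 := (hasDerivAt_line hd u).unique h
  rw [covd_apply, h1, add_sub_cancel_right]
  rfl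

/-- The formal adjoint of `d_C` on a Kähler manifold, as the commutator `[Λ, d]`. -/
def KForm.deltaC (g : Metric m M) (C : EndField m M) :
    {k : ℕ} → KForm m M 𝕜 (k + 1) → KForm m M 𝕜 k
  | 0, β => KForm.lam g C (KForm.d β)
  | _ + 1, β => KForm.lam g C (KForm.d β) - KForm.d (KForm.lam g C β)

theorem KForm.IsSmooth.deltaC (hC : C.IsSmooth) {β : KForm m M 𝕜 (k + 1)} (h : β.IsSmooth) :
    (KForm.deltaC g C β).IsSmooth := by
  cases k with
  | zero => exact h.d.lam g hC
  | succ k => exact (h.d.lam g hC).sub (h.lam g hC).d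

/-- The commutator [Λ, d] is Σ g^{ab} i_{e_b} ∇_{C eₐ}, since the term Alt(Λ∇β) is dΛβ. In degree
one Λβ is absent and only Λdβ occurs. -/
theorem KForm.deltaC_inChart (hC : IsKahler g C) {β : KForm m M 𝕜 (k + 1)} (h : β.IsSmooth)
    (hy : y ∈ (extChartAt (𝓡 m) c).target) (hΓ : IsChristoffel g c y Γ) :
    (KForm.deltaC g C β).inChart c y = ∑ a, ∑ b, (gramInChart g c y)⁻¹ a b •
      (covd Γ (β.inChart c) y (C.inChart c y (bvec a))).curryLeft (bvec b) := by
  cases k with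
  | zero =>
    rw [KForm.deltaC, KForm.lam_inChart g C _ hy, KForm.d_inChart_eq_covd h hy hΓ,
      lam_alternatizeUncurryFin_zero (inv_gramInChart_transpose g) (hC.toMat_mul_inv hy)]
  | succ k =>
    have h1 : (KForm.d (KForm.lam g C β)).inChart c y = alternatizeUncurryFin
        (HK.lam 𝕜 k (gramInChart g c y)⁻¹ (C.inChart c y) ∘L covd Γ (β.inChart c) y) := by
      rw [KForm.d_inChart (h.lam g hC.complex.smooth) hy,
        (KForm.lam_inChart_eventuallyEq g C β hy).extDeriv_eq, extDeriv_eq_covd hΓ.symm,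
        hC.covd_lam hy hΓ ((h.contDiffAt hy).of_le (by simp))]
    rw [KForm.deltaC, KForm.inChart_sub, h1, KForm.lam_inChart g C _ hy,
      KForm.d_inChart_eq_covd h hy hΓ,
      lam_alternatizeUncurryFin (inv_gramInChart_transpose g) (hC.toMat_mul_inv hy),
      add_sub_cancel_right]

/-- The components in a chart of the vector density whose divergence is the defect of adjointness
of `d_C` and `deltaC`. -/
def flux (g : Metric m M) (C : EndField m M) (α : KForm m M 𝕜 k) (β : KForm m M 𝕜 (k + 1)) (c : M)
    (a : Fin m) (z : Model m) : 𝕜 :=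
  density g c z • ∑ b, (gramInChart g c z)⁻¹ a b • pair (gramInChart g c z)⁻¹ (α.inChart c z)
    ((β.inChart c z).curryLeft (C.inChart c z (bvec b)))

theorem contDiffAt_flux (hC : C.IsSmooth) {α : KForm m M 𝕜 k} {β : KForm m M 𝕜 (k + 1)}
    (hα : α.IsSmooth) (hβ : β.IsSmooth) (hy : y ∈ (extChartAt (𝓡 m) c).target) (a : Fin m) :
    ContDiffAt ℝ ∞ (flux g C α β c a) y := by
  have hc : ContDiffAt ℝ ∞ (fun z ↦ (β.inChart c z).curryLeft) y :=
    ContDiffAt.comp (g := fun α ↦ curryLeftL m k 𝕜 α) y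
      (ContinuousLinearMap.contDiff _).contDiffAt (hβ.contDiffAt hy)
  refine (contDiffAt_density g hy).fun_smul (ContDiffAt.sum fun b _ ↦
    (contDiffAt_inv_gramInChart g hy a b).fun_smul ?_)
  exact contDiffAt_pair (contDiffAt_inv_gramInChart g hy) (hα.contDiffAt hy)
    (hc.clm_apply ((hC.contDiffAt hy).clm_apply contDiffAt_const))

/-- The symmetry Γᵃ_{ab} = Γᵃ_{ba} is what makes the divergence of a vector density free of
Christoffel symbols. -/
theorem IsChristoffel.sum_toMat (hΓ : IsChristoffel g c y Γ) (X : Fin m → 𝕜) :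
    ∑ a, ∑ b, toMat (Γ (bvec a)) a b • X b = ∑ b, (toMat (Γ (bvec b))).trace • X b := by
  rw [Finset.sum_comm]
  refine Finset.sum_congr rfl fun b _ ↦ ?_
  rw [← Finset.sum_smul]
  congr 1
  refine Finset.sum_congr rfl fun a _ ↦ ?_
  change Γ (bvec a) (bvec b) a = Γ (bvec b) (bvec a) a
  rw [hΓ.symm]

theorem fderiv_flux (hC : IsKahler g C) {α : KForm m M 𝕜 k} {β : KForm m M 𝕜 (k + 1)}
    (hα : α.IsSmooth) (hβ : β.IsSmooth) (hy : y ∈ (extChartAt (𝓡 m) c).target)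
    (hΓ : IsChristoffel g c y Γ) (a : Fin m) :
    fderiv ℝ (flux g C α β c a) y (bvec a) = density g c y • (
      (∑ b, (gramInChart g c y)⁻¹ a b • (pair (gramInChart g c y)⁻¹
          (covd Γ (α.inChart c) y (bvec a)) ((β.inChart c y).curryLeft (C.inChart c y (bvec b))) +
        pair (gramInChart g c y)⁻¹ (α.inChart c y)
          ((covd Γ (β.inChart c) y (bvec a)).curryLeft (C.inChart c y (bvec b)))) -
      ∑ b, (toMat (Γ (bvec a)) * (gramInChart g c y)⁻¹) a b • pair (gramInChart g c y)⁻¹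
        (α.inChart c y) ((β.inChart c y).curryLeft (C.inChart c y (bvec b))))) +
      ((toMat (Γ (bvec a))).trace * density g c y) • ∑ b, (gramInChart g c y)⁻¹ a b •
        pair (gramInChart g c y)⁻¹
          (α.inChart c y) ((β.inChart c y).curryLeft (C.inChart c y (bvec b))) := by
  have h0 : y + (0 : ℝ) • bvec a = y := by simp
  have h := hasDerivAt_sum_pair (𝕜 := 𝕜) (k := k) (t := 0) (Γ := Γ (bvec a))
    (H := fun s ↦ (gramInChart g c (y + s • bvec a))⁻¹)
    (C := fun s ↦ C.inChart c (y + s • bvec a))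
    (α := fun s ↦ α.inChart c (y + s • bvec a)) (β := fun s ↦ β.inChart c (y + s • bvec a))
    (fun i j ↦ by rw [h0]; exact hΓ.hasDerivAt_inv_gramInChart hy (bvec a) i j)
    (by rw [h0]; exact hC.hasDerivAt_inChart hy hΓ (bvec a))
    (hasDerivAt_line ((hα.contDiffAt hy).differentiableAt (by simp)) (bvec a))
    (hasDerivAt_line ((hβ.contDiffAt hy).differentiableAt (by simp)) (bvec a)) a
  have h1 := (hΓ.hasDerivAt_density hy (bvec a)).fun_smul h
  rw [h0] at h1
  exact (hasDerivAt_line ((contDiffAt_flux hC.complex.smooth hα hβ hy a).differentiableAt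
    (by simp)) (bvec a)).unique h1

/-- The derivative of the flux has a part differentiating α, which is ⟨d_C α, β⟩, and a part
differentiating β, which is -⟨α, [Λ, d]β⟩. The factor k! is there because the flux uses the
unnormalised pairing. -/
theorem sum_fderiv_flux (hC : IsKahler g C) {α : KForm m M 𝕜 k} {β : KForm m M 𝕜 (k + 1)}
    (hα : α.IsSmooth) (hβ : β.IsSmooth) (hy : y ∈ (extChartAt (𝓡 m) c).target) :
    ∑ a, fderiv ℝ (flux g C α β c a) y (bvec a) = (k.factorial : ℝ) • density g c y •
      (KForm.inner g (KForm.dC C α) β ((extChartAt (𝓡 m) c).symm y) -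
        KForm.inner g α (KForm.deltaC g C β) ((extChartAt (𝓡 m) c).symm y)) := by
  obtain ⟨Γ, hΓ⟩ := exists_isChristoffel g hy
  have hH := inv_gramInChart_transpose g (c := c) (y := y)
  have hCH := hC.toMat_mul_inv hy
  simp only [fderiv_flux hC hα hβ hy hΓ]
  rw [KForm.inner_symm_eq g _ _ hy, KForm.inner_symm_eq g _ _ hy, KForm.dC_inChart hC hα hy hΓ,
    KForm.deltaC_inChart hC hβ hy hΓ, pair_alternatizeUncurryFin]
  set H := (gramInChart g c y)⁻¹
  set A := C.inChart c y
  set P : Fin m → 𝕜 := fun b ↦ pair H (α.inChart c y) ((β.inChart c y).curryLeft (A (bvec b)))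
  -- The Christoffel term from the vector index cancels the one from the derivative of the density.
  have e1 : ∑ a, ∑ b, (toMat (Γ (bvec a)) * H) a b • P b =
      ∑ a, (toMat (Γ (bvec a))).trace • ∑ b, H a b • P b := by
    rw [← hΓ.sum_toMat]
    refine Finset.sum_congr rfl fun a _ ↦ ?_
    simp only [Matrix.mul_apply, Finset.sum_smul, Finset.smul_sum, smul_smul]
    exact Finset.sum_comm
  -- In this identity and the next, C is moved by skewness from the contracted vector to the
  -- direction of differentiation.
  have e2 : ∑ a, ∑ b, H a b • pair H (covd Γ (α.inChart c) y (bvec a))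
        ((β.inChart c y).curryLeft (A (bvec b))) =
      ∑ a, ∑ b, H a b • pair H ((covd Γ (α.inChart c) y ∘L (-A)) (bvec a))
        ((β.inChart c y).curryLeft (bvec b)) := by
    have h := sum_smul_skew hH hCH ((pairₗ H k).compl₁₂
      (covd Γ (α.inChart c) y : Model m →ₗ[ℝ] Model m [⋀^Fin k]→L[ℝ] 𝕜)
      ((β.inChart c y).curryLeft : Model m →ₗ[ℝ] Model m [⋀^Fin k]→L[ℝ] 𝕜))
    have h1 : ∀ u, (covd Γ (α.inChart c) y ∘L (-A)) u = -covd Γ (α.inChart c) y (A u) :=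
      fun u ↦ ContinuousLinearMap.map_neg (covd Γ (α.inChart c) y) (A u)
    simp only [h1, ← pairₗ_apply, map_neg, LinearMap.neg_apply, smul_neg, Finset.sum_neg_distrib]
    rw [Finset.sum_comm]
    refine Eq.trans ?_ h
    refine Finset.sum_congr rfl fun a _ ↦ Finset.sum_congr rfl fun b _ ↦ ?_
    have h2 : H a b = H b a := congrFun (congrFun hH b) a
    rw [h2]
    rfl
  have e3 : ∑ a, ∑ b, H a b • pair H (α.inChart c y)
        ((covd Γ (β.inChart c) y (bvec a)).curryLeft (A (bvec b))) =
      -pair H (α.inChart c y) (∑ a, ∑ b, H a b •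
        (covd Γ (β.inChart c) y (A (bvec a))).curryLeft (bvec b)) := by
    let T : Model m →ₗ[ℝ] Model m →ₗ[ℝ] 𝕜 := LinearMap.mk₂ ℝ
      (fun u v ↦ pair H (α.inChart c y) ((covd Γ (β.inChart c) y u).curryLeft v))
      (fun u u' v ↦ by simp [← pairₗ_apply]) (fun c u v ↦ by simp [← pairₗ_apply])
      (fun u v v' ↦ by simp [← pairₗ_apply]) (fun c u v ↦ by simp [← pairₗ_apply])
    have h := sum_smul_skew hH hCH T
    simp only [← pairₗ_apply, _root_.map_sum, map_smul]
    refine Eq.trans ?_ h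
    rw [Finset.sum_comm]
    refine Finset.sum_congr rfl fun a _ ↦ Finset.sum_congr rfl fun b _ ↦ ?_
    have h2 : H a b = H b a := congrFun (congrFun hH b) a
    rw [h2]
    rfl
  simp only [mul_comm _ (density g c y), mul_smul, ← smul_add, ← Finset.smul_sum]
  rw [smul_comm (k.factorial : ℝ)]
  congr 1
  simp only [smul_add, Finset.sum_add_distrib, Finset.sum_sub_distrib]
  rw [← e1, e2, e3, sub_add_cancel, smul_sub, smul_smul, smul_smul, smul_smul, ← sub_eq_add_neg]
  have hk : (k.factorial : ℝ) ≠ 0 := by positivity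
  have hk' : (k : ℝ) + 1 ≠ 0 := by positivity
  congr 1
  · rw [Nat.factorial_succ]
    push_cast
    refine (one_smul ℝ _).symm.trans (congrArg (· • _) ?_)
    field_simp
  · rw [mul_inv_cancel₀ hk, one_smul]

end Divergence

/-! ### Integration of the divergence in one chart -/

section Stokes

open Set Filter Topology ContinuousAlternatingMap MeasureTheory

theorem integral_fderiv_eq_zero {m : ℕ} {F : Type*} [NormedAddCommGroup F] [NormedSpace ℝ F]
    {f : Model m → F} (hf : ContDiff ℝ 1 f) (hc : HasCompactSupport f) (v : Model m) :
    ∫ x, fderiv ℝ f x v = 0 := by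
  have hi : Integrable (fun x ↦ fderiv ℝ f x v) :=
    ((hf.continuous_fderiv (by simp)).clm_apply continuous_const).integrable_of_hasCompactSupport
      ((hc.fderiv (𝕜 := ℝ)).comp_left (g := fun L : Model m →L[ℝ] F ↦ L v) rfl)
  have h := integral_smul_fderiv_eq_neg_fderiv_smul_of_integrable (μ := volume)
    (f := fun _ : Model m ↦ (1 : ℝ)) (g := f) (v := v) (by simp) (by simpa using hi)
    (by simpa using hf.continuous.integrable_of_hasCompactSupport hc)
    (fun x _ ↦ differentiableAt_const _) (fun x _ ↦ (hf.differentiable (by simp)) x)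
  simpa using h

variable {m : ℕ} {M : Type*} [TopologicalSpace M] [ChartedSpace (EuclideanSpace ℝ (Fin m)) M]
  [IsManifold (𝓡 m) ∞ M] {𝕜 : Type*} [RCLike 𝕜] {k : ℕ} {g : Metric m M} {C : EndField m M}

/-- The form vanishes off `S`. -/
def KForm.SupportedIn (η : KForm m M 𝕜 k) (S : Set M) : Prop := ∀ x ∉ S, η.val x = 0

theorem KForm.SupportedIn.mono {η : KForm m M 𝕜 k} {S T : Set M} (h : η.SupportedIn S)
    (hST : S ⊆ T) : η.SupportedIn T := fun x hx ↦ h x fun hxS ↦ hx (hST hxS)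

theorem KForm.d_val_eq_zero {η : KForm m M 𝕜 k} {x : M} (h : ∀ᶠ z in 𝓝 x, η.val z = 0) :
    (KForm.d η).val x = 0 := by
  have h1 : η.inChart x =ᶠ[𝓝 (extChartAt (𝓡 m) x x)] fun _ ↦ 0 := by
    have h2 := continuousAt_extChartAt_symm (I := 𝓡 m) x
    rw [ContinuousAt, extChartAt_to_inv] at h2
    filter_upwards [h2.eventually h] with y hy
    rw [KForm.inChart_eq, hy]
    rfl
  have h3 : extDeriv (η.inChart x) (extChartAt (𝓡 m) x x) = 0 := by
    rw [h1.extDeriv_eq, extDeriv, fderiv_fun_const]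
    exact (alternatizeUncurryFinCLM ℝ (Model m) 𝕜 (n := k)).map_zero
  change (extDeriv (η.inChart x) (extChartAt (𝓡 m) x x)).compContinuousLinearMap
    (chartDeriv x : Model m →L[ℝ] Model m) = 0
  rw [h3]
  rfl

theorem KForm.SupportedIn.d {η : KForm m M 𝕜 k} {S : Set M} (h : η.SupportedIn S)
    (hS : IsClosed S) : (KForm.d η).SupportedIn S := fun x hx ↦
  KForm.d_val_eq_zero (by filter_upwards [hS.isOpen_compl.mem_nhds hx] with z hz using h z hz)

theorem KForm.SupportedIn.ad {η : KForm m M 𝕜 k} {S : Set M} (h : η.SupportedIn S)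
    (C : EndField m M) : (KForm.ad C η).SupportedIn S := fun x hx ↦ by
  rw [KForm.ad_val, h x hx, ← derivExtL_apply, _root_.map_zero]

theorem KForm.SupportedIn.dC {η : KForm m M 𝕜 k} {S : Set M} (h : η.SupportedIn S)
    (hS : IsClosed S) (C : EndField m M) : (KForm.dC C η).SupportedIn S := fun x hx ↦ by
  have h1 := (h.d hS).ad C x hx
  have h2 := (h.ad C).d hS x hx
  change (KForm.ad C (KForm.d η)).val x - (KForm.d (KForm.ad C η)).val x = 0
  rw [h1, h2, sub_zero]

theorem KForm.inner_eq_zero_left (g : Metric m M) {α : KForm m M 𝕜 k} (β : KForm m M 𝕜 k) {x : M}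
    (h : α.val x = 0) : KForm.inner g α β x = 0 := by
  rw [KForm.inner_eq_pair, h, ← pairₗ_apply, _root_.map_zero, LinearMap.zero_apply, _root_.smul_zero]

theorem KForm.inner_eq_zero_right (g : Metric m M) (α : KForm m M 𝕜 k) {β : KForm m M 𝕜 k} {x : M}
    (h : β.val x = 0) : KForm.inner g α β x = 0 := by
  rw [KForm.inner_eq_pair, h, ← pairₗ_apply, _root_.map_zero, _root_.smul_zero]

theorem KForm.inner_add_left (g : Metric m M) (α α' β : KForm m M 𝕜 k) (x : M) :
    KForm.inner g (α + α') β x = KForm.inner g α β x + KForm.inner g α' β x := by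
  simp only [KForm.inner_eq_pair, ← pairₗ_apply]
  change _ • pairₗ _ _ (α.val x + α'.val x) _ = _
  rw [_root_.map_add, LinearMap.add_apply, smul_add]

theorem KForm.inner_add_right (g : Metric m M) (α β β' : KForm m M 𝕜 k) (x : M) :
    KForm.inner g α (β + β') x = KForm.inner g α β x + KForm.inner g α β' x := by
  simp only [KForm.inner_eq_pair, ← pairₗ_apply]
  change _ • pairₗ _ _ _ (β.val x + β'.val x) = _
  rw [_root_.map_add, smul_add]

theorem KForm.inner_smul_left (g : Metric m M) (r : ℝ) (α β : KForm m M 𝕜 k) (x : M) :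
    KForm.inner g (r • α) β x = r • KForm.inner g α β x := by
  simp only [KForm.inner_eq_pair, ← pairₗ_apply]
  change _ • pairₗ _ _ (r • α.val x) _ = _
  rw [_root_.map_smul, LinearMap.smul_apply, smul_comm]

theorem KForm.inner_smul_right (g : Metric m M) (r : ℝ) (α β : KForm m M 𝕜 k) (x : M) :
    KForm.inner g α (r • β) x = r • KForm.inner g α β x := by
  simp only [KForm.inner_eq_pair, ← pairₗ_apply]
  change _ • pairₗ _ _ _ (r • β.val x) = _
  rw [_root_.map_smul, smul_comm]

variable [T2Space M] [SecondCountableTopology M] [MeasurableSpace M] [BorelSpace M]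

theorem KForm.integrable_inner (g : Metric m M) {α β : KForm m M 𝕜 k} (hα : α.IsSmooth)
    (hβ : β.IsSmooth) {S : Set M} (hS : IsCompact S) (h : α.SupportedIn S) :
    Integrable (KForm.inner g α β) (riemannianVolume g) := by
  have := isLocallyFiniteMeasure_riemannianVolume g
  exact (KForm.continuous_inner g hα hβ).integrable_of_hasCompactSupport
    (HasCompactSupport.intro hS fun x hx ↦ KForm.inner_eq_zero_left g β (h x hx))

/-- The defect of adjointness of `d_C` and `deltaC`, before integration. -/
def adjointDefect (g : Metric m M) (C : EndField m M) (α : KForm m M 𝕜 k) (β : KForm m M 𝕜 (k + 1))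
    (x : M) : 𝕜 :=
  KForm.inner g (KForm.dC C α) β x - KForm.inner g α (KForm.deltaC g C β) x

theorem integrable_adjointDefect (hC : C.IsSmooth) {α : KForm m M 𝕜 k} {β : KForm m M 𝕜 (k + 1)}
    (hα : α.IsSmooth) (hβ : β.IsSmooth) {S : Set M} (hS : IsCompact S) (h : α.SupportedIn S) :
    Integrable (adjointDefect g C α β) (riemannianVolume g) :=
  (KForm.integrable_inner g (hα.dC hC) hβ hS (h.dC hS.isClosed C)).sub
    (KForm.integrable_inner g hα (hβ.deltaC hC) hS h)

/-- In coordinates the integrand is, up to k!, a sum of partial derivatives of compactly supported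
functions. Compactness is needed for α only; β is arbitrary. -/
theorem integral_adjointDefect_of_chart (hC : IsKahler g C) {α : KForm m M 𝕜 k}
    {β : KForm m M 𝕜 (k + 1)} (hα : α.IsSmooth) (hβ : β.IsSmooth) {S : Set M} (hS : IsCompact S)
    (h : α.SupportedIn S) {c : M} (hSc : S ⊆ (extChartAt (𝓡 m) c).source) :
    ∫ x, adjointDefect g C α β x ∂(riemannianVolume g) = 0 := by
  have hfi := integrable_adjointDefect (g := g) hC.complex.smooth hα hβ hS h
  rw [integral_riemannianVolume_eq g c hfi.aestronglyMeasurable]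
  swap
  · intro x hx
    have hxS : x ∉ S := fun hxS ↦ hx (hSc hxS)
    rw [adjointDefect, KForm.inner_eq_zero_left g _ (h.dC hS.isClosed C x hxS),
      KForm.inner_eq_zero_left g _ (h x hxS), sub_zero]
  set U := (extChartAt (𝓡 m) c).target
  -- The flux is meaningful only on the chart target. It vanishes off the compact image of S, so
  -- extension by zero is C¹ on the whole model space.
  let Y : Fin m → Model m → 𝕜 := fun a ↦ U.indicator (flux g C α β c a)
  have hS' : IsCompact (extChartAt (𝓡 m) c '' S) :=
    hS.image_of_continuousOn ((continuousOn_extChartAt c).mono hSc)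
  have hSU : extChartAt (𝓡 m) c '' S ⊆ U := by
    rintro _ ⟨x, hx, rfl⟩
    exact (extChartAt (𝓡 m) c).map_source (hSc hx)
  have hY0 : ∀ a, ∀ y ∉ extChartAt (𝓡 m) c '' S, Y a y = 0 := by
    intro a y hy
    by_cases hyU : y ∈ U
    · have hsy : (extChartAt (𝓡 m) c).symm y ∉ S := fun hs ↦
        hy ⟨_, hs, (extChartAt (𝓡 m) c).right_inv hyU⟩
      have h0 : α.inChart c y = 0 := by
        rw [KForm.inChart_eq, h _ hsy]
        rfl
      simp only [Y, indicator_of_mem hyU, flux, h0]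
      simp only [← pairₗ_apply, _root_.map_zero, LinearMap.zero_apply, _root_.smul_zero,
        Finset.sum_const_zero]
    · exact indicator_of_notMem hyU _
  have hYd : ∀ a, ContDiff ℝ 1 (Y a) := fun a ↦ contDiff_iff_contDiffAt.2 fun y ↦ by
    by_cases hyU : y ∈ U
    · refine ((contDiffAt_flux (g := g) hC.complex.smooth hα hβ hyU a).of_le
        (by simp)).congr_of_eventuallyEq ?_
      filter_upwards [target_mem_nhds hyU] with z hz using indicator_of_mem hz _
    · refine (contDiffAt_const (c := (0 : 𝕜))).congr_of_eventuallyEq ?_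
      filter_upwards [hS'.isClosed.isOpen_compl.mem_nhds fun hy ↦ hyU (hSU hy)] with z hz
        using hY0 a z hz
  have hYc : ∀ a, HasCompactSupport (Y a) := fun a ↦ HasCompactSupport.intro hS' (hY0 a)
  have hsum : ∫ y, ∑ a, fderiv ℝ (Y a) y (bvec a) = 0 := by
    rw [integral_finsetSum]
    · exact Finset.sum_eq_zero fun a _ ↦ integral_fderiv_eq_zero (hYd a) (hYc a) _
    · intro a _
      exact (((hYd a).continuous_fderiv (by simp)).clm_apply
        continuous_const).integrable_of_hasCompactSupport
          (((hYc a).fderiv (𝕜 := ℝ)).comp_left (g := fun L : Model m →L[ℝ] 𝕜 ↦ L (bvec a)) rfl)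
  have heq : ∀ y, ∑ a, fderiv ℝ (Y a) y (bvec a) = U.indicator (fun y ↦ (k.factorial : ℝ) •
      density g c y • adjointDefect g C α β ((extChartAt (𝓡 m) c).symm y)) y := by
    intro y
    by_cases hyU : y ∈ U
    · rw [indicator_of_mem hyU]
      refine Eq.trans ?_ (sum_fderiv_flux hC hα hβ hyU)
      refine Finset.sum_congr rfl fun a _ ↦ ?_
      have : Y a =ᶠ[𝓝 y] flux g C α β c a := by
        filter_upwards [target_mem_nhds hyU] with z hz using indicator_of_mem hz _
      rw [this.fderiv_eq]
    · rw [indicator_of_notMem hyU]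
      refine Finset.sum_eq_zero fun a _ ↦ ?_
      have : Y a =ᶠ[𝓝 y] fun _ ↦ 0 := by
        filter_upwards [hS'.isClosed.isOpen_compl.mem_nhds fun hy ↦ hyU (hSU hy)] with z hz
          using hY0 a z hz
      rw [this.fderiv_eq, fderiv_fun_const]
      rfl
  simp only [heq] at hsum
  rw [integral_indicator (measurableSet_target c), integral_smul] at hsum
  exact (smul_eq_zero.1 hsum).resolve_left (by positivity)

end Stokes

/-! ### Partition of unity and formal adjoints on smooth forms -/

section Global

open Set Filter Topology ContinuousAlternatingMap MeasureTheory

variable {m : ℕ} {M : Type*} [TopologicalSpace M] [ChartedSpace (EuclideanSpace ℝ (Fin m)) M]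
  [IsManifold (𝓡 m) ∞ M] {𝕜 : Type*} [RCLike 𝕜] {k : ℕ} {g : Metric m M} {C : EndField m M}

/-- The product of a function and a form. -/
def KForm.mulFun (f : M → ℝ) (η : KForm m M 𝕜 k) : KForm m M 𝕜 k := fun x ↦ f x • η.val x

theorem KForm.mulFun_val (f : M → ℝ) (η : KForm m M 𝕜 k) (x : M) :
    (KForm.mulFun f η).val x = f x • η.val x := rfl

theorem KForm.IsSmooth.mulFun {f : M → ℝ} (hf : ContMDiff (𝓡 m) 𝓘(ℝ, ℝ) ∞ f) {η : KForm m M 𝕜 k}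
    (h : η.IsSmooth) : (KForm.mulFun f η).IsSmooth :=
  KForm.isSmooth_of_contDiffAt fun c _ hy ↦
    ((hf.comp_contMDiffOn (contMDiffOn_extChartAt_symm c)).contDiffOn.contDiffAt
      (target_mem_nhds hy)).smul (h.contDiffAt hy)

theorem KForm.mulFun_add (f f' : M → ℝ) (η : KForm m M 𝕜 k) :
    KForm.mulFun (f + f') η = KForm.mulFun f η + KForm.mulFun f' η :=
  funext fun x ↦ add_smul (f x) (f' x) (η.val x)

theorem KForm.SupportedIn.mulFun (f : M → ℝ) {η : KForm m M 𝕜 k} {S : Set M}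
    (h : η.SupportedIn S) : (KForm.mulFun f η).SupportedIn (S ∩ tsupport f) := fun x hx ↦ by
  rw [KForm.mulFun_val]
  by_cases hxS : x ∈ S
  · rw [image_eq_zero_of_notMem_tsupport fun hf ↦ hx ⟨hxS, hf⟩]
    exact zero_smul (M₀ := ℝ) (A := Model m [⋀^Fin k]→L[ℝ] 𝕜) _
  · rw [h x hxS]
    exact _root_.smul_zero (A := Model m [⋀^Fin k]→L[ℝ] 𝕜) (_ : ℝ)

theorem KForm.dC_add {C : EndField m M} (hC : C.IsSmooth) {η η' : KForm m M 𝕜 k} (h : η.IsSmooth)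
    (h' : η'.IsSmooth) : KForm.dC C (η + η') = KForm.dC C η + KForm.dC C η' := by
  simp only [KForm.dC]
  rw [KForm.d_add h h', KForm.ad_add, KForm.ad_add, KForm.d_add (h.ad hC) (h'.ad hC)]
  exact add_sub_add_comm _ _ _ _

theorem adjointDefect_add (hC : C.IsSmooth) {α α' : KForm m M 𝕜 k} (h : α.IsSmooth)
    (h' : α'.IsSmooth) (β : KForm m M 𝕜 (k + 1)) (x : M) :
    adjointDefect g C (α + α') β x = adjointDefect g C α β x + adjointDefect g C α' β x := by
  simp only [adjointDefect]
  rw [KForm.dC_add hC h h', KForm.inner_add_left, KForm.inner_add_left]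
  ring

variable [T2Space M] [SecondCountableTopology M] [MeasurableSpace M] [BorelSpace M]

/-- The defect is additive in α, so α may be cut into pieces supported in charts; no Leibniz rule
for the cut-off functions is needed. -/
theorem integral_adjointDefect (hC : IsKahler g C) {α : KForm m M 𝕜 k}
    {β : KForm m M 𝕜 (k + 1)} (hα : α.IsSmooth) (hβ : β.IsSmooth) {S : Set M} (hS : IsCompact S)
    (h : α.SupportedIn S) :
    ∫ x, adjointDefect g C α β x ∂(riemannianVolume g) = 0 := by
  have : LocallyCompactSpace M := Manifold.locallyCompact_of_finiteDimensional (𝓡 m)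
  obtain ⟨ρ, hρ⟩ := SmoothPartitionOfUnity.exists_isSubordinate_chartAt_source (𝓡 m) M
  have key : ∀ F : Finset M,
      ∫ x, adjointDefect g C (KForm.mulFun (fun x ↦ ∑ i ∈ F, ρ i x) α) β x
        ∂(riemannianVolume g) = 0 := by
    classical
    intro F
    induction F using Finset.induction_on with
    | empty =>
      have h0 : (KForm.mulFun (fun x ↦ ∑ i ∈ (∅ : Finset M), ρ i x) α).SupportedIn ∅ :=
        fun x _ ↦ zero_smul (M₀ := ℝ) (A := Model m [⋀^Fin k]→L[ℝ] 𝕜) _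
      refine (integral_congr_ae (Eventually.of_forall fun x ↦ ?_)).trans (integral_zero _ _)
      rw [adjointDefect, KForm.inner_eq_zero_left g _ (h0.dC isClosed_empty C x (notMem_empty x)),
        KForm.inner_eq_zero_left g _ (h0 x (notMem_empty x)), sub_zero]
    | insert i F hi ih =>
      have hsm : ContMDiff (𝓡 m) 𝓘(ℝ, ℝ) ∞ fun x ↦ ∑ i ∈ F, ρ i x :=
        contMDiff_finsetSum fun i _ ↦ (ρ i).contMDiff
      have e : (fun x ↦ ∑ j ∈ insert i F, ρ j x) = (fun x ↦ ρ i x) + fun x ↦ ∑ j ∈ F, ρ j x :=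
        funext fun x ↦ Finset.sum_insert hi
      rw [e, KForm.mulFun_add]
      simp only [adjointDefect_add hC.complex.smooth (hα.mulFun (ρ i).contMDiff) (hα.mulFun hsm)]
      rw [integral_add, ih, integral_adjointDefect_of_chart hC (hα.mulFun (ρ i).contMDiff) hβ
        (hS.inter_right (isClosed_tsupport _)) (h.mulFun _) (c := i), add_zero]
      · rw [extChartAt_source]
        exact inter_subset_right.trans (hρ i)
      · exact integrable_adjointDefect hC.complex.smooth (hα.mulFun (ρ i).contMDiff) hβ hS
          ((h.mulFun _).mono inter_subset_left)
      · exact integrable_adjointDefect hC.complex.smooth (hα.mulFun hsm) hβ hS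
          ((h.mulFun _).mono inter_subset_left)
  -- Only finitely many functions of the partition meet the compact set S, so their finite sum
  -- already reproduces α.
  have hfin := ρ.locallyFinite.finite_nonempty_inter_compact hS
  have heq : KForm.mulFun (fun x ↦ ∑ i ∈ hfin.toFinset, ρ i x) α = α := by
    funext x
    change (∑ i ∈ hfin.toFinset, ρ i x) • α.val x = α.val x
    by_cases hx : x ∈ S
    · have h1 := ρ.sum_eq_one (mem_univ x)
      rw [finsum_eq_sum_of_support_subset (s := hfin.toFinset)] at h1
      · rw [h1, one_smul]
      · intro i hi
        simp only [Finite.coe_toFinset, mem_ofPred_eq]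
        exact ⟨x, hi, hx⟩
    · rw [h x hx]
      exact _root_.smul_zero (A := Model m [⋀^Fin k]→L[ℝ] 𝕜) (_ : ℝ)
  rw [← heq]
  exact key _

theorem integral_inner_dC (hC : IsKahler g C) {α : KForm m M 𝕜 k}
    {β : KForm m M 𝕜 (k + 1)} (hα : α.IsSmooth) (hβ : β.IsSmooth) {S : Set M} (hS : IsCompact S)
    (h : α.SupportedIn S) :
    ∫ x, KForm.inner g (KForm.dC C α) β x ∂(riemannianVolume g) =
      ∫ x, KForm.inner g α (KForm.deltaC g C β) x ∂(riemannianVolume g) := by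
  rw [← sub_eq_zero, ← integral_sub]
  · exact integral_adjointDefect hC hα hβ hS h
  · exact KForm.integrable_inner g (hα.dC hC.complex.smooth) hβ hS (h.dC hS.isClosed C)
  · exact KForm.integrable_inner g hα (hβ.deltaC hC.complex.smooth) hS h

/-! ### Formal adjoints of operators on smooth forms -/

/-- The scalar product of two smooth forms. -/
def l2Inner (g : Metric m M) (α β : smoothForms m M 𝕜) : 𝕜 := formL2Inner (M := M) g α.1 β.1

/-- The form vanishes off a compact set. -/
def HasCompactSupp (α : smoothForms m M 𝕜) : Prop :=
  ∃ S : Set M, IsCompact S ∧ ∀ k, (component α k).SupportedIn S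

theorem l2Inner_eq (g : Metric m M) {α : smoothForms m M 𝕜} (hα : HasCompactSupp α)
    (β : smoothForms m M 𝕜) : l2Inner g α β = ∑ k ∈ Finset.range (m + 1),
      ∫ x, KForm.inner g (component α k) (component β k) x ∂(riemannianVolume g) := by
  obtain ⟨S, hS, h⟩ := hα
  exact integral_finsetSum _ fun k _ ↦ KForm.integrable_inner g (isSmooth_component α k)
    (isSmooth_component β k) hS (h k)

theorem HasCompactSupp.add {α α' : smoothForms m M 𝕜} (h : HasCompactSupp α)
    (h' : HasCompactSupp α') : HasCompactSupp (α + α') := by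
  obtain ⟨S, hS, h⟩ := h
  obtain ⟨S', hS', h'⟩ := h'
  refine ⟨S ∪ S', hS.union hS', fun k x hx ↦ ?_⟩
  change (component α k).val x + (component α' k).val x = 0
  rw [h k x fun hx' ↦ hx (Or.inl hx'), h' k x fun hx' ↦ hx (Or.inr hx'), add_zero]

theorem HasCompactSupp.smul (r : ℝ) {α : smoothForms m M 𝕜} (h : HasCompactSupp α) :
    HasCompactSupp (r • α) := by
  obtain ⟨S, hS, h⟩ := h
  refine ⟨S, hS, fun k x hx ↦ ?_⟩
  change r • (component α k).val x = 0
  rw [h k x hx]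
  exact _root_.smul_zero (A := Model m [⋀^Fin k]→L[ℝ] 𝕜) (_ : ℝ)

theorem l2Inner_add_left (g : Metric m M) {α α' : smoothForms m M 𝕜} (hα : HasCompactSupp α)
    (hα' : HasCompactSupp α') (β : smoothForms m M 𝕜) :
    l2Inner g (α + α') β = l2Inner g α β + l2Inner g α' β := by
  rw [l2Inner_eq g (hα.add hα'), l2Inner_eq g hα, l2Inner_eq g hα', ← Finset.sum_add_distrib]
  obtain ⟨S, hS, h⟩ := hα
  obtain ⟨S', hS', h'⟩ := hα'
  refine Finset.sum_congr rfl fun k _ ↦ ?_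
  rw [← integral_add (KForm.integrable_inner g (isSmooth_component α k)
    (isSmooth_component β k) hS (h k)) (KForm.integrable_inner g (isSmooth_component α' k)
    (isSmooth_component β k) hS' (h' k))]
  exact integral_congr_ae (Eventually.of_forall fun x ↦ KForm.inner_add_left g _ _ _ x)

theorem l2Inner_add_right (g : Metric m M) {α : smoothForms m M 𝕜} (hα : HasCompactSupp α)
    (β β' : smoothForms m M 𝕜) :
    l2Inner g α (β + β') = l2Inner g α β + l2Inner g α β' := by
  rw [l2Inner_eq g hα, l2Inner_eq g hα, l2Inner_eq g hα, ← Finset.sum_add_distrib]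
  obtain ⟨S, hS, h⟩ := hα
  refine Finset.sum_congr rfl fun k _ ↦ ?_
  rw [← integral_add (KForm.integrable_inner g (isSmooth_component α k)
    (isSmooth_component β k) hS (h k)) (KForm.integrable_inner g (isSmooth_component α k)
    (isSmooth_component β' k) hS (h k))]
  exact integral_congr_ae (Eventually.of_forall fun x ↦ KForm.inner_add_right g _ _ _ x)

theorem l2Inner_smul_left (g : Metric m M) (r : ℝ) {α : smoothForms m M 𝕜} (hα : HasCompactSupp α)
    (β : smoothForms m M 𝕜) : l2Inner g (r • α) β = r • l2Inner g α β := by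
  rw [l2Inner_eq g (hα.smul r), l2Inner_eq g hα, Finset.smul_sum]
  refine Finset.sum_congr rfl fun k _ ↦ ?_
  rw [← integral_smul]
  exact integral_congr_ae (Eventually.of_forall fun x ↦ KForm.inner_smul_left g r _ _ x)

theorem l2Inner_smul_right (g : Metric m M) (r : ℝ) {α : smoothForms m M 𝕜}
    (hα : HasCompactSupp α)
    (β : smoothForms m M 𝕜) : l2Inner g α (r • β) = r • l2Inner g α β := by
  rw [l2Inner_eq g hα, l2Inner_eq g hα, Finset.smul_sum]
  refine Finset.sum_congr rfl fun k _ ↦ ?_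
  rw [← integral_smul]
  exact integral_congr_ae (Eventually.of_forall fun x ↦ KForm.inner_smul_right g r _ _ x)

/-- `δ` is a formal adjoint of `D`, for operators on smooth forms. -/
structure IsAdj (g : Metric m M) (D δ : Module.End ℝ (smoothForms m M 𝕜)) : Prop where
  supp : ∀ α, HasCompactSupp α → HasCompactSupp (D α)
  adjoint : ∀ α β, HasCompactSupp α → l2Inner g (D α) β = l2Inner g α (δ β)

theorem IsAdj.add {D δ D' δ' : Module.End ℝ (smoothForms m M 𝕜)} (h : IsAdj g D δ)
    (h' : IsAdj g D' δ') : IsAdj g (D + D') (δ + δ') where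
  supp α hα := (h.supp α hα).add (h'.supp α hα)
  adjoint α β hα := by
    rw [LinearMap.add_apply, LinearMap.add_apply,
      l2Inner_add_left g (h.supp α hα) (h'.supp α hα), l2Inner_add_right g hα,
      h.adjoint α β hα, h'.adjoint α β hα]

theorem IsAdj.smul (r : ℝ) {D δ : Module.End ℝ (smoothForms m M 𝕜)} (h : IsAdj g D δ) :
    IsAdj g (r • D) (r • δ) where
  supp α hα := (h.supp α hα).smul r
  adjoint α β hα := by
    rw [LinearMap.smul_apply, LinearMap.smul_apply, l2Inner_smul_left g r (h.supp α hα),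
      l2Inner_smul_right g r hα, h.adjoint α β hα]

theorem IsAdj.sub {D δ D' δ' : Module.End ℝ (smoothForms m M 𝕜)} (h : IsAdj g D δ)
    (h' : IsAdj g D' δ') : IsAdj g (D - D') (δ - δ') := by
  have e : ∀ T : Module.End ℝ (smoothForms m M 𝕜), (-1 : ℝ) • T = -T := fun T ↦ neg_one_smul ℝ T
  have h1 := h.add (h'.smul (-1))
  rwa [e, e, ← sub_eq_add_neg, ← sub_eq_add_neg] at h1

theorem IsAdj.mul {D δ D' δ' : Module.End ℝ (smoothForms m M 𝕜)} (h : IsAdj g D δ)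
    (h' : IsAdj g D' δ') : IsAdj g (D * D') (δ' * δ) where
  supp α hα := h.supp _ (h'.supp α hα)
  adjoint α β hα := by
    rw [Module.End.mul_apply, Module.End.mul_apply, h.adjoint _ β (h'.supp α hα),
      h'.adjoint α _ hα]

/-- The contraction with the bivector of `C`, on smooth forms. -/
def lamEnd (g : Metric m M) (C : EndField m M) (hC : C.IsSmooth) :
    Module.End ℝ (smoothForms m M 𝕜) where
  toFun η := ⟨fun k ↦ KForm.lam g C (component η (k + 2)), fun k ↦
    (isSmooth_component η (k + 2)).lam g hC⟩
  map_add' η η' := ext_component fun k ↦ funext fun x ↦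
    (lam 𝕜 k (gram g x)⁻¹ (C.val x)).map_add ((component η (k + 2)).val x)
      ((component η' (k + 2)).val x)
  map_smul' r η := ext_component fun k ↦ funext fun x ↦
    (lam 𝕜 k (gram g x)⁻¹ (C.val x)).map_smul r ((component η (k + 2)).val x)

/-- The formal adjoint of `d_C` on smooth forms. -/
def deltaCEnd (g : Metric m M) (C : EndField m M) (hC : C.IsSmooth) :
    Module.End ℝ (smoothForms m M 𝕜) := lamEnd g C hC * dEnd - dEnd * lamEnd g C hC

theorem component_deltaCEnd (hC : C.IsSmooth) (η : smoothForms m M 𝕜) :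
    ∀ k, component (deltaCEnd g C hC η) k = KForm.deltaC g C (component η (k + 1))
  | 0 => by
    rw [deltaCEnd, LinearMap.sub_apply, Module.End.mul_apply, Module.End.mul_apply, component_sub,
      component_dEnd_zero, sub_zero]
    rfl
  | _ + 1 => rfl

theorem KForm.eq_zero_of_lt (hk : m < k) (η : KForm m M 𝕜 k) : η = 0 :=
  funext fun x ↦ eq_zero_of_lt_degree hk (η.val x)

/-- Degree by degree this is `integral_inner_dC`. The sums over degrees 0, …, m for the two sides
differ by a shift. -/
theorem isAdj_dCEnd (hC : IsKahler g C) :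
    IsAdj g (dCEnd C hC.complex.smooth : Module.End ℝ (smoothForms m M 𝕜))
      (deltaCEnd g C hC.complex.smooth) := by
  have hsupp : ∀ α : smoothForms m M 𝕜, ∀ S, IsCompact S → (∀ k, (component α k).SupportedIn S) →
      ∀ k, (component (dCEnd C hC.complex.smooth α) k).SupportedIn S := by
    rintro α S hS h (_ | k)
    · rw [component_dCEnd_zero]
      exact fun x hx ↦ rfl
    · rw [component_dCEnd_succ]
      exact (h k).dC hS.isClosed C
  have hcs : ∀ α : smoothForms m M 𝕜, HasCompactSupp α →
      HasCompactSupp (dCEnd C hC.complex.smooth α) := fun α ⟨S, hS, h⟩ ↦ ⟨S, hS, hsupp α S hS h⟩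
  refine ⟨hcs, fun α β hα ↦ ?_⟩
  rw [l2Inner_eq g (hcs α hα), l2Inner_eq g hα]
  obtain ⟨S, hS, h⟩ := hα
  -- The shift is repaired at both ends: forms of degree m + 1 vanish, and d_C α has no component of
  -- degree 0.
  have h1 : ∫ x, KForm.inner g (component (dCEnd C hC.complex.smooth α) (m + 1))
      (component β (m + 1)) x ∂(riemannianVolume g) = 0 := by
    rw [KForm.eq_zero_of_lt (Nat.lt_succ_self m) (component β (m + 1))]
    refine (integral_congr_ae (Eventually.of_forall fun x ↦ ?_)).trans (integral_zero _ _)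
    exact KForm.inner_eq_zero_right g _ rfl
  have h0 : ∫ x, KForm.inner g (component (dCEnd C hC.complex.smooth α) 0)
      (component β 0) x ∂(riemannianVolume g) = 0 := by
    rw [component_dCEnd_zero]
    refine (integral_congr_ae (Eventually.of_forall fun x ↦ ?_)).trans (integral_zero _ _)
    exact KForm.inner_eq_zero_left g _ rfl
  rw [← add_zero (∑ k ∈ Finset.range (m + 1), _), ← h1, ← Finset.sum_range_succ,
    Finset.sum_range_succ', h0, add_zero]
  refine Finset.sum_congr rfl fun k _ ↦ ?_
  rw [component_dCEnd_succ, component_deltaCEnd]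
  exact integral_inner_dC hC (isSmooth_component α k) (isSmooth_component β (k + 1)) hS (h k)

end Global

/-! ### Skewness of the derivations and uniqueness of adjoints -/

section Uniqueness

open Set Filter Topology ContinuousAlternatingMap MeasureTheory

variable {m : ℕ} {M : Type*} [TopologicalSpace M] [ChartedSpace (EuclideanSpace ℝ (Fin m)) M]
  [IsManifold (𝓡 m) ∞ M] {𝕜 : Type*} [RCLike 𝕜] {k : ℕ} {g : Metric m M} {C : EndField m M}

/-- C is a skew isometry, so ad_C is pointwise skew-adjoint, with no integration by parts. -/
theorem KForm.inner_ad (hC : IsKahler g C) (α β : KForm m M 𝕜 k) (x : M) :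
    KForm.inner g (KForm.ad C α) β x = (-1 : ℝ) • KForm.inner g α (KForm.ad C β) x := by
  have hy := mem_extChartAt_target (I := 𝓡 m) x
  have h : ∀ γ δ : KForm m M 𝕜 k, KForm.inner g γ δ x =
      KForm.inner g γ δ ((extChartAt (𝓡 m) x).symm (extChartAt (𝓡 m) x x)) := fun γ δ ↦ by
    rw [extChartAt_to_inv]
  rw [h, h, KForm.inner_symm_eq g _ _ hy, KForm.inner_symm_eq g _ _ hy, KForm.ad_inChart C _ hy,
    KForm.ad_inChart C _ hy, pair_derivExt _ _ (C.inChart x (extChartAt (𝓡 m) x x))]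
  · have h1 : derivExt (-C.inChart x (extChartAt (𝓡 m) x x))
        (β.inChart x (extChartAt (𝓡 m) x x)) =
        -derivExt (C.inChart x (extChartAt (𝓡 m) x x)) (β.inChart x (extChartAt (𝓡 m) x x)) := by
      simp only [← derivExtL_apply, _root_.map_neg]
      rfl
    rw [h1, ← pairₗ_apply, ← pairₗ_apply, _root_.map_neg, smul_neg, neg_one_smul, neg_neg]
  · rw [toMat_neg, neg_mul, hC.toMat_mul_inv hy, neg_neg]

variable [T2Space M] [SecondCountableTopology M] [MeasurableSpace M] [BorelSpace M]

theorem isAdj_adEnd (hC : IsKahler g C) :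
    IsAdj g (adEnd C hC.complex.smooth : Module.End ℝ (smoothForms m M 𝕜))
      ((-1 : ℝ) • adEnd C hC.complex.smooth) := by
  have hcs : ∀ α : smoothForms m M 𝕜, HasCompactSupp α →
      HasCompactSupp (adEnd C hC.complex.smooth α) := fun α ⟨S, hS, h⟩ ↦
    ⟨S, hS, fun k ↦ (h k).ad C⟩
  refine ⟨hcs, fun α β hα ↦ ?_⟩
  rw [LinearMap.smul_apply, l2Inner_smul_right g _ hα, l2Inner_eq g (hcs α hα), l2Inner_eq g hα,
    Finset.smul_sum]
  refine Finset.sum_congr rfl fun k _ ↦ ?_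
  rw [← integral_smul]
  exact integral_congr_ae (Eventually.of_forall fun x ↦ KForm.inner_ad hC _ _ x)

theorem isOpenPosMeasure_riemannianVolume (g : Metric m M) :
    (riemannianVolume g).IsOpenPosMeasure := by
  refine ⟨fun U hU ⟨x, hx⟩ h0 ↦ ?_⟩
  have h1 : chartVolume g x U = 0 := by
    rw [← riemannianVolume_restrict_source]
    exact le_antisymm ((Measure.restrict_apply_le _ _).trans h0.le) bot_le
  rw [chartVolume_apply g x hU.measurableSet] at h1
  set W := (extChartAt (𝓡 m) x).symm ⁻¹' U ∩ (extChartAt (𝓡 m) x).target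
  have hW : IsOpen W := by
    have e : W = (extChartAt (𝓡 m) x).target ∩ (extChartAt (𝓡 m) x).symm ⁻¹' U := inter_comm _ _
    rw [e]
    exact (continuousOn_extChartAt_symm x).isOpen_inter_preimage (isOpen_target x) hU
  have hne : W.Nonempty := ⟨extChartAt (𝓡 m) x x, by
    rw [mem_preimage, extChartAt_to_inv]
    exact hx, mem_extChartAt_target x⟩
  have hm : AEMeasurable (fun y ↦ ENNReal.ofReal (density g x y)) (volume.restrict W) :=
    (((continuousOn_density g x).mono inter_subset_right).aemeasurable
      hW.measurableSet).ennreal_ofReal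
  rw [lintegral_eq_zero_iff' hm] at h1
  have h2 : ∀ᵐ _ ∂(volume.restrict W), False := by
    filter_upwards [h1, ae_restrict_mem hW.measurableSet] with y hy hyW
    exact (ENNReal.ofReal_pos.2 (density_pos g hyW.2)).ne' hy
  rw [ae_iff] at h2
  simp only [not_false_eq_true, Set.ofPred_true, Measure.restrict_apply_univ] at h2
  exact (hW.measure_pos volume hne).ne' h2

theorem KForm.re_inner_mulFun (g : Metric m M) (f : M → ℝ) (γ : KForm m M 𝕜 k) (x : M) :
    ∃ r : ℝ, 0 ≤ r ∧ RCLike.re (KForm.inner g (KForm.mulFun f γ) γ x) = f x * r ∧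
      (r = 0 → γ.val x = 0) := by
  obtain ⟨r, hr, h, h0⟩ := pair_self_nonneg (gram g x)⁻¹ (gram_posDef g x).inv (γ.val x)
  refine ⟨(k.factorial : ℝ)⁻¹ * r, by positivity, ?_, fun h1 ↦ h0 ?_⟩
  · rw [KForm.inner_eq_pair, KForm.mulFun_val, ← pairₗ_apply]
    have h2 : pairₗ (𝕜 := 𝕜) (gram g x)⁻¹ k (f x • γ.val x) (γ.val x) = f x • (r : 𝕜) := by
      rw [← h, ← pairₗ_apply, ← LinearMap.smul_apply]
      exact congrArg (fun L ↦ L (γ.val x)) ((pairₗ (𝕜 := 𝕜) (gram g x)⁻¹ k).map_smul _ _)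
    rw [h2, RCLike.smul_re, RCLike.smul_re, RCLike.ofReal_re]
    ring
  · exact (mul_eq_zero.1 h1).resolve_left (by positivity)

/-- The product of a smooth function and a smooth form. -/
def mulFunForm {f : M → ℝ} (hf : ContMDiff (𝓡 m) 𝓘(ℝ, ℝ) ∞ f) (γ : smoothForms m M 𝕜) :
    smoothForms m M 𝕜 :=
  ⟨fun k ↦ KForm.mulFun f (component γ k), fun k ↦ (isSmooth_component γ k).mulFun hf⟩

/-- Test against fγ with f a bump function at x: the integrands f|γ|² are continuous and
nonnegative, and the measure charges open sets, so γ vanishes at x. -/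
theorem eq_zero_of_l2Inner (g : Metric m M) {γ : smoothForms m M 𝕜}
    (h : ∀ α, HasCompactSupp α → l2Inner g α γ = 0) : γ = 0 := by
  refine ext_component fun k ↦ ?_
  -- Degrees above m do not enter the scalar product, but forms of such degrees vanish anyway.
  rcases lt_or_ge m k with hk | hk
  · exact KForm.eq_zero_of_lt hk _
  funext x
  have := isLocallyFiniteMeasure_riemannianVolume g
  have := isOpenPosMeasure_riemannianVolume g
  let f : SmoothBumpFunction (𝓡 m) x := Classical.arbitrary _
  have hcs : ∀ j, (component (mulFunForm f.contMDiff γ) j).SupportedIn (tsupport f) := by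
    intro j z hz
    have h1 : (component γ j).SupportedIn univ := fun z hz ↦ absurd (mem_univ z) hz
    exact h1.mulFun f z fun hz' ↦ hz hz'.2
  have hα : HasCompactSupp (mulFunForm f.contMDiff γ) := ⟨_, f.hasCompactSupport, hcs⟩
  have hsm : ∀ j, (component (mulFunForm f.contMDiff γ) j).IsSmooth := fun j ↦
    isSmooth_component _ j
  let F : ℕ → M → ℝ := fun j z ↦
    RCLike.re (KForm.inner g (KForm.mulFun f (component γ j)) (component γ j) z)
  have hF : ∀ j, 0 ≤ F j := fun j z ↦ by
    obtain ⟨r, hr, h1, -⟩ := KForm.re_inner_mulFun g f (component γ j) z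
    simp only [F, h1]
    exact mul_nonneg f.nonneg hr
  have hsum : ∑ j ∈ Finset.range (m + 1), ∫ z, F j z ∂(riemannianVolume g) = 0 := by
    have h1 := congrArg RCLike.re (h _ hα)
    rw [l2Inner_eq g hα, _root_.map_sum, _root_.map_zero] at h1
    rw [← h1]
    exact Finset.sum_congr rfl fun j _ ↦ integral_re
      (KForm.integrable_inner g (hsm j) (isSmooth_component γ j) f.hasCompactSupport (hcs j))
  have hk0 := (Finset.sum_eq_zero_iff_of_nonneg
    (fun j _ ↦ integral_nonneg (hF j))).1 hsum k (Finset.mem_range.2 (by omega))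
  have hFx : F k x = 0 := by
    by_contra hne
    refine (Continuous.integral_pos_of_hasCompactSupport_nonneg_nonzero
      (RCLike.continuous_re.comp (KForm.continuous_inner g (hsm k) (isSmooth_component γ k)))
      (HasCompactSupport.intro f.hasCompactSupport fun z hz ↦ ?_) (hF k) hne).ne' hk0
    change RCLike.re (KForm.inner g _ _ z) = 0
    rw [KForm.inner_eq_zero_left g _ (hcs k z hz), _root_.map_zero]
  obtain ⟨r, -, h1, h2⟩ := KForm.re_inner_mulFun g f (component γ k) x
  simp only [F, h1, f.eq_one, one_mul] at hFx
  exact h2 hFx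

theorem eq_of_l2Inner (g : Metric m M) {γ γ' : smoothForms m M 𝕜}
    (h : ∀ α, HasCompactSupp α → l2Inner g α γ = l2Inner g α γ') : γ = γ' := by
  have h1 : γ + (-1 : ℝ) • γ' = 0 := eq_zero_of_l2Inner g fun α hα ↦ by
    rw [l2Inner_add_right g hα, l2Inner_smul_right g _ hα, h α hα, neg_one_smul, add_neg_cancel]
  have e : (-1 : ℝ) • γ' = -γ' := neg_one_smul ℝ γ'
  rwa [e, ← sub_eq_add_neg, sub_eq_zero] at h1

theorem IsAdj.unique {D δ δ' : Module.End ℝ (smoothForms m M 𝕜)} (h : IsAdj g D δ)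
    (h' : IsAdj g D δ') : δ = δ' :=
  LinearMap.ext fun β ↦ eq_of_l2Inner g fun α hα ↦ by
    rw [← h.adjoint α β hα, ← h'.adjoint α β hα]

/-- The commutator of a skew-adjoint operator with an operator has as adjoint the commutator with
the adjoint. -/
theorem IsAdj.commutator {A D δ : Module.End ℝ (smoothForms m M 𝕜)} (hA : IsAdj g A ((-1 : ℝ) • A))
    (h : IsAdj g D δ) : IsAdj g (A * D - D * A) (A * δ - δ * A) := by
  have h1 := (hA.mul h).sub (h.mul hA)
  have e : δ * ((-1 : ℝ) • A) - (-1 : ℝ) • A * δ = A * δ - δ * A := by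
    have e1 : ∀ T : Module.End ℝ (smoothForms m M 𝕜), (-1 : ℝ) • T = -T := fun T ↦ neg_one_smul ℝ T
    rw [mul_smul_comm, smul_mul_assoc, e1, e1, sub_neg_eq_add]
    exact neg_add_eq_sub _ _
  rwa [e] at h1

end Uniqueness

/-! ### Quaternionic quadruples in an associative algebra -/

section Algebra

/-- Bracketing with a is a derivation of the ring; new anticommutation relations are generated from
old ones by it. -/
theorem commutator_anticommutator {R : Type*} [Ring R] {a p q p' q' t : R} (hp : a * p - p * a = p')
    (hq : a * q - q * a = q') (h : p * q + q * p = t) :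
    p' * q + q * p' + (p * q' + q' * p) = a * t - t * a := by
  subst hp hq h
  noncomm_ring

variable {R : Type*} [Ring R] [Algebra ℝ R]

theorem sum_anticommutator {ι : Type*} [Fintype ι] (x y : ι → ℝ) (p q : ι → R) :
    (∑ i, x i • p i) * (∑ j, y j • q j) + (∑ j, y j • q j) * (∑ i, x i • p i) =
      ∑ i, ∑ j, (x i * y j) • (p i * q j + q j * p i) := by
  rw [Finset.sum_mul_sum, Finset.sum_mul_sum, Finset.sum_comm (f := fun j i ↦ y j • q j * x i • p i),
    ← Finset.sum_add_distrib]
  refine Finset.sum_congr rfl fun i _ ↦ ?_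
  rw [← Finset.sum_add_distrib]
  refine Finset.sum_congr rfl fun j _ ↦ ?_
  rw [smul_mul_smul_comm, smul_mul_smul_comm, mul_comm (y j), smul_add]

theorem sum_commutator {ι : Type*} [Fintype ι] (x y : ι → ℝ) (p q : ι → R) :
    (∑ i, x i • p i) * (∑ j, y j • q j) - (∑ j, y j • q j) * (∑ i, x i • p i) =
      ∑ i, ∑ j, (x i * y j) • (p i * q j - q j * p i) := by
  rw [Finset.sum_mul_sum, Finset.sum_mul_sum, Finset.sum_comm (f := fun j i ↦ y j • q j * x i • p i),
    ← Finset.sum_sub_distrib]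
  refine Finset.sum_congr rfl fun i _ ↦ ?_
  rw [← Finset.sum_sub_distrib]
  refine Finset.sum_congr rfl fun j _ ↦ ?_
  rw [smul_mul_smul_comm, smul_mul_smul_comm, mul_comm (y j), smul_sub]

/-- The combination `x⁰ p₀ + x¹ p₁ + x² p₂ + x³ p₃`. -/
def quatComb (p : Fin 4 → R) (x : ℍ[ℝ]) : R :=
  x.re • p 0 + x.imI • p 1 + x.imJ • p 2 + x.imK • p 3

theorem quatComb_eq_sum (p : Fin 4 → R) (x : ℍ[ℝ]) :
    quatComb p x = ∑ i, (![x.re, x.imI, x.imJ, x.imK] : Fin 4 → ℝ) i • p i := by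
  rw [Fin.sum_univ_four]
  rfl

/-- The commutation relations of `ad_I`, `ad_J`, `ad_K` with a quaternionic quadruple of
operators. -/
structure IsQuatModule (aI aJ aK : R) (p : Fin 4 → R) : Prop where
  I0 : aI * p 0 - p 0 * aI = p 1
  J0 : aJ * p 0 - p 0 * aJ = p 2
  K0 : aK * p 0 - p 0 * aK = p 3
  II : aI * p 1 - p 1 * aI = -p 0
  JJ : aJ * p 2 - p 2 * aJ = -p 0
  KK : aK * p 3 - p 3 * aK = -p 0
  IJ : aI * p 2 - p 2 * aI = p 3
  JI : aJ * p 1 - p 1 * aJ = -p 3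
  JK : aJ * p 3 - p 3 * aJ = p 1
  KJ : aK * p 2 - p 2 * aK = -p 1
  KI : aK * p 1 - p 1 * aK = p 2
  IK : aI * p 3 - p 3 * aI = -p 2

variable {aI aJ aK : R} {p q : Fin 4 → R}

theorem IsQuatModule.commutator (h : IsQuatModule aI aJ aK p) {n : R}
    (hn : ∀ i, n * p i - p i * n = p i) (x y : ℍ[ℝ]) :
    quatComb ![n, aI, aJ, aK] x * quatComb p y - quatComb p y * quatComb ![n, aI, aJ, aK] x =
      quatComb p (x * y) := by
  rw [quatComb_eq_sum, quatComb_eq_sum p y, sum_commutator]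
  simp only [Fin.sum_univ_four, Matrix.cons_val, hn, h.I0, h.J0, h.K0, h.II, h.JJ, h.KK, h.IJ, h.JI,
    h.JK, h.KJ, h.KI, h.IK, quatComb, Quaternion.re_mul, Quaternion.imI_mul, Quaternion.imJ_mul,
    Quaternion.imK_mul]
  module

theorem anticommutator_of_basis {t : R}
    (hpq : ∀ i j, p i * q j + q j * p i = if i = j then t else 0) (x y : ℍ[ℝ]) :
    quatComb p x * quatComb q y + quatComb q y * quatComb p x = (star x * y).re • t := by
  rw [quatComb_eq_sum, quatComb_eq_sum q y, sum_anticommutator]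
  simp only [hpq, smul_ite, smul_zero, Finset.sum_ite_eq, Finset.mem_univ, if_true, ← Finset.sum_smul]
  congr 1
  simp only [Fin.sum_univ_four, Matrix.cons_val, Quaternion.re_mul, Quaternion.re_star,
    Quaternion.imI_star, Quaternion.imJ_star, Quaternion.imK_star]
  ring

/-- Bracketing p₀² = 0 with a gives {p₀, pᵢ} = 0. A second bracket gives pᵢ² = p₀² = 0 and the mixed
relations. -/
theorem IsQuatModule.anticommutator_self (h : IsQuatModule aI aJ aK p) (h0 : p 0 * p 0 = 0)
    (x y : ℍ[ℝ]) : quatComb p x * quatComb p y + quatComb p y * quatComb p x = 0 := by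
  have h00 : p 0 * p 0 + p 0 * p 0 = 0 := by rw [h0, add_zero]
  have key : ∀ {a b c b' c' : R}, a * b - b * a = b' → a * c - c * a = c' →
      b * c + c * b = 0 → b' * c + c * b' + (b * c' + c' * b) = 0 := fun h1 h2 h3 ↦ by
    rw [commutator_anticommutator h1 h2 h3, mul_zero, zero_mul, sub_zero]
  have zero_one : ∀ {a c : R}, a * p 0 - p 0 * a = c → p 0 * c + c * p 0 = 0 := fun {a c} h1 ↦ by
    subst h1
    have e : p 0 * (a * p 0 - p 0 * a) + (a * p 0 - p 0 * a) * p 0 = a * (p 0 * p 0) - (p 0 * p 0) * a := by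
      noncomm_ring
    rw [e, h0, mul_zero, zero_mul, sub_zero]
  have h01 := zero_one h.I0
  have h02 := zero_one h.J0
  have h03 := zero_one h.K0
  have h11 := key h.I0 h.II h01
  have h22 := key h.J0 h.JJ h02
  have h33 := key h.K0 h.KK h03
  have h12 := key h.I0 h.IJ h02
  have h23 := key h.J0 h.JK h03
  have h31 := key h.K0 h.KI h01
  simp only [mul_neg, neg_mul, ← neg_add, h00, neg_zero, add_zero] at h11 h22 h33
  rw [h03, add_zero] at h12
  rw [h01, add_zero] at h23
  rw [h02, add_zero] at h31
  have hpp : ∀ i j, p i * p j + p j * p i = if i = j then 0 else 0 := by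
    intro i j
    rw [ite_self]
    fin_cases i <;> fin_cases j <;> first | assumption | (rw [add_comm]; assumption)
  rw [anticommutator_of_basis hpp, smul_zero]

/-- The three relations {p₀, qᵢ} = 0 suffice. One bracket turns them into {pᵢ, qᵢ} = {p₀, q₀} and
{pᵢ, qⱼ} = 0 for distinct nonzero i, j. -/
theorem IsQuatModule.anticommutator (h : IsQuatModule aI aJ aK p) (h' : IsQuatModule aI aJ aK q)
    (h01 : p 0 * q 1 + q 1 * p 0 = 0) (h02 : p 0 * q 2 + q 2 * p 0 = 0)
    (h03 : p 0 * q 3 + q 3 * p 0 = 0) (x y : ℍ[ℝ]) :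
    quatComb p x * quatComb q y + quatComb q y * quatComb p x =
      (star x * y).re • (p 0 * q 0 + q 0 * p 0) := by
  have key : ∀ {a b c b' c' : R}, a * b - b * a = b' → a * c - c * a = c' →
      b * c + c * b = 0 → b' * c + c * b' + (b * c' + c' * b) = 0 := fun h1 h2 h3 ↦ by
    rw [commutator_anticommutator h1 h2 h3, mul_zero, zero_mul, sub_zero]
  have h11 := key h.I0 h'.II h01
  have h22 := key h.J0 h'.JJ h02
  have h33 := key h.K0 h'.KK h03
  have h12 := key h.I0 h'.IJ h02
  have h23 := key h.J0 h'.JK h03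
  have h31 := key h.K0 h'.KI h01
  have h21 := key h.J0 h'.JI h01
  have h32 := key h.K0 h'.KJ h02
  have h13 := key h.I0 h'.IK h03
  simp only [mul_neg, neg_mul, ← neg_add, h01, h02, h03, neg_zero, add_zero]
    at h11 h22 h33 h12 h23 h31 h21 h32 h13
  rw [add_neg_eq_zero] at h11 h22 h33
  -- The remaining relations {pᵢ, q₀} = 0 come from a second bracket. For example, bracketing {p₂,
  -- q₃} = 0 with a_K gives -{p₁, q₃} - {p₂, q₀} = 0, whose first term is already known to vanish.
  have h10 := key h.KJ h'.KK h23
  have h20 := key h.IK h'.II h31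
  have h30 := key h.JI h'.JJ h12
  simp only [mul_neg, neg_mul, ← neg_add, h13, h21, h32, neg_zero, zero_add, neg_eq_zero] at h10 h20 h30
  refine anticommutator_of_basis (fun i j ↦ ?_) x y
  fin_cases i <;> fin_cases j <;> first | rfl | assumption

end Algebra

/-! ### Hyperkähler manifolds: the relations for the differentials and their adjoints -/

section Hyperkahler

variable {m : ℕ} {M : Type*} [TopologicalSpace M] [ChartedSpace (EuclideanSpace ℝ (Fin m)) M]
  [IsManifold (𝓡 m) ∞ M] {𝕜 : Type*} [RCLike 𝕜] {g : Metric m M} {I J K : EndField m M}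

namespace IsHyperkahler

theorem I_J (h : IsHyperkahler g I J K) (x : M) (v) : I x (J x v) = K x v := by
  have h1 := h.ijk x (K x v)
  rw [h.kahlerK.complex.sq, map_neg, map_neg] at h1
  exact neg_inj.1 h1

theorem J_K (h : IsHyperkahler g I J K) (x : M) (v) : J x (K x v) = I x v := by
  have h1 := congrArg (I x) (h.ijk x v)
  rw [h.kahlerI.complex.sq, map_neg] at h1
  exact neg_inj.1 h1

theorem K_J (h : IsHyperkahler g I J K) (x : M) (v) : K x (J x v) = -I x v := by
  rw [← h.I_J, h.kahlerJ.complex.sq, map_neg]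

theorem J_I (h : IsHyperkahler g I J K) (x : M) (v) : J x (I x v) = -K x v := by
  rw [← h.J_K, h.kahlerJ.complex.sq]

theorem I_K (h : IsHyperkahler g I J K) (x : M) (v) : I x (K x v) = -J x v := by
  rw [← h.I_J, h.kahlerI.complex.sq]

theorem K_I (h : IsHyperkahler g I J K) (x : M) (v) : K x (I x v) = J x v := by
  rw [← h.I_J, h.J_I, map_neg, h.I_K, neg_neg]

end IsHyperkahler

/-- The differentials `d, d_I, d_J, d_K` on smooth forms. -/
def dQuad (𝕜 : Type*) [RCLike 𝕜] (h : IsHyperkahler g I J K) :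
    Fin 4 → Module.End ℝ (smoothForms m M 𝕜) :=
  ![dEnd, dCEnd I h.kahlerI.complex.smooth, dCEnd J h.kahlerJ.complex.smooth,
    dCEnd K h.kahlerK.complex.smooth]

theorem isQuatModule_dQuad (h : IsHyperkahler g I J K) :
    IsQuatModule (adEnd I h.kahlerI.complex.smooth) (adEnd J h.kahlerJ.complex.smooth)
      (adEnd K h.kahlerK.complex.smooth) (dQuad 𝕜 h) where
  I0 := rfl
  J0 := rfl
  K0 := rfl
  II := adEnd_mul_dCEnd_self h.kahlerI
  JJ := adEnd_mul_dCEnd_self h.kahlerJ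
  KK := adEnd_mul_dCEnd_self h.kahlerK
  IJ := (adEnd_mul_dCEnd_of_comp h.kahlerI h.kahlerJ h.kahlerK 1
    fun x v ↦ by rw [h.J_I, one_smul]).trans (one_smul ℝ _)
  JI := (adEnd_mul_dCEnd_of_comp h.kahlerJ h.kahlerI h.kahlerK (-1)
    fun x v ↦ by rw [h.I_J, neg_one_smul, neg_neg]).trans (neg_one_smul ℝ (dCEnd K h.kahlerK.complex.smooth))
  JK := (adEnd_mul_dCEnd_of_comp h.kahlerJ h.kahlerK h.kahlerI 1
    fun x v ↦ by rw [h.K_J, one_smul]).trans (one_smul ℝ _)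
  KJ := (adEnd_mul_dCEnd_of_comp h.kahlerK h.kahlerJ h.kahlerI (-1)
    fun x v ↦ by rw [h.J_K, neg_one_smul, neg_neg]).trans (neg_one_smul ℝ (dCEnd I h.kahlerI.complex.smooth))
  KI := (adEnd_mul_dCEnd_of_comp h.kahlerK h.kahlerI h.kahlerJ 1
    fun x v ↦ by rw [h.I_K, one_smul]).trans (one_smul ℝ _)
  IK := (adEnd_mul_dCEnd_of_comp h.kahlerI h.kahlerK h.kahlerJ (-1)
    fun x v ↦ by rw [h.K_I, neg_one_smul, neg_neg]).trans (neg_one_smul ℝ (dCEnd J h.kahlerJ.complex.smooth))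

theorem gradingEnd_mul_dQuad (h : IsHyperkahler g I J K) (i : Fin 4) :
    gradingEnd * dQuad 𝕜 h i - dQuad 𝕜 h i * gradingEnd = dQuad 𝕜 h i := by
  fin_cases i
  · exact gradingEnd_mul_dEnd
  · exact gradingEnd_mul_dCEnd I h.kahlerI.complex.smooth
  · exact gradingEnd_mul_dCEnd J h.kahlerJ.complex.smooth
  · exact gradingEnd_mul_dCEnd K h.kahlerK.complex.smooth

theorem dQ_eq (h : IsHyperkahler g I J K) (x : ℍ[ℝ]) (η : smoothForms m M 𝕜) :
    Form.dQ (M := M) I J K x η.1 = (quatComb (dQuad 𝕜 h) x η).1 := rfl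

/-- The formal adjoints of `d, d_I, d_J, d_K` on smooth forms. -/
def deltaQuad (𝕜 : Type*) [RCLike 𝕜] (h : IsHyperkahler g I J K) :
    Fin 4 → Module.End ℝ (smoothForms m M 𝕜) :=
  ![deltaCEnd g I h.kahlerI.complex.smooth * adEnd I h.kahlerI.complex.smooth -
      adEnd I h.kahlerI.complex.smooth * deltaCEnd g I h.kahlerI.complex.smooth,
    deltaCEnd g I h.kahlerI.complex.smooth, deltaCEnd g J h.kahlerJ.complex.smooth,
    deltaCEnd g K h.kahlerK.complex.smooth]

/-- Expanding {d, [Λ, d]}, the terms dΛd cancel and the others contain d². This is the only input on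
adjoints needed for (iii) beyond the bracket relations. -/
theorem dEnd_anticommute_deltaCEnd {C : EndField m M} (hC : C.IsSmooth) :
    dEnd * deltaCEnd g C hC + deltaCEnd g C hC * dEnd =
      (0 : Module.End ℝ (smoothForms m M 𝕜)) := by
  rw [deltaCEnd, mul_sub, sub_mul, ← mul_assoc dEnd dEnd, dEnd_mul_dEnd, mul_assoc _ dEnd dEnd,
    dEnd_mul_dEnd, mul_assoc]
  simp

variable [T2Space M] [SecondCountableTopology M] [MeasurableSpace M] [BorelSpace M]

theorem isAdj_dQuad (h : IsHyperkahler g I J K) (i : Fin 4) :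
    IsAdj g (dQuad 𝕜 h i) (deltaQuad 𝕜 h i) := by
  fin_cases i
  -- The adjoint of d is read off from d = -[ad_I, d_I].
  · have h1 := ((isAdj_adEnd h.kahlerI).commutator (isAdj_dCEnd (𝕜 := 𝕜) h.kahlerI)).smul (-1)
    rw [adEnd_mul_dCEnd_self h.kahlerI] at h1
    have e : ∀ T : Module.End ℝ (smoothForms m M 𝕜), (-1 : ℝ) • T = -T := fun T ↦ neg_one_smul ℝ T
    rw [e, e, neg_neg, neg_sub] at h1
    exact h1
  · exact isAdj_dCEnd h.kahlerI
  · exact isAdj_dCEnd h.kahlerJ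
  · exact isAdj_dCEnd h.kahlerK

theorem IsAdj.neg {D δ : Module.End ℝ (smoothForms m M 𝕜)} (h : IsAdj g D δ) :
    IsAdj g (-D) (-δ) := by
  have e : ∀ T : Module.End ℝ (smoothForms m M 𝕜), (-1 : ℝ) • T = -T := fun T ↦ neg_one_smul ℝ T
  have h1 := h.smul (-1)
  rwa [e, e] at h1

/-- A commutation relation with `ad_C` passes to the adjoints. -/
theorem IsAdj.commutator_eq {A D D' δ δ' : Module.End ℝ (smoothForms m M 𝕜)}
    (hA : IsAdj g A ((-1 : ℝ) • A)) (h : IsAdj g D δ) (h' : IsAdj g D' δ')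
    (hD : A * D - D * A = D') : A * δ - δ * A = δ' := by
  subst hD
  exact (hA.commutator h).unique h'

/-- Taking adjoints commutes with the bracket by a skew-adjoint operator, so each relation is
transported without change of sign, and uniqueness of adjoints identifies the result. -/
theorem isQuatModule_deltaQuad (h : IsHyperkahler g I J K) :
    IsQuatModule (adEnd I h.kahlerI.complex.smooth) (adEnd J h.kahlerJ.complex.smooth)
      (adEnd K h.kahlerK.complex.smooth) (deltaQuad 𝕜 h) := by
  have hI := isAdj_adEnd (𝕜 := 𝕜) h.kahlerI
  have hJ := isAdj_adEnd (𝕜 := 𝕜) h.kahlerJ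
  have hK := isAdj_adEnd (𝕜 := 𝕜) h.kahlerK
  have hd := isAdj_dQuad (𝕜 := 𝕜) h
  have hq := isQuatModule_dQuad (𝕜 := 𝕜) h
  exact ⟨hI.commutator_eq (hd 0) (hd 1) hq.I0, hJ.commutator_eq (hd 0) (hd 2) hq.J0,
    hK.commutator_eq (hd 0) (hd 3) hq.K0, hI.commutator_eq (hd 1) (hd 0).neg hq.II,
    hJ.commutator_eq (hd 2) (hd 0).neg hq.JJ, hK.commutator_eq (hd 3) (hd 0).neg hq.KK,
    hI.commutator_eq (hd 2) (hd 3) hq.IJ, hJ.commutator_eq (hd 1) (hd 3).neg hq.JI,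
    hJ.commutator_eq (hd 3) (hd 1) hq.JK, hK.commutator_eq (hd 2) (hd 1).neg hq.KJ,
    hK.commutator_eq (hd 1) (hd 2) hq.KI, hI.commutator_eq (hd 3) (hd 2).neg hq.IK⟩

theorem isAdj_quatComb (h : IsHyperkahler g I J K) (y : ℍ[ℝ]) :
    IsAdj g (quatComb (dQuad 𝕜 h) y) (quatComb (deltaQuad 𝕜 h) y) :=
  ((((isAdj_dQuad h 0).smul _).add ((isAdj_dQuad h 1).smul _)).add
    ((isAdj_dQuad h 2).smul _)).add ((isAdj_dQuad h 3).smul _)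

open Classical in
/-- The extension by zero of an operator on smooth forms to all forms. -/
def extendEnd (δ : Module.End ℝ (smoothForms m M 𝕜)) (β : Form m M 𝕜) : Form m M 𝕜 :=
  if h : β.IsSmooth then (δ ⟨β, h⟩).1 else 0

theorem extendEnd_apply (δ : Module.End ℝ (smoothForms m M 𝕜)) {β : Form m M 𝕜}
    (h : β.IsSmooth) : extendEnd δ β = (δ ⟨β, h⟩).1 := dif_pos h

theorem IsAdj.isFormalAdjoint {D : Form m M 𝕜 → Form m M 𝕜}
    {D' δ : Module.End ℝ (smoothForms m M 𝕜)} (hD : ∀ η : smoothForms m M 𝕜, D η.1 = (D' η).1)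
    (h : IsAdj g D' δ) : IsFormalAdjoint g D (extendEnd δ) where
  smooth β hβ := by
    rw [extendEnd_apply δ hβ]
    exact (δ ⟨β, hβ⟩).2
  adjoint α β hα hc hβ := by
    rw [extendEnd_apply δ hβ, hD ⟨α, hα⟩]
    exact h.adjoint ⟨α, hα⟩ ⟨β, hβ⟩ hc

/-- An arbitrary formal adjoint, not assumed linear and unconstrained off smooth forms, coincides on
smooth forms with the constructed one by nondegeneracy. -/
theorem IsAdj.eq_of_isFormalAdjoint {D δ' : Form m M 𝕜 → Form m M 𝕜}
    {D' δ : Module.End ℝ (smoothForms m M 𝕜)} (hD : ∀ η : smoothForms m M 𝕜, D η.1 = (D' η).1)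
    (h : IsAdj g D' δ) (h' : IsFormalAdjoint g D δ') (β : smoothForms m M 𝕜) :
    δ' β.1 = (δ β).1 := by
  have h1 : (⟨δ' β.1, h'.smooth β.1 β.2⟩ : smoothForms m M 𝕜) = δ β :=
    eq_of_l2Inner g fun α hα ↦ by
      rw [← h.adjoint α β hα]
      refine (h'.adjoint α.1 β.1 α.2 hα β.2).symm.trans ?_
      rw [hD α]
      rfl
  exact congrArg Subtype.val h1

end Hyperkahler

end HK

end

theorem proposition1 (m : ℕ) (M : Type*) [TopologicalSpace M] [T2Space M]
    [SecondCountableTopology M] [ChartedSpace (EuclideanSpace ℝ (Fin m)) M]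
    [IsManifold (𝓡 m) ∞ M] [MeasurableSpace M] [BorelSpace M]
    (𝕜 : Type*) [RCLike 𝕜]
    (g : HK.Metric m M) (I J K : HK.EndField m M) (hM : HK.IsHyperkahler g I J K) :
    -- (i)
    (∀ (x y : ℍ[ℝ]) (η : HK.Form m M 𝕜), η.IsSmooth →
      HK.Form.hat I J K x (HK.Form.dQ I J K y η) - HK.Form.dQ I J K y (HK.Form.hat I J K x η)
        = HK.Form.dQ I J K (x * y) η) ∧
    -- (ii)
    (∀ (x y : ℍ[ℝ]) (η : HK.Form m M 𝕜), η.IsSmooth →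
      HK.Form.dQ I J K x (HK.Form.dQ I J K y η) + HK.Form.dQ I J K y (HK.Form.dQ I J K x η)
        = 0) ∧
    -- the adjoints exist
    (∀ y : ℍ[ℝ], ∃ δ : HK.Form m M 𝕜 → HK.Form m M 𝕜,
      HK.IsFormalAdjoint g (HK.Form.dQ I J K y) δ) ∧
    (∃ δ : HK.Form m M 𝕜 → HK.Form m M 𝕜, HK.IsFormalAdjoint g HK.Form.d δ) ∧
    -- (iii), with `δy = d_y^*`, `δ = d^*` and `Δ = d d^* + d^* d`
    (∀ (x y : ℍ[ℝ]) (δy δ : HK.Form m M 𝕜 → HK.Form m M 𝕜),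
      HK.IsFormalAdjoint g (HK.Form.dQ I J K y) δy → HK.IsFormalAdjoint g HK.Form.d δ →
      ∀ η : HK.Form m M 𝕜, η.IsSmooth →
        HK.Form.dQ I J K x (δy η) + δy (HK.Form.dQ I J K x η)
          = (star x * y).re • (HK.Form.d (δ η) + δ (HK.Form.d η))) := by
  refine ⟨fun x y η hη ↦ ?_, fun x y η hη ↦ ?_, fun y ↦ ⟨_,
    (HK.isAdj_quatComb hM y).isFormalAdjoint (HK.dQ_eq hM y)⟩, ⟨_,
    (HK.isAdj_dQuad hM 0).isFormalAdjoint fun _ ↦ rfl⟩, fun x y δy δ hδy hδ η hη ↦ ?_⟩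
  · have h := (HK.isQuatModule_dQuad (𝕜 := 𝕜) hM).commutator (HK.gradingEnd_mul_dQuad hM) x y
    exact congrArg Subtype.val (LinearMap.congr_fun h ⟨η, hη⟩)
  · have h := (HK.isQuatModule_dQuad (𝕜 := 𝕜) hM).anticommutator_self HK.dEnd_mul_dEnd x y
    exact congrArg Subtype.val (LinearMap.congr_fun h ⟨η, hη⟩)
  · have h := (HK.isQuatModule_dQuad (𝕜 := 𝕜) hM).anticommutator (HK.isQuatModule_deltaQuad hM)
      (HK.dEnd_anticommute_deltaCEnd _) (HK.dEnd_anticommute_deltaCEnd _)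
      (HK.dEnd_anticommute_deltaCEnd _) x y
    have h1 := (HK.isAdj_quatComb hM y).eq_of_isFormalAdjoint (HK.dQ_eq hM y) hδy
    have h2 := (HK.isAdj_dQuad (𝕜 := 𝕜) hM 0).eq_of_isFormalAdjoint (fun _ ↦ rfl) hδ
    have e1 := h1 ⟨η, hη⟩
    -- The given adjoints are evaluated on η and on the smooth forms d_x η and dη, and replaced
    -- there by the constructed ones.
    have e2 := h1 (HK.quatComb (HK.dQuad 𝕜 hM) x ⟨η, hη⟩)
    have e3 := h2 ⟨η, hη⟩
    have e4 := h2 (HK.dEnd ⟨η, hη⟩)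
    rw [← HK.dQ_eq hM] at e2
    have e4' : δ (HK.Form.d η) = _ := e4
    rw [e1, e2, e3, e4']
    exact congrArg Subtype.val (LinearMap.congr_fun h ⟨η, hη⟩)
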